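/- **Theorem (Utility analysis of CENTAUR for linear representation learning).** *Setting.* Let $n\ge 2$ be the number of clients, $m\le n$ the number of data points per client and $1\le k\le d$. Client $i$ holds inputs $x_{i1},\dots,x_{im}\in\mathbb R^d$, drawn i.i.d. from a law $p_i$, independently over clients. Each $p_i$ has mean $0$, covariance $I_d$ and subgaussian norm at most $K$, that is, $\sup_{\|u\|_2=1}\|\langle u,x\rangle\|_{\psi_2}\le K$ with $\|z\|_{\psi_2}=\inf\{s>0:\mathbb E\exp(z^2/s^2)\le 2\}$. The responses are $y_{ij}={w_i^*}^\top {B^*}^\top x_{ij}$, where $B^*\in\mathbb R^{d\times k}$ has orthonormal columns and $w_i^*\in\mathbb R^k$. Let $W^*\in\mathbb R^{n\times k}$ have rows $w_i^*$, let $s_1\ge\dots\ge s_k>0$ be the singular values of $W^*/\sqrt n$, and $\kappa=s_1/s_k$. Let $\mu>0$ satisfy $\max_i\|w_i^*\|_2\le\mu\sqrt k\,s_k$. Assume $d\ge\kappa^8k^3\log n$. Let $\mathrm{dist}(B,B^*)=\|(I_d-BB^\top)B^*\|_2$. For a set $S$ of data points of client $i$ let $l([w,B];S)=\frac1{|S|}\sum_{j\in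 S}\frac12(w^\top B^\top x_{ij}-y_{ij})^2$. For matrices $A_1,\dots,A_n$ let $\mathrm{GM}_{\zeta,\sigma}(\{A_i\})=\frac1n\big(\sum_i A_i\min\{1,\zeta/\|A_i\|_F\}+\sigma\zeta W\big)$, where $W$ has independent $\mathcal N(0,1)$ entries and is fresh in every call. $\mathrm{QR}(\cdot)$ returns the $Q$-factor of the QR decomposition. *Algorithm.* All mini-batches of a client are drawn uniformly at random without replacement from its data set during the whole run, so they are disjoint. Initialization: run $T_0\ge1$ trials of the private power method. Each trial starts from $X^0=\mathrm{QR}$ of a standard Gaussian matrix and for $l=1,\dots,L$ sets $X^l=\mathrm{QR}(\mathrm{GM}_{\zeta_0,\sigma_0}(\{M_i^lX^{l-1}\}_i))$, where $M_i^l=\frac1{\bar m_0}\sum_j y_{ij}^2x_{ij}x_{ij}^\top$ over a mini-batch of size $\bar m_0$. Among the outputs $B_1,\dots,B_{T_0}$ select $B^0=B_{\hat c}$ such that, for at least half of the indices $c$, all $k$ singular values of $B_c^\top B_{\hat c}$ are at least $1-2\epsilon_i^2$ (any $\hat c$ if there is none). Main loop, for $t=0,\dots,T_g-1$, with all clients participating: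 client $i$ draws mini-batches $S_i^{t,1},S_i^{t,2}$ of size $\bar m$, computes $w_i^{t+1}\in\arg\min_w l([w,B^t];S_i^{t,1})$ and returns $G_i^t=\partial_B l([w_i^{t+1},B^t];S_i^{t,2})$. The server sets $B^{t+1}=\mathrm{QR}\big(B^t-\eta_g\,\mathrm{GM}_{\zeta_g,\sigma_g}(\{G_i^t\}_i)\big)$. *Claim.* For every $K$ there are constants $c_m,c_\zeta,c_T,c_\sigma,c_p,c_d>0$, depending on $K$ only, such that the following holds in every such setting and for all parameters of the initialization. Let the local data suffice for the mini-batches, $T_0L\bar m_0+2T_g\bar m\le m$, and let $$\bar m\ge c_m\max\Big\{\kappa^2k^2\log n,\ \frac{\mu^4k^2d}{n}\Big\},\qquad \zeta_g=c_\zeta\mu^2ks_k^2\sqrt{dk\log n},\qquad \eta_g=\frac1{4s_1^2},$$ $$0<\sigma_g\le\frac{c_\sigma n\kappa^4}{\mu^2d\sqrt{k\log n}},\qquad T_g\ge c_T\kappa^2\log\frac{n}{\kappa^2\eta_g\sigma_g\zeta_g\sqrt d}$$ (in particular, $T_g$ may be the least natural number satisfying the last inequality). Then, conditionally on the event $\mathrm{dist}(B^0,B^*)\le0.2$,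 with probability at least $1-c_p\,\bar m\,T_g\,n^{-k}$, $$\mathrm{dist}(B^{T_g},B^*)\le c_d\,\kappa^2\,\frac{\eta_g\sigma_g\zeta_g\sqrt d}{n}=\tilde c_d\,\frac{\sigma_g\mu^2k^{1.5}d}{n},\qquad \tilde c_d=\frac{c_dc_\zeta}{4}\sqrt{\log n}.$$ -/

import Mathlib

open MeasureTheory ProbabilityTheory
open scoped Matrix ENNReal NNReal

noncomputable section

namespace Centaur

/-! ### Matrices, clipping, the Gaussian mechanism, QR, principal angle distance -/

/-- Real `d × k` matrices. -/
abbrev Mat (d k : ℕ) := Matrix (Fin d) (Fin k) ℝ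

/-- The Frobenius norm. -/
def frobNorm {d k : ℕ} (A : Mat d k) : ℝ := √(∑ a, ∑ b, A a b ^ 2)

/-- The spectral norm: operator norm with respect to the Euclidean norms. -/
def specNorm {d k : ℕ} (A : Mat d k) : ℝ :=
  ‖LinearMap.toContinuousLinearMap (Matrix.toEuclideanLin A)‖

/-- The singular values, in decreasing order and indexed from `0`. -/
def singVal {d k : ℕ} (A : Mat d k) (i : ℕ) : ℝ := (Matrix.toEuclideanLin A).singularValues i

/-- `clip(A; ζ) = A · min{1, ζ / ‖A‖_F}`. -/
def clip {d k : ℕ} (ζ : ℝ) (A : Mat d k) : Mat d k := min 1 (ζ / frobNorm A) • A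

/-- The Gaussian mechanism `(1/s) (∑ clip(A_i; ζ) + σ ζ W)`; `W` is the noise matrix. -/
def gaussMech {s d k : ℕ} (ζ σ : ℝ) (A : Fin s → Mat d k) (W : Mat d k) : Mat d k :=
  (1 / (s : ℝ)) • ((∑ i, clip ζ (A i)) + (σ * ζ) • W)

/-- The `Q`-factor of the (thin) QR decomposition, obtained by Gram-Schmidt on the columns
(so that `R` has a nonnegative diagonal). For a matrix of full column rank it is column
orthonormal; a column that depends on the earlier ones is sent to `0`. -/
def qrQ {d k : ℕ} (A : Mat d k) : Mat d k :=
  Matrix.of fun a b =>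
    InnerProductSpace.gramSchmidtNormed ℝ
      (fun b' : Fin k => (WithLp.toLp 2 (fun a' => A a' b') : EuclideanSpace ℝ (Fin d))) b a

/-- Principal angle distance `dist(B, B') = ‖(I - B Bᵀ) B'‖₂`. -/
def angleDist {d k : ℕ} (B B' : Mat d k) : ℝ := specNorm ((1 - B * Bᵀ) * B')

/-! ### Subgaussian random vectors -/

/-- `‖f‖_{ψ₂} = inf {s > 0 | E exp(f² / s²) ≤ 2}`, with value `∞` if there is no such `s`. -/
def psi2Norm {Ω : Type*} [MeasurableSpace Ω] (ν : Measure Ω) (f : Ω → ℝ) : ℝ≥0∞ :=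
  ⨅ (s : ℝ≥0) (_ : 0 < s)
    (_ : ∫⁻ ω, ENNReal.ofReal (Real.exp (f ω ^ 2 / (s : ℝ) ^ 2)) ∂ν ≤ 2), (s : ℝ≥0∞)

/-- The subgaussian norm of a random vector with law `ν`: the supremum over unit vectors `u` of
`‖⟨u, x⟩‖_{ψ₂}`. -/
def vecPsi2Norm {d : ℕ} (ν : Measure (EuclideanSpace ℝ (Fin d))) : ℝ≥0∞ :=
  ⨆ (u : EuclideanSpace ℝ (Fin d)) (_ : ‖u‖ = 1), psi2Norm ν (fun x => inner ℝ u x)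

/-- A probability law on `ℝ^d` with mean zero, identity covariance and subgaussian norm at
most `K`. (The last condition makes the two integrals below converge.) -/
structure IsIsotropicSubgaussian {d : ℕ} (K : ℝ≥0) (ν : Measure (EuclideanSpace ℝ (Fin d))) :
    Prop where
  prob : IsProbabilityMeasure ν
  mean : ∀ a, ∫ x, x a ∂ν = 0
  cov : ∀ a b, ∫ x, x a * x b ∂ν = if a = b then 1 else 0
  subgaussian : vecPsi2Norm ν ≤ K

/-! ### The linear representation learning problem -/

/-- The inputs `x_{ij}`, `i` a client and `j` one of its `m` data points. -/
abbrev Inputs (n m d : ℕ) := Fin n → Fin m → EuclideanSpace ℝ (Fin d)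

/-- The response `y = w*ᵀ B*ᵀ x`. -/
def response {d k : ℕ} (Bst : Mat d k) (wst : Fin k → ℝ) (x : EuclideanSpace ℝ (Fin d)) : ℝ :=
  wst ⬝ᵥ (Bstᵀ *ᵥ x.ofLp)

/-- The local objective
`l([w, B]; S) = (1/|S|) ∑_{j ∈ S} (1/2) (wᵀ Bᵀ x_j - y_j)²`, for one client with inputs `X`
and responses `y`; a subset of the local data set is given by its indices. -/
def localLoss {m d k : ℕ} (X : Fin m → EuclideanSpace ℝ (Fin d)) (y : Fin m → ℝ)
    (S : Finset (Fin m)) (w : Fin k → ℝ) (B : Mat d k) : ℝ :=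
  (1 / (S.card : ℝ)) * ∑ j ∈ S, (1 / 2) * (w ⬝ᵥ (Bᵀ *ᵥ (X j).ofLp) - y j) ^ 2

/-- The gradient `∂_B l([w, B]; S) = (1/|S|) ∑_{j ∈ S} (wᵀ Bᵀ x_j - y_j) x_j wᵀ`. -/
def localGrad {m d k : ℕ} (X : Fin m → EuclideanSpace ℝ (Fin d)) (y : Fin m → ℝ)
    (S : Finset (Fin m)) (w : Fin k → ℝ) (B : Mat d k) : Mat d k :=
  (1 / (S.card : ℝ)) •
    ∑ j ∈ S, (w ⬝ᵥ (Bᵀ *ᵥ (X j).ofLp) - y j) • Matrix.vecMulVec (X j).ofLp w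

/-- `localGrad` is the gradient of `localLoss` in `B` (for the Frobenius inner product). -/
theorem hasDerivAt_localLoss {m d k : ℕ} (X : Fin m → EuclideanSpace ℝ (Fin d))
    (y : Fin m → ℝ) (S : Finset (Fin m)) (w : Fin k → ℝ) (B H : Mat d k) :
    HasDerivAt (fun t : ℝ => localLoss X y S w (B + t • H))
      (∑ a, ∑ b, localGrad X y S w B a b * H a b) 0 := by
  have key : ∀ j, w ⬝ᵥ (Hᵀ *ᵥ (X j).ofLp) = ∑ a, ∑ b, ((X j).ofLp a * w b) * H a b := by
    intro j
    simp only [dotProduct, Matrix.mulVec, Matrix.transpose_apply, Finset.mul_sum]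
    rw [Finset.sum_comm]
    refine Finset.sum_congr rfl fun a _ => Finset.sum_congr rfl fun b _ => ?_
    ring
  have h1 : ∀ j, HasDerivAt
      (fun t : ℝ => (1 / 2) * (w ⬝ᵥ ((B + t • H)ᵀ *ᵥ (X j).ofLp) - y j) ^ 2)
      ((w ⬝ᵥ (Bᵀ *ᵥ (X j).ofLp) - y j) * (w ⬝ᵥ (Hᵀ *ᵥ (X j).ofLp))) 0 := by
    intro j
    have e : (fun t : ℝ => (1 / 2) * (w ⬝ᵥ ((B + t • H)ᵀ *ᵥ (X j).ofLp) - y j) ^ 2) =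
        fun t : ℝ => (1 / 2) *
          (w ⬝ᵥ (Bᵀ *ᵥ (X j).ofLp) - y j + t * (w ⬝ᵥ (Hᵀ *ᵥ (X j).ofLp))) ^ 2 := by
      funext t
      simp only [Matrix.transpose_add, Matrix.transpose_smul, Matrix.add_mulVec,
        Matrix.smul_mulVec, dotProduct_add, dotProduct_smul, smul_eq_mul]
      ring
    rw [e]
    have h := ((((hasDerivAt_id (0 : ℝ)).mul_const (w ⬝ᵥ (Hᵀ *ᵥ (X j).ofLp))).const_add
      (w ⬝ᵥ (Bᵀ *ᵥ (X j).ofLp) - y j)).pow 2).const_mul (1 / 2 : ℝ)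
    refine (h.congr_deriv ?_)
    simp
    ring
  have h2 := (HasDerivAt.fun_sum (u := S) fun j _ => h1 j).const_mul (1 / (S.card : ℝ))
  refine HasDerivAt.congr_deriv h2 ?_
  simp only [key, localGrad, Matrix.smul_apply, Matrix.sum_apply, Matrix.vecMulVec_apply,
    smul_eq_mul, Finset.mul_sum, Finset.sum_mul]
  rw [Finset.sum_comm]
  refine Finset.sum_congr rfl fun a _ => ?_
  rw [Finset.sum_comm]
  refine Finset.sum_congr rfl fun b _ => Finset.sum_congr rfl fun j _ => ?_
  ring

/-- The local head: a minimizer of `w ↦ l([w, B]; S)` over `ℝ^k`. -/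
def localHead {m d k : ℕ} (X : Fin m → EuclideanSpace ℝ (Fin d)) (y : Fin m → ℝ)
    (S : Finset (Fin m)) (B : Mat d k) : Fin k → ℝ :=
  Classical.epsilon fun w => ∀ w', localLoss X y S w B ≤ localLoss X y S w' B

/-! ### Sampling without replacement

Each client draws its data points one after the other, without replacement, during the whole run;
`π j` is the position at which the data point `j` is drawn, and `π` is a uniformly random
permutation. A mini-batch consists of the data points drawn at consecutive positions. -/

instance permMeasurableSpace (m : ℕ) : MeasurableSpace (Equiv.Perm (Fin m)) := ⊤

/-- The data points drawn at the positions `off, …, off + len - 1`. -/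
def batch {m : ℕ} (π : Equiv.Perm (Fin m)) (off len : ℕ) : Finset (Fin m) :=
  Finset.univ.filter fun j => off ≤ (π j : ℕ) ∧ (π j : ℕ) < off + len

/-! ### Initialization: private power method and cross-validation -/

/-- Private power method with `L` rounds, `X0` the (not yet orthonormalized) starting matrix, `W`
the noise matrices, `S i l` the mini-batch of client `i` in round `l`. It uses
`M_i^l = (1/|S|) ∑_{j ∈ S} y_{ij}² x_{ij} x_{ij}ᵀ`, `Y_i^l = M_i^l X^{l-1}`. -/
def ppm {n m d k L : ℕ} (σ₀ ζ₀ : ℝ) (X : Inputs n m d) (y : Fin n → Fin m → ℝ)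
    (S : Fin n → Fin L → Finset (Fin m)) (X0 : Mat d k) (W : Fin L → Mat d k) : Mat d k :=
  Fin.induction (motive := fun _ : Fin (L + 1) => Mat d k) (qrQ X0)
    (fun l Z => qrQ (gaussMech ζ₀ σ₀
      (fun i => ((1 / ((S i l).card : ℝ)) •
        ∑ j ∈ S i l, (y i j) ^ 2 • Matrix.vecMulVec (X i j).ofLp (X i j).ofLp) * Z)
      (W l)))
    (Fin.last L)

/-- The cross-validation test: the candidate `c'` passes if for at least half of the candidates `c`
all `k` singular values of `B_cᵀ B_{c'}` are at least `1 - 2 ε²`. -/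
def passesTest {d k T₀ : ℕ} (ε : ℝ) (B : Fin T₀ → Mat d k) (c' : Fin T₀) : Prop :=
  T₀ ≤ 2 * Set.ncard {c : Fin T₀ | ∀ i < k, 1 - 2 * ε ^ 2 ≤ singVal ((B c)ᵀ * B c') i}

/-- The candidate that is selected; any one that passes the test (an arbitrary one if there is
none). -/
def crossValidate {d k T₀ : ℕ} [NeZero T₀] (ε : ℝ) (B : Fin T₀ → Mat d k) : Mat d k :=
  B (Classical.epsilon (passesTest ε B))

/-! ### The complete run -/

/-- The hyperparameters other than the numbers of rounds. `m₀`, `σ₀`, `ζ₀`, `εi` belong to the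
initialization; `mbar`, `ηg`, `σg`, `ζg` are the mini-batch size, step size, noise multiplier and
clipping threshold of the main loop. -/
structure Hyper where
  m₀ : ℕ
  σ₀ : ℝ
  ζ₀ : ℝ
  εi : ℝ
  mbar : ℕ
  ηg : ℝ
  σg : ℝ
  ζg : ℝ

/-- All the randomness of a run: the inputs, the orders in which the clients draw their data, the
starting matrices of the `T₀` power method trials, the noise of their `L` rounds, and the noise of
the `T` rounds of the main loop. -/
abbrev Randomness (n m d k T₀ L T : ℕ) :=
  Inputs n m d × (Fin n → Equiv.Perm (Fin m)) × (Fin T₀ → Fin d → Fin k → ℝ) ×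
    (Fin T₀ → Fin L → Fin d → Fin k → ℝ) × (Fin T → Fin d → Fin k → ℝ)

/-- The law of a `d × k` matrix with independent standard Gaussian entries. -/
def gaussMatrix (d k : ℕ) : Measure (Fin d → Fin k → ℝ) :=
  Measure.pi fun _ => Measure.pi fun _ => gaussianReal 0 1

instance (d k : ℕ) : IsProbabilityMeasure (gaussMatrix d k) := by
  unfold gaussMatrix; infer_instance

/-- The law of the randomness of a run: the `x_{ij}` are independent with `x_{ij} ∼ p i`, the
orders are uniformly random, the noise and starting matrices are standard Gaussian, and everything
is independent. -/
def runLaw {n d : ℕ} (m k T₀ L T : ℕ) (p : Fin n → Measure (EuclideanSpace ℝ (Fin d))) :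
    Measure (Randomness n m d k T₀ L T) :=
  (Measure.pi fun i => Measure.pi fun _ : Fin m => p i).prod
    ((Measure.pi fun _ : Fin n =>
        (PMF.uniformOfFintype (Equiv.Perm (Fin m))).toMeasure).prod
      ((Measure.pi fun _ : Fin T₀ => gaussMatrix d k).prod
        ((Measure.pi fun _ : Fin T₀ => Measure.pi fun _ : Fin L => gaussMatrix d k).prod
          (Measure.pi fun _ : Fin T => gaussMatrix d k))))

/-- The responses `y_{ij} = w_i*ᵀ B*ᵀ x_{ij}`. -/
def responses {n m d k : ℕ} (Bst : Mat d k) (Wst : Matrix (Fin n) (Fin k) ℝ)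
    (X : Inputs n m d) : Fin n → Fin m → ℝ :=
  fun i j => response Bst (Wst i) (X i j)

/-- The matrix `B⁰` returned by the initialization: `T₀` trials of the private power method,
started at random column orthonormal matrices (the `Q`-factors of Gaussian matrices) and run on
fresh mini-batches of size `m₀`, followed by cross-validation. -/
def initialization {n m d k T₀ L T : ℕ} [NeZero T₀] (h : Hyper) (Bst : Mat d k)
    (Wst : Matrix (Fin n) (Fin k) ℝ) (ω : Randomness n m d k T₀ L T) : Mat d k :=
  crossValidate h.εi fun c : Fin T₀ =>
    ppm h.σ₀ h.ζ₀ ω.1 (responses Bst Wst ω.1)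
      (fun i l => batch (ω.2.1 i) (((c : ℕ) * L + (l : ℕ)) * h.m₀) h.m₀)
      (Matrix.of (ω.2.2.1 c)) (fun l => Matrix.of (ω.2.2.2.1 c l))

/-- The gradient `G_i^t` that a client returns, given the current `B^t` and its two mini-batches:
the first one determines the local head `w_i^{t+1}`, the second one the gradient. -/
def client {m d k : ℕ} (X : Fin m → EuclideanSpace ℝ (Fin d)) (y : Fin m → ℝ)
    (S₁ S₂ : Finset (Fin m)) (B : Mat d k) : Mat d k :=
  localGrad X y S₂ (localHead X y S₁ B) B

/-- The iterates `B^t`, `0 ≤ t ≤ T`, of the server procedure with full participation of the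
clients: `B^{t+1} = QR(B^t - η_g GM_{ζ_g, σ_g}({G_i^t}_i))`. The `2 T` mini-batches of a client are
drawn after those of the initialization. -/
def iterate {n m d k T₀ L T : ℕ} [NeZero T₀] (h : Hyper) (Bst : Mat d k)
    (Wst : Matrix (Fin n) (Fin k) ℝ) (ω : Randomness n m d k T₀ L T) : Fin (T + 1) → Mat d k :=
  Fin.induction (motive := fun _ : Fin (T + 1) => Mat d k) (initialization h Bst Wst ω)
    (fun t B => qrQ (B - h.ηg • gaussMech h.ζg h.σg
      (fun i => client (ω.1 i) (responses Bst Wst ω.1 i)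
        (batch (ω.2.1 i) (T₀ * L * h.m₀ + 2 * (t : ℕ) * h.mbar) h.mbar)
        (batch (ω.2.1 i) (T₀ * L * h.m₀ + (2 * (t : ℕ) + 1) * h.mbar) h.mbar) B)
      (Matrix.of (ω.2.2.2.2 t))))

/-- The output `B^{T_g}`. -/
def output {n m d k T₀ L T : ℕ} [NeZero T₀] (h : Hyper) (Bst : Mat d k)
    (Wst : Matrix (Fin n) (Fin k) ℝ) (ω : Randomness n m d k T₀ L T) : Mat d k :=
  iterate h Bst Wst ω (Fin.last T)

/-- `s_i = s_i(W* / √n)`, the `i`-th largest singular value, `i = 1, 2, …`. -/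
def headSingVal {n k : ℕ} (Wst : Matrix (Fin n) (Fin k) ℝ) (i : ℕ) : ℝ :=
  singVal ((1 / √(n : ℝ)) • Wst) (i - 1)

end Centaur

end

/-!
The main loop is an inexact alternating minimization, and the proof follows one round of it.

*Deterministic part.* Let `B` be column orthonormal with `D = dist(B, B*) ≤ 0.2`. If the second
moments of a client's first mini-batch are accurate to order `1 / (κ √k)` in the relevant
directions, its least squares head `w i` differs from `Bᵀ B* w*ᵢ` by `0.1 D ‖w*ᵢ‖ / (κ √k)`; since
`∑ ‖w*ᵢ‖² ≤ k n s₁²`, the total error of the heads is a small multiple of `n s_k²`. On the population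
level the step is `B - η avg (B wᵢ - B* w*ᵢ) wᵢᵀ`. Outside the range of `B*` it acts on `B` by
`1 - η avg wᵢ wᵢᵀ`, which shrinks, and it hardly shortens `B` itself, the residual being nearly
orthogonal to the range of `B`. Both effects are compared along each direction `u` with
`ω = avg ⟨wᵢ, u⟩²`, which lies between `0.9 s_k²` and `1.06 s₁²` (`step_contraction`). As the cross
term of heads and errors is bounded by `ω` instead of by a product of operator norms, no factor of
the condition number is lost. With the sampling error of the pooled gradient and the privacy noise
as a perturbation, one round gives `D' ≤ (1 - 0.05 / κ²) D + 32 ν` with `ν = η σ ζ √d / n`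
(`Regime.angleDist_qrQ_rawStep_le`). Clipping is inactive because the residual predictors have size
`√(k log n)` and the inputs size `√d`. After `20 κ² log (1 / (κ² ν))` rounds, `640 κ² ν` and a
geometric term of size `κ² ν` remain. If `3200 κ² ν > 1` the claim is void, since distances are at
most `1`.

*Probabilistic part.* A product of two linear functionals of an isotropic subgaussian vector is
subexponential, so averages over a batch of one client, or over the batches of all clients, obey
Bernstein's inequality; Gaussian noise and single inputs have subgaussian tails. Operator norms are
controlled through nets of the unit balls with `5 ^ k` and `5 ^ d` points. As `k log n ≤ d`, a round
that starts from a fixed `B` fails with probability at most `8 m̄ n⁻ᵏ`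
(`Regime.measure_not_goodStep_le`). The head is computed from the first mini-batch and the gradient
from the second one, so the gradient bound is applied conditionally on the first.

*Independence.* Sampling without replacement lists the data of a client in random order. For any
orders, the data points at distinct positions are independent, so the run is driven by independent
blocks: that of the initialization, and one block of two mini-batches and a noise matrix for each
round (`measurePreserving_parts`). The state before a round is a function of the earlier blocks, so
the failure probabilities of the rounds add up (`measure_exists_bad_le`), also on the event that the
initialization succeeds. The algorithm picks minimizers arbitrarily, which need not be measurable;
the explicit formula `headOf` is measurable and agrees with them as long as no round fails
(`Regime.iterate_eq_traj`).
-/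

namespace Centaur

open ContinuousLinearMap InnerProductSpace

/-! ### Isometries, principal angles and the contraction of one step -/

section Abstract

variable {V E : Type*} [NormedAddCommGroup V] [InnerProductSpace ℝ V]
  [NormedAddCommGroup E] [InnerProductSpace ℝ E]

variable {B Bs : V →L[ℝ] E}

lemma norm_isometry (hB : ∀ u v, inner ℝ (B u) (B v) = inner ℝ u v) (u : V) : ‖B u‖ = ‖u‖ := by
  have := hB u u
  rw [real_inner_self_eq_norm_sq, real_inner_self_eq_norm_sq] at this
  exact (pow_left_inj₀ (norm_nonneg _) (norm_nonneg _) two_ne_zero).1 this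

variable [FiniteDimensional ℝ V] [FiniteDimensional ℝ E]

/-- The residual `x ↦ x - B (B† x)`; for an isometry `B` this is the orthogonal projection onto
the complement of the range of `B`. -/
noncomputable def residual (B : V →L[ℝ] E) : E →L[ℝ] E := 1 - B ∘L adjoint B

lemma residual_apply (B : V →L[ℝ] E) (x : E) : residual B x = x - B (adjoint B x) := rfl

lemma adjoint_apply_self (hB : ∀ u v, inner ℝ (B u) (B v) = inner ℝ u v) (u : V) :
    adjoint B (B u) = u := by
  refine ext_inner_right ℝ fun v => ?_
  rw [adjoint_inner_left, hB]

lemma adjoint_residual (hB : ∀ u v, inner ℝ (B u) (B v) = inner ℝ u v) (x : E) :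
    adjoint B (residual B x) = 0 := by
  rw [residual_apply, map_sub, adjoint_apply_self hB, sub_self]

lemma residual_self (hB : ∀ u v, inner ℝ (B u) (B v) = inner ℝ u v) (u : V) :
    residual B (B u) = 0 := by
  rw [residual_apply, adjoint_apply_self hB, sub_self]

lemma norm_residual_sq (hB : ∀ u v, inner ℝ (B u) (B v) = inner ℝ u v) (x : E) :
    ‖residual B x‖ ^ 2 = ‖x‖ ^ 2 - ‖adjoint B x‖ ^ 2 := by
  have h1 : inner ℝ x (B (adjoint B x)) = ‖adjoint B x‖ ^ 2 := by
    rw [← adjoint_inner_left, real_inner_self_eq_norm_sq]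
  rw [residual_apply, norm_sub_sq_real, h1, norm_isometry hB]
  ring

lemma norm_residual_le (hB : ∀ u v, inner ℝ (B u) (B v) = inner ℝ u v) (x : E) :
    ‖residual B x‖ ≤ ‖x‖ := by
  have := norm_residual_sq hB x
  exact abs_le_of_sq_le_sq' (by nlinarith [sq_nonneg ‖adjoint B x‖]) (norm_nonneg _) |>.2

lemma norm_adjoint_le (hB : ∀ u v, inner ℝ (B u) (B v) = inner ℝ u v) (x : E) :
    ‖adjoint B x‖ ≤ ‖x‖ := by
  have := norm_residual_sq hB x
  exact abs_le_of_sq_le_sq' (by nlinarith [sq_nonneg ‖residual B x‖]) (norm_nonneg _) |>.2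

/-- Two subspaces of equal dimension have the same largest principal angle seen from either side:
the smallest singular values of `B† B*` and of its adjoint agree. -/
lemma norm_residual_symm (hB : ∀ u v, inner ℝ (B u) (B v) = inner ℝ u v)
    (hBs : ∀ u v, inner ℝ (Bs u) (Bs v) = inner ℝ u v) {D : ℝ} (hD1 : D < 1)
    (h : ∀ u, ‖residual B (Bs u)‖ ≤ D * ‖u‖) (u : V) : ‖residual Bs (B u)‖ ≤ D * ‖u‖ := by
  rcases eq_or_ne u 0 with rfl | hu
  · simp
  have hu' : 0 < ‖u‖ := norm_pos_iff.2 hu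
  have hD0 : 0 ≤ D := by
    have := (norm_nonneg _).trans (h u)
    exact nonneg_of_mul_nonneg_left this hu'
  let S : V →ₗ[ℝ] V := (adjoint B ∘L Bs : V →L[ℝ] V)
  have hS : ∀ z, (1 - D ^ 2) * ‖z‖ ^ 2 ≤ ‖S z‖ ^ 2 := by
    intro z
    have h1 := norm_residual_sq hB (Bs z)
    rw [norm_isometry hBs] at h1
    have h2 := pow_le_pow_left₀ (norm_nonneg _) (h z) 2
    have : ‖S z‖ = ‖adjoint B (Bs z)‖ := rfl
    rw [this]
    nlinarith
  have hpos : 0 < 1 - D ^ 2 := by nlinarith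
  have hinj : Function.Injective S := by
    rw [← LinearMap.ker_eq_bot, LinearMap.ker_eq_bot']
    intro z hz
    have := hS z
    rw [hz, norm_zero] at this
    have h0 : ‖z‖ ^ 2 ≤ 0 := by nlinarith [sq_nonneg ‖z‖]
    exact norm_eq_zero.1 (pow_eq_zero_iff two_ne_zero |>.1 (le_antisymm h0 (sq_nonneg _)))
  obtain ⟨z, hz⟩ := (LinearMap.injective_iff_surjective.1 hinj) u
  have hz' : adjoint B (Bs z) = u := hz
  have hz0 : 0 < ‖z‖ := by
    rw [norm_pos_iff]; rintro rfl; exact hu (by simpa using hz.symm)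
  have h3 : ‖u‖ ^ 2 ≤ ‖adjoint Bs (B u)‖ * ‖z‖ := by
    calc ‖u‖ ^ 2 = inner ℝ u (adjoint B (Bs z)) := by rw [hz', real_inner_self_eq_norm_sq]
      _ = inner ℝ (adjoint Bs (B u)) z := by rw [adjoint_inner_right, adjoint_inner_left]
      _ ≤ _ := real_inner_le_norm _ _
  have h4 : (1 - D ^ 2) * ‖z‖ ^ 2 ≤ ‖u‖ ^ 2 := by
    have := hS z; rwa [hz] at this
  have h5 : (1 - D ^ 2) * ‖u‖ ^ 2 ≤ ‖adjoint Bs (B u)‖ ^ 2 := by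
    have h6 : (‖u‖ ^ 2) ^ 2 ≤ (‖adjoint Bs (B u)‖ * ‖z‖) ^ 2 :=
      pow_le_pow_left₀ (sq_nonneg _) h3 2
    have h7 : (1 - D ^ 2) * ‖u‖ ^ 2 * ‖z‖ ^ 2 ≤ ‖adjoint Bs (B u)‖ ^ 2 * ‖z‖ ^ 2 := by
      nlinarith [mul_le_mul_of_nonneg_left h4 (sq_nonneg ‖u‖)]
    exact le_of_mul_le_mul_right h7 (by positivity)
  have h8 := norm_residual_sq hBs (B u)
  rw [norm_isometry hB] at h8
  refine (abs_le_of_sq_le_sq' ?_ (by positivity)).2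
  rw [h8]; nlinarith

set_option maxHeartbeats 1000000 in
/-- One noisy alternating step contracts the principal angle. Here `w i` are the local heads,
`h i = w i - B† B* w* i` their errors and `B w i - B* w* i` the residual predictors, so that
`B - η avg (B w i - B* w* i) ⊗ w i` is the population gradient step; `Z` collects the sampling error
and the privacy noise. The cross term `⟨H u, W u⟩` is compared with `‖W u‖²` rather than bounded by
operator norms: this is what makes an error `‖H‖ ≪ s_k` sufficient, with no loss of a factor of the
condition number. -/
lemma step_contraction {n : ℕ} (hn : 0 < n) (hB : ∀ u v, inner ℝ (B u) (B v) = inner ℝ u v)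
    (hBs : ∀ u v, inner ℝ (Bs u) (Bs v) = inner ℝ u v) {D s1 sk e : ℝ}
    (hD0 : 0 ≤ D) (hD : D ≤ 0.2) (hDB : ∀ u, ‖residual B (Bs u)‖ ≤ D * ‖u‖)
    (hsk : 0 < sk) (hs : sk ≤ s1) (w ws : Fin n → V)
    (hlow : ∀ u, n * sk ^ 2 * ‖u‖ ^ 2 ≤ ∑ i, inner ℝ (ws i) u ^ 2)
    (hup : ∀ u, ∑ i, inner ℝ (ws i) u ^ 2 ≤ n * s1 ^ 2 * ‖u‖ ^ 2)
    (hh : ∑ i, ‖w i - adjoint B (Bs (ws i))‖ ^ 2 ≤ n * (0.0004 * sk ^ 2))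
    (Z : V →L[ℝ] E) (hZ : ∀ u, ‖Z u‖ ≤ e * ‖u‖) (he0 : 0 ≤ e) (he : e ≤ 0.02)
    (Bp : V →L[ℝ] E)
    (hBp : ∀ u, Bp u = B u - (1 / (4 * s1 ^ 2)) •
      ((1 / (n : ℝ)) • ∑ i, inner ℝ (w i) u • (B (w i) - Bs (ws i))) - Z u) (u : V) :
    ‖residual Bs (Bp u)‖ ≤ (D * (1 - 0.11 * (sk / s1) ^ 2) + 2 * e) * ‖Bp u‖ ∧
      0.9 * ‖u‖ ≤ ‖Bp u‖ := by
  have hn' : (0 : ℝ) < n := by exact_mod_cast hn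
  have hs1 : 0 < s1 := hsk.trans_le hs
  -- by homogeneity it is enough to treat unit vectors
  suffices H : ∀ u : V, ‖u‖ = 1 →
      ‖residual Bs (Bp u)‖ ≤ (D * (1 - 0.11 * (sk / s1) ^ 2) + 2 * e) * ‖Bp u‖ ∧
      0.9 ≤ ‖Bp u‖ by
    rcases eq_or_ne u 0 with rfl | hu
    · simp
    have hu' : 0 < ‖u‖ := norm_pos_iff.2 hu
    have h1 : ‖(‖u‖⁻¹ • u)‖ = 1 := by
      rw [norm_smul, norm_inv, norm_norm, inv_mul_cancel₀ hu'.ne']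
    obtain ⟨h2, h3⟩ := H _ h1
    simp only [map_smul, norm_smul, norm_inv, norm_norm] at h2 h3
    constructor
    · have := mul_le_mul_of_nonneg_left h2 hu'.le
      rw [← mul_assoc, mul_inv_cancel₀ hu'.ne', one_mul] at this
      refine this.trans (le_of_eq ?_)
      field_simp
    · have := mul_le_mul_of_nonneg_left h3 hu'.le
      rw [← mul_assoc, mul_inv_cancel₀ hu'.ne', one_mul] at this
      linarith
  intro u hu
  set h : Fin n → V := fun i => w i - adjoint B (Bs (ws i)) with hhdef
  set ω : ℝ := (1 / (n : ℝ)) * ∑ i, inner ℝ (w i) u ^ 2 with hω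
  set η : ℝ := 1 / (4 * s1 ^ 2) with hη
  have hη0 : 0 < η := by positivity
  set g : V := (1 / (n : ℝ)) • ∑ i, inner ℝ (w i) u • w i with hg
  -- the error part of the heads is small in every direction
  have hβ : ∀ z : V, ∑ i, inner ℝ (h i) z ^ 2 ≤ n * (0.0004 * sk ^ 2) * ‖z‖ ^ 2 := by
    intro z
    calc ∑ i, inner ℝ (h i) z ^ 2 ≤ ∑ i, ‖h i‖ ^ 2 * ‖z‖ ^ 2 := by
          refine Finset.sum_le_sum fun i _ => ?_
          rw [← mul_pow, ← sq_abs]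
          exact pow_le_pow_left₀ (abs_nonneg _) (abs_real_inner_le_norm _ _) 2
      _ ≤ _ := by
          rw [← Finset.sum_mul]
          exact mul_le_mul_of_nonneg_right hh (sq_nonneg _)
  have hsplit : ∀ i (z : V), inner ℝ (w i) z =
      inner ℝ (ws i) (adjoint Bs (B z)) + inner ℝ (h i) z := by
    intro i z
    rw [hhdef, adjoint_inner_right, ← adjoint_inner_left, ← inner_add_left]
    congr 1; simp
  -- bounds on the quadratic form of the heads, from those of the true heads along `Bs† B z`
  have hupw : ∀ z : V, ∑ i, inner ℝ (w i) z ^ 2 ≤ n * (1.06 * s1 ^ 2) * ‖z‖ ^ 2 := by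
    intro z
    calc ∑ i, inner ℝ (w i) z ^ 2
        ≤ ∑ i, (1.05 * inner ℝ (ws i) (adjoint Bs (B z)) ^ 2 + 21 * inner ℝ (h i) z ^ 2) := by
          refine Finset.sum_le_sum fun i _ => ?_
          rw [hsplit]
          nlinarith [sq_nonneg (inner ℝ (ws i) (adjoint Bs (B z)) - 20 * inner ℝ (h i) z)]
      _ = 1.05 * ∑ i, inner ℝ (ws i) (adjoint Bs (B z)) ^ 2 + 21 * ∑ i, inner ℝ (h i) z ^ 2 := by
          rw [Finset.sum_add_distrib, Finset.mul_sum, Finset.mul_sum]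
      _ ≤ 1.05 * (n * s1 ^ 2 * ‖z‖ ^ 2) + 21 * (n * (0.0004 * sk ^ 2) * ‖z‖ ^ 2) := by
          gcongr
          · refine (hup _).trans ?_
            gcongr
            exact (norm_adjoint_le hBs _).trans (norm_isometry hB z).le
          · exact hβ z
      _ ≤ _ := by
          have : sk ^ 2 ≤ s1 ^ 2 := pow_le_pow_left₀ hsk.le hs 2
          have : n * sk ^ 2 * ‖z‖ ^ 2 ≤ n * s1 ^ 2 * ‖z‖ ^ 2 := by gcongr
          nlinarith [mul_nonneg (mul_nonneg hn'.le (sq_nonneg s1)) (sq_nonneg ‖z‖)]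
  have hloww : 0.9 * sk ^ 2 ≤ ω := by
    have hD2 : 0.96 ≤ ‖adjoint Bs (B u)‖ ^ 2 := by
      have h1 := norm_residual_sq hBs (B u)
      have h2 := norm_residual_symm hB hBs (by linarith) hDB u
      rw [norm_isometry hB, hu] at h1
      rw [hu, mul_one] at h2
      nlinarith [norm_nonneg (residual Bs (B u))]
    have h3 : ∑ i, (0.95 * inner ℝ (ws i) (adjoint Bs (B u)) ^ 2 - 19 * inner ℝ (h i) u ^ 2)
        ≤ ∑ i, inner ℝ (w i) u ^ 2 := by
      refine Finset.sum_le_sum fun i _ => ?_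
      rw [hsplit]
      nlinarith [sq_nonneg (inner ℝ (ws i) (adjoint Bs (B u)) + 20 * inner ℝ (h i) u)]
    rw [Finset.sum_sub_distrib, ← Finset.mul_sum, ← Finset.mul_sum] at h3
    have h4 := hlow (adjoint Bs (B u))
    have h5 := hβ u
    rw [hu] at h5
    have h6 : n * sk ^ 2 * 0.96 ≤ n * sk ^ 2 * ‖adjoint Bs (B u)‖ ^ 2 := by gcongr
    have h7 : n * (0.9 * sk ^ 2) ≤ ∑ i, inner ℝ (w i) u ^ 2 := by
      have : 0 ≤ n * sk ^ 2 := by positivity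
      linarith
    rw [hω, one_div, inv_mul_eq_div, le_div_iff₀ hn']
    linarith
  have hωup : ω ≤ 1.06 * s1 ^ 2 := by
    have := hupw u
    rw [hu] at this
    rw [hω, one_div, inv_mul_eq_div, div_le_iff₀ hn']
    linarith
  have hgu : inner ℝ g u = ω := by
    rw [hg, hω, real_inner_smul_left, sum_inner]
    congr 1
    refine Finset.sum_congr rfl fun i _ => ?_
    rw [real_inner_smul_left]; ring
  -- Cauchy-Schwarz over the clients
  have hgn : ‖g‖ ^ 2 ≤ 1.06 * s1 ^ 2 * ω := by
    have h1 : ‖g‖ ^ 2 = (1 / (n : ℝ)) * ∑ i, inner ℝ (w i) u * inner ℝ (w i) g := by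
      rw [← real_inner_self_eq_norm_sq]
      nth_rw 1 [hg]
      rw [real_inner_smul_left, sum_inner]
      congr 1
      refine Finset.sum_congr rfl fun i _ => ?_
      rw [real_inner_smul_left]
    have h2 := Finset.sum_mul_sq_le_sq_mul_sq Finset.univ (fun i => inner ℝ (w i) u)
      (fun i => inner ℝ (w i) g)
    have h3 := hupw g
    have h4 : (n * ‖g‖ ^ 2) ^ 2 ≤ (n * ω) * (n * (1.06 * s1 ^ 2) * ‖g‖ ^ 2) := by
      have e1 : n * ‖g‖ ^ 2 = ∑ i, inner ℝ (w i) u * inner ℝ (w i) g := by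
        rw [h1]; field_simp
      have e2 : n * ω = ∑ i, inner ℝ (w i) u ^ 2 := by rw [hω]; field_simp
      rw [e1, e2]
      exact h2.trans (mul_le_mul_of_nonneg_left h3 (by positivity))
    rcases (sq_nonneg ‖g‖).eq_or_lt with h5 | h5
    · rw [← h5]
      have : 0 ≤ ω := by nlinarith [sq_nonneg sk]
      positivity
    · have h6 : ‖g‖ ^ 2 * (n ^ 2 * ‖g‖ ^ 2) ≤ (1.06 * s1 ^ 2 * ω) * (n ^ 2 * ‖g‖ ^ 2) := by
        nlinarith
      exact le_of_mul_le_mul_right h6 (by positivity)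
  -- `a` is the amount by which the step shrinks the direction `u`
  set a : ℝ := η * ω with ha
  have hηs : η * s1 ^ 2 = 1 / 4 := by rw [hη]; field_simp
  have ha_low : 0.225 * (sk / s1) ^ 2 ≤ a := by
    have : η * (0.9 * sk ^ 2) ≤ a := by rw [ha]; gcongr
    refine le_trans (le_of_eq ?_) this
    rw [hη]; field_simp; norm_num
  have ha_up : a ≤ 0.265 := by
    have : a ≤ η * (1.06 * s1 ^ 2) := by rw [ha]; gcongr
    linarith
  have ha0 : 0 ≤ a := le_trans (by positivity) ha_low
  have hA : ‖u - η • g‖ ≤ 1 - 0.8 * a := by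
    refine (abs_le_of_sq_le_sq' ?_ (by linarith)).2
    rw [norm_sub_sq_real, hu, norm_smul, real_inner_smul_right, real_inner_comm, hgu,
      Real.norm_of_nonneg hη0.le]
    have h1 : (η * ‖g‖) ^ 2 ≤ 0.265 * a := by
      calc (η * ‖g‖) ^ 2 = η * (η * ‖g‖ ^ 2) := by ring
        _ ≤ η * (η * (1.06 * s1 ^ 2 * ω)) := by gcongr
        _ = η * s1 ^ 2 * 1.06 * a := by rw [ha]; ring
        _ = 0.265 * a := by rw [hηs]; ring
    nlinarith
  -- the component outside the range of `Bs`: the gradient contributes nothing from `Bs` itself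
  have hP : ‖residual Bs (Bp u)‖ ≤ D * (1 - 0.8 * a) + e := by
    have h1 : residual Bs (Bp u) = residual Bs (B (u - η • g)) - residual Bs (Z u) := by
      rw [hBp u, map_sub, map_sub, map_sub, map_sub, map_smul, map_smul]
      congr 2
      rw [hg, map_smul, map_smul, map_smul, map_smul, map_sum, map_sum, map_sum]
      congr 2
      refine Finset.sum_congr rfl fun i _ => ?_
      rw [map_smul, map_smul, map_smul, map_sub, residual_self hBs, sub_zero]
    rw [h1]
    refine (norm_sub_le _ _).trans (add_le_add ?_ ?_)
    · refine (norm_residual_symm hB hBs (by linarith) hDB _).trans ?_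
      gcongr
    · refine (norm_residual_le hBs _).trans ((hZ u).trans ?_)
      rw [hu, mul_one]
  -- the component along `B u`, which the step barely shortens: only the errors of the heads and
  -- the noise contribute
  have hQ : 1 - 0.05 * a - e ≤ ‖Bp u‖ := by
    have h1 : inner ℝ (B u) (Bp u) =
        1 - η * ((1 / (n : ℝ)) * ∑ i, inner ℝ (w i) u * inner ℝ (h i) u) - inner ℝ (B u) (Z u) := by
      rw [hBp u, inner_sub_right, inner_sub_right, hB, real_inner_self_eq_norm_sq, hu, one_pow,
        real_inner_smul_right, real_inner_smul_right, inner_sum]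
      congr 3
      congr 1
      refine Finset.sum_congr rfl fun i _ => ?_
      rw [real_inner_smul_right, inner_sub_right, hB, ← adjoint_inner_right, ← inner_sub_right]
      exact congrArg _ (real_inner_comm _ _)
    have h2 : (1 / (n : ℝ)) * ∑ i, inner ℝ (w i) u * inner ℝ (h i) u ≤ 0.05 * ω := by
      have h3 : ∑ i, inner ℝ (w i) u * inner ℝ (h i) u ≤
          ∑ i, (0.025 * inner ℝ (w i) u ^ 2 + 10 * inner ℝ (h i) u ^ 2) := by
        refine Finset.sum_le_sum fun i _ => ?_
        nlinarith [sq_nonneg (inner ℝ (w i) u - 20 * inner ℝ (h i) u)]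
      rw [Finset.sum_add_distrib, ← Finset.mul_sum, ← Finset.mul_sum] at h3
      have h4 := hβ u
      rw [hu] at h4
      have e2 : ∑ i, inner ℝ (w i) u ^ 2 = n * ω := by rw [hω]; field_simp
      rw [one_div, inv_mul_eq_div, div_le_iff₀ hn']
      have h5 : n * (0.9 * sk ^ 2) ≤ n * ω := by gcongr
      rw [e2] at h3
      have h6 : 0 ≤ n * sk ^ 2 := by positivity
      linarith
    have h3 : inner ℝ (B u) (Z u) ≤ e := by
      refine (real_inner_le_norm _ _).trans ?_
      rw [norm_isometry hB, hu, one_mul]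
      simpa [hu] using hZ u
    have h4 : inner ℝ (B u) (Bp u) ≤ ‖Bp u‖ := by
      refine (real_inner_le_norm _ _).trans ?_
      rw [norm_isometry hB, hu, one_mul]
    have h5 := mul_le_mul_of_nonneg_left h2 hη0.le
    rw [ha]
    linarith
  refine ⟨?_, by linarith⟩
  have hr : D * (1 - 0.5 * a) + 2 * e ≤ D * (1 - 0.11 * (sk / s1) ^ 2) + 2 * e := by
    have : 0 ≤ (sk / s1) ^ 2 := sq_nonneg _
    have := mul_le_mul_of_nonneg_left
      (show 1 - 0.5 * a ≤ 1 - 0.11 * (sk / s1) ^ 2 by linarith) hD0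
    linarith
  have hr0 : 0 ≤ D * (1 - 0.5 * a) + 2 * e := by
    have : 0 ≤ D * (1 - 0.5 * a) := mul_nonneg hD0 (by linarith)
    linarith
  calc ‖residual Bs (Bp u)‖ ≤ D * (1 - 0.8 * a) + e := hP
    _ ≤ (D * (1 - 0.5 * a) + 2 * e) * (1 - 0.05 * a - e) := by
        have hDa : 0 ≤ D * a := mul_nonneg hD0 ha0
        have hae : 0 ≤ a * e := mul_nonneg ha0 he0
        have hDe : D * e ≤ 0.2 * e := by gcongr
        have hee : e * e ≤ 0.02 * e := by gcongr
        have haee : a * e ≤ 0.265 * e := by gcongr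
        have hDaa : 0 ≤ D * a * a := mul_nonneg hDa ha0
        have hDae : 0 ≤ D * a * e := mul_nonneg hDa he0
        nlinarith
    _ ≤ (D * (1 - 0.5 * a) + 2 * e) * ‖Bp u‖ := by gcongr
    _ ≤ _ := by gcongr

end Abstract

/-! ### Matrices as operators -/

/-- The operator between Euclidean spaces given by a matrix. -/
noncomputable def op {d k : ℕ} (A : Mat d k) :
    EuclideanSpace ℝ (Fin k) →L[ℝ] EuclideanSpace ℝ (Fin d) :=
  LinearMap.toContinuousLinearMap (Matrix.toEuclideanLin A)

section Op

variable {d k l : ℕ}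

lemma ofLp_op (A : Mat d k) (u : EuclideanSpace ℝ (Fin k)) : (op A u).ofLp = A *ᵥ u.ofLp := by
  simp [op, Matrix.ofLp_toLpLin]

lemma op_toLp (A : Mat d k) (u : Fin k → ℝ) : op A (WithLp.toLp 2 u) = WithLp.toLp 2 (A *ᵥ u) := by
  simp [op]

lemma specNorm_eq (A : Mat d k) : specNorm A = ‖op A‖ := rfl

lemma op_add (A B : Mat d k) : op (A + B) = op A + op B := by simp [op]

lemma op_sub (A B : Mat d k) : op (A - B) = op A - op B := by simp [op]

lemma op_smul (c : ℝ) (A : Mat d k) : op (c • A) = c • op A := by simp [op]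

lemma op_sum {ι : Type*} (s : Finset ι) (A : ι → Mat d k) :
    op (∑ i ∈ s, A i) = ∑ i ∈ s, op (A i) := by
  simp [op]

lemma op_mul_apply (A : Mat d k) (B : Mat k l) (u : EuclideanSpace ℝ (Fin l)) :
    op (A * B) u = op A (op B u) := by
  refine WithLp.ofLp_injective 2 ?_
  simp [ofLp_op, Matrix.mulVec_mulVec]

lemma op_one_apply (u : EuclideanSpace ℝ (Fin k)) : op (1 : Mat k k) u = u := by
  refine WithLp.ofLp_injective 2 ?_
  simp [ofLp_op]

lemma inner_eq_dotProduct (u v : EuclideanSpace ℝ (Fin k)) : inner ℝ u v = u.ofLp ⬝ᵥ v.ofLp := by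
  rw [dotProduct_comm]; rfl

lemma adjoint_op (A : Mat d k) : adjoint (op A) = op Aᵀ := by
  symm
  rw [eq_adjoint_iff]
  intro x y
  rw [inner_eq_dotProduct, inner_eq_dotProduct, ofLp_op, ofLp_op, Matrix.mulVec_transpose,
    Matrix.dotProduct_mulVec]

lemma op_vecMulVec (x : EuclideanSpace ℝ (Fin d)) (w u : EuclideanSpace ℝ (Fin k)) :
    op (Matrix.vecMulVec x.ofLp w.ofLp) u = inner ℝ w u • x := by
  refine WithLp.ofLp_injective 2 ?_
  rw [ofLp_op, Matrix.vecMulVec_mulVec, inner_eq_dotProduct]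
  ext; simp [mul_comm]

lemma inner_op_of_isometry {B : Mat d k} (hB : Bᵀ * B = 1) (u v : EuclideanSpace ℝ (Fin k)) :
    inner ℝ (op B u) (op B v) = inner ℝ u v := by
  rw [← adjoint_inner_left, adjoint_op, ← op_mul_apply, hB, op_one_apply]

lemma op_residual (B B' : Mat d k) (u : EuclideanSpace ℝ (Fin k)) :
    op ((1 - B * Bᵀ) * B') u = residual (op B) (op B' u) := by
  rw [op_mul_apply, op_sub, _root_.sub_apply, op_one_apply, op_mul_apply,
    residual_apply, adjoint_op]

lemma angleDist_le_iff {B B' : Mat d k} {D : ℝ} (hD : 0 ≤ D) :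
    angleDist B B' ≤ D ↔ ∀ u, ‖residual (op B) (op B' u)‖ ≤ D * ‖u‖ := by
  unfold angleDist
  rw [specNorm_eq, opNorm_le_iff hD]
  simp only [op_residual]

lemma angleDist_nonneg (B B' : Mat d k) : 0 ≤ angleDist B B' := norm_nonneg _

lemma norm_residual_le_angleDist (B B' : Mat d k) (u : EuclideanSpace ℝ (Fin k)) :
    ‖residual (op B) (op B' u)‖ ≤ angleDist B B' * ‖u‖ :=
  (angleDist_le_iff (angleDist_nonneg B B')).1 le_rfl u

end Op

/-! ### The `Q`-factor -/

section QR

variable {d k : ℕ}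

/-- The columns of a matrix as Euclidean vectors. -/
noncomputable def cols (A : Mat d k) (b : Fin k) : EuclideanSpace ℝ (Fin d) :=
  WithLp.toLp 2 fun a => A a b

lemma op_eq_sum_cols (A : Mat d k) (u : EuclideanSpace ℝ (Fin k)) :
    op A u = ∑ b, u b • cols A b := by
  refine WithLp.ofLp_injective 2 ?_
  rw [ofLp_op]
  ext a
  simp [Matrix.mulVec, dotProduct, cols, mul_comm]

lemma cols_qrQ (A : Mat d k) (b : Fin k) :
    cols (qrQ A) b = gramSchmidtNormed ℝ (cols A) b := by
  refine WithLp.ofLp_injective 2 ?_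
  ext a
  simp only [qrQ, cols, Matrix.of_apply]
  rfl

lemma range_op_eq_span (A : Mat d k) :
    Set.range (op A) =
      (Submodule.span ℝ (Set.range (cols A)) : Set (EuclideanSpace ℝ (Fin d))) := by
  ext x
  rw [SetLike.mem_coe, Submodule.mem_span_range_iff_exists_fun]
  constructor
  · rintro ⟨u, rfl⟩
    exact ⟨u.ofLp, (op_eq_sum_cols A u).symm⟩
  · rintro ⟨c, rfl⟩
    exact ⟨WithLp.toLp 2 c, by rw [op_eq_sum_cols]⟩

lemma range_op_qrQ (A : Mat d k) : Set.range (op (qrQ A)) = Set.range (op A) := by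
  rw [range_op_eq_span, range_op_eq_span]
  have : cols (qrQ A) = gramSchmidtNormed ℝ (cols A) := funext (cols_qrQ A)
  rw [this, span_gramSchmidtNormed_range, span_gramSchmidt]

lemma qrQ_isometry {A : Mat d k} (hA : Function.Injective (op A)) : (qrQ A)ᵀ * qrQ A = 1 := by
  have hli : LinearIndependent ℝ (cols A) := by
    rw [Fintype.linearIndependent_iff]
    intro g hg
    have h1 : op A (WithLp.toLp 2 g) = op A 0 := by
      rw [op_eq_sum_cols, map_zero]; exact hg
    have := hA h1
    intro i
    have h2 := congrArg (fun v : EuclideanSpace ℝ (Fin k) => v i) this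
    simpa using h2
  have ho := gramSchmidtNormed_orthonormal (𝕜 := ℝ) hli
  ext b b'
  rw [orthonormal_iff_ite] at ho
  have := ho b b'
  rw [← cols_qrQ, ← cols_qrQ, inner_eq_dotProduct] at this
  rw [Matrix.mul_apply, Matrix.one_apply, ← this]
  rfl

/-- For the `Q`-factor of any matrix, degenerate or not, `x ↦ x - Q Qᵀ x` is a contraction. -/
lemma norm_residual_qrQ_le (A : Mat d k) (x : EuclideanSpace ℝ (Fin d)) :
    ‖residual (op (qrQ A)) x‖ ≤ ‖x‖ := by
  set Q := qrQ A with hQ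
  have horth : ∀ b b', b ≠ b' → inner ℝ (cols Q b) (cols Q b') = 0 := by
    intro b b' hbb
    rw [hQ, cols_qrQ, cols_qrQ, gramSchmidtNormed, gramSchmidtNormed, inner_smul_left,
      inner_smul_right, gramSchmidt_orthogonal ℝ (cols A) hbb]
    simp
  have hnorm : ∀ b, ‖cols Q b‖ ^ 2 ≤ 1 := by
    intro b
    rw [hQ, cols_qrQ]
    by_cases h0 : gramSchmidtNormed ℝ (cols A) b = 0
    · simp [h0]
    · rw [gramSchmidtNormed_unit_length' h0]; norm_num
  have hQu : ∀ u, ‖op Q u‖ ^ 2 ≤ ‖u‖ ^ 2 := by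
    intro u
    rw [op_eq_sum_cols, ← real_inner_self_eq_norm_sq, sum_inner, EuclideanSpace.norm_sq_eq]
    refine Finset.sum_le_sum fun b _ => ?_
    rw [inner_sum, Finset.sum_eq_single b]
    · rw [real_inner_smul_left, real_inner_smul_right, real_inner_self_eq_norm_sq, Real.norm_eq_abs,
        sq_abs]
      nlinarith [hnorm b, sq_nonneg (u b)]
    · intro b' _ hb'
      rw [real_inner_smul_left, real_inner_smul_right, horth b b' hb'.symm]; simp
    · simp
  have h1 : inner ℝ x (op Q (adjoint (op Q) x)) = ‖adjoint (op Q) x‖ ^ 2 := by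
    rw [← adjoint_inner_left, real_inner_self_eq_norm_sq]
  have h2 : ‖residual (op Q) x‖ ^ 2 ≤ ‖x‖ ^ 2 := by
    rw [residual_apply, norm_sub_sq_real, h1]
    nlinarith [hQu (adjoint (op Q) x), sq_nonneg ‖adjoint (op Q) x‖]
  exact (abs_le_of_sq_le_sq' h2 (norm_nonneg _)).2

/-- Distances are at most `1` even where the `Q`-factor has zero columns. -/
lemma angleDist_qrQ_le_one {Bst : Mat d k} (hBst : Bstᵀ * Bst = 1) (A : Mat d k) :
    angleDist (qrQ A) Bst ≤ 1 := by
  rw [angleDist_le_iff zero_le_one]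
  intro u
  rw [one_mul, ← norm_isometry (inner_op_of_isometry hBst) u]
  exact norm_residual_qrQ_le A _

/-- If the part of `A` outside the range of `Bst` is a fraction `ρ` of `A` in every direction, the
range of `A` is at distance at most `ρ` from that of `Bst`. -/
lemma angleDist_qrQ_le {A Bst : Mat d k} (hBst : Bstᵀ * Bst = 1) (hA : Function.Injective (op A))
    {ρ : ℝ} (hρ0 : 0 ≤ ρ) (hρ : ρ < 1)
    (h : ∀ u, ‖residual (op Bst) (op A u)‖ ≤ ρ * ‖op A u‖) :
    angleDist (qrQ A) Bst ≤ ρ := by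
  have hQ := inner_op_of_isometry (qrQ_isometry hA)
  rw [angleDist_le_iff hρ0]
  refine norm_residual_symm (inner_op_of_isometry hBst) hQ hρ fun u => ?_
  have : op (qrQ A) u ∈ Set.range (op A) := range_op_qrQ A ▸ Set.mem_range_self u
  obtain ⟨u', hu'⟩ := this
  rw [← norm_isometry hQ u, ← hu']
  exact h u'

end QR

/-! ### Singular values -/

section SingVal

variable {V E : Type*} [NormedAddCommGroup V] [InnerProductSpace ℝ V] [FiniteDimensional ℝ V]
  [NormedAddCommGroup E] [InnerProductSpace ℝ E] [FiniteDimensional ℝ E]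

lemma norm_sq_apply_eq_sum_singularValues (T : V →ₗ[ℝ] E) {k : ℕ} (hk : Module.finrank ℝ V = k)
    (v : V) : ‖T v‖ ^ 2 = ∑ i : Fin k, T.singularValues i ^ 2 *
      inner ℝ (T.isSymmetric_adjoint_comp_self.eigenvectorBasis hk i) v ^ 2 := by
  set b := T.isSymmetric_adjoint_comp_self.eigenvectorBasis hk
  rw [← real_inner_self_eq_norm_sq, ← LinearMap.adjoint_inner_left,
    ← OrthonormalBasis.sum_inner_mul_inner b]
  refine Finset.sum_congr rfl fun i _ => ?_
  have h1 : inner ℝ (LinearMap.adjoint T (T v)) (b i) =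
      T.singularValues i ^ 2 * inner ℝ (b i) v := by
    have h2 := T.isSymmetric_adjoint_comp_self v (b i)
    simp only [LinearMap.comp_apply] at h2
    rw [h2]
    have h3 := T.isSymmetric_adjoint_comp_self.apply_eigenvectorBasis hk i
    simp only [LinearMap.comp_apply] at h3
    rw [h3, inner_smul_right, T.sq_singularValues_fin hk, real_inner_comm]
    rfl
  rw [h1]; ring

lemma norm_sq_apply_le_singularValues_zero (T : V →ₗ[ℝ] E) (v : V) :
    ‖T v‖ ^ 2 ≤ T.singularValues 0 ^ 2 * ‖v‖ ^ 2 := by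
  rw [norm_sq_apply_eq_sum_singularValues T rfl,
    ← OrthonormalBasis.sum_sq_inner_right
      (T.isSymmetric_adjoint_comp_self.eigenvectorBasis rfl) v, Finset.mul_sum]
  gcongr with i
  · exact T.singularValues_nonneg _
  · exact T.singularValues_antitone (Nat.zero_le _)

lemma singularValues_last_le_norm_sq_apply (T : V →ₗ[ℝ] E) (v : V) :
    T.singularValues (Module.finrank ℝ V - 1) ^ 2 * ‖v‖ ^ 2 ≤ ‖T v‖ ^ 2 := by
  rw [norm_sq_apply_eq_sum_singularValues T rfl,
    ← OrthonormalBasis.sum_sq_inner_right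
      (T.isSymmetric_adjoint_comp_self.eigenvectorBasis rfl) v, Finset.mul_sum]
  gcongr with i
  · exact T.singularValues_nonneg _
  · exact T.singularValues_antitone (by have := i.2; omega)

/-- A lower bound on all singular values is a closed condition on the operator. -/
lemma forall_le_singularValues_iff (T : V →ₗ[ℝ] E) {k : ℕ} (hk : Module.finrank ℝ V = k)
    {c : ℝ} (hc : 0 < c) :
    (∀ i < k, c ≤ T.singularValues i) ↔ ∀ v, c * ‖v‖ ≤ ‖T v‖ := by
  constructor
  · intro h v
    rcases Nat.eq_zero_or_pos k with h0 | h0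
    · have : Subsingleton V := Module.finrank_zero_iff.1 (hk.trans h0)
      rw [Subsingleton.elim v 0]; simp
    have h1 := singularValues_last_le_norm_sq_apply T v
    rw [hk] at h1
    have h2 := h (k - 1) (by omega)
    refine (abs_le_of_sq_le_sq' ?_ (norm_nonneg _)).2
    rw [mul_pow]
    refine le_trans ?_ h1
    gcongr
  · intro h i hi
    have h1 := h (T.isSymmetric_adjoint_comp_self.eigenvectorBasis hk ⟨i, hi⟩)
    rw [OrthonormalBasis.norm_eq_one, mul_one] at h1
    refine (abs_le_of_sq_le_sq' ?_ (T.singularValues_nonneg i)).2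
    refine (pow_le_pow_left₀ hc.le h1 2).trans (le_of_eq ?_)
    rw [norm_sq_apply_eq_sum_singularValues T hk, Finset.sum_eq_single ⟨i, hi⟩]
    · simp
    · intro j _ hj
      rw [OrthonormalBasis.inner_eq_zero _ hj]; simp
    · simp

end SingVal

lemma headSingVal_antitone {n k : ℕ} {Wst : Matrix (Fin n) (Fin k) ℝ} {i j : ℕ} (hij : i ≤ j) :
    headSingVal Wst j ≤ headSingVal Wst i :=
  LinearMap.singularValues_antitone _ (Nat.sub_le_sub_right hij 1)

/-- Extreme singular values of the head matrix as bounds on its quadratic form. -/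
lemma headSingVal_bounds {n k : ℕ} (hn : 0 < n) (Wst : Matrix (Fin n) (Fin k) ℝ)
    (u : EuclideanSpace ℝ (Fin k)) :
    n * headSingVal Wst k ^ 2 * ‖u‖ ^ 2 ≤ ∑ i, inner ℝ (WithLp.toLp 2 (Wst i)) u ^ 2 ∧
    ∑ i, inner ℝ (WithLp.toLp 2 (Wst i)) u ^ 2 ≤ n * headSingVal Wst 1 ^ 2 * ‖u‖ ^ 2 := by
  have hn' : (0 : ℝ) < n := by exact_mod_cast hn
  have key : ∑ i, inner ℝ (WithLp.toLp 2 (Wst i)) u ^ 2 =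
      n * ‖Matrix.toEuclideanLin ((1 / √(n : ℝ)) • Wst) u‖ ^ 2 := by
    rw [map_smul, LinearMap.smul_apply, norm_smul, mul_pow, Real.norm_eq_abs, sq_abs, div_pow,
      Real.sq_sqrt hn'.le, EuclideanSpace.norm_sq_eq]
    field_simp
    refine Finset.sum_congr rfl fun i _ => ?_
    rw [Real.norm_eq_abs, sq_abs, inner_eq_dotProduct]
    rfl
  rw [key]
  have h1 := norm_sq_apply_le_singularValues_zero (Matrix.toEuclideanLin ((1 / √(n : ℝ)) • Wst)) u
  have h2 := singularValues_last_le_norm_sq_apply (Matrix.toEuclideanLin ((1 / √(n : ℝ)) • Wst)) u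
  rw [finrank_euclideanSpace_fin] at h2
  unfold headSingVal singVal
  rw [mul_assoc, mul_assoc]
  exact ⟨mul_le_mul_of_nonneg_left h2 hn'.le, mul_le_mul_of_nonneg_left h1 hn'.le⟩

/-! ### Nets -/

/-- `N` determines norms up to a factor `2`. -/
def IsHalfNet {V : Type*} [NormedAddCommGroup V] [InnerProductSpace ℝ V] (N : Finset V) : Prop :=
  ∀ (z : V) (t : ℝ), 0 ≤ t → (∀ u ∈ N, inner ℝ u z ≤ t) → ‖z‖ ≤ 2 * t

/-- A maximal `1/2`-separated subset of the unit ball is a `1/2`-net; it has at most `5 ^ dim`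
points by comparison of volumes. -/
lemma exists_net (V : Type*) [NormedAddCommGroup V] [InnerProductSpace ℝ V]
    [FiniteDimensional ℝ V] :
    ∃ N : Finset V, N.card ≤ 5 ^ Module.finrank ℝ V ∧ (∀ u ∈ N, ‖u‖ ≤ 1) ∧
      IsHalfNet N := by
  classical
  let P : ℕ → Prop := fun c => ∃ s : Finset V, s.card = c ∧ (∀ u ∈ s, ‖u‖ ≤ 1) ∧
    ∀ u ∈ s, ∀ v ∈ s, u ≠ v → 1 / 2 ≤ ‖u - v‖
  have hP : ∀ s : Finset V, (∀ u ∈ s, ‖u‖ ≤ 1) →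
      (∀ u ∈ s, ∀ v ∈ s, u ≠ v → 1 / 2 ≤ ‖u - v‖) → s.card ≤ 5 ^ Module.finrank ℝ V := by
    intro s h1 h2
    have hinj : Function.Injective (fun v : V => (2 : ℝ) • v) := smul_right_injective V two_ne_zero
    rw [← Finset.card_image_of_injective s hinj]
    refine Besicovitch.card_le_of_separated _ ?_ ?_
    · simp only [Finset.mem_image, forall_exists_index, and_imp]
      rintro _ u hu rfl
      rw [norm_smul, Real.norm_two]; linarith [h1 u hu]
    · simp only [Finset.mem_image, forall_exists_index, and_imp]
      rintro _ u hu rfl _ v hv rfl huv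
      rw [← smul_sub, norm_smul, Real.norm_two]
      linarith [h2 u hu v hv fun h => huv (by rw [h])]
  have hbdd : ∀ c, P c → c ≤ 5 ^ Module.finrank ℝ V := by
    rintro c ⟨s, rfl, h1, h2⟩; exact hP s h1 h2
  have hne : P 0 := ⟨∅, rfl, by simp, by simp⟩
  -- a separated set of maximal cardinality is a net
  obtain ⟨N, hNc, hN1, hN2⟩ : P (Nat.findGreatest P (5 ^ Module.finrank ℝ V)) :=
    Nat.findGreatest_spec (Nat.zero_le _) hne
  refine ⟨N, hP N hN1 hN2, hN1, fun z t ht h => ?_⟩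
  rcases eq_or_ne z 0 with rfl | hz
  · simpa using ht
  have hz' : 0 < ‖z‖ := norm_pos_iff.2 hz
  set e : V := ‖z‖⁻¹ • z with he
  have hen : ‖e‖ = 1 := by rw [he, norm_smul, norm_inv, norm_norm, inv_mul_cancel₀ hz'.ne']
  obtain ⟨u, hu, hue⟩ : ∃ u ∈ N, ‖e - u‖ < 1 / 2 := by
    by_contra hcon
    push Not at hcon
    have heN : e ∉ N := fun h => by have := hcon e h; simp at this; norm_num at this
    have hPs : P (N.card + 1) := by
      refine ⟨insert e N, Finset.card_insert_of_notMem heN, ?_, ?_⟩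
      · intro v hv
        rcases Finset.mem_insert.1 hv with rfl | hv
        · exact hen.le
        · exact hN1 v hv
      · intro v hv v' hv' hne
        rcases Finset.mem_insert.1 hv with rfl | hv <;> rcases Finset.mem_insert.1 hv' with rfl | hv'
        · exact absurd rfl hne
        · exact hcon _ hv'
        · rw [norm_sub_rev]; exact hcon _ hv
        · exact hN2 v hv v' hv' hne
    have := Nat.le_findGreatest (hbdd _ hPs) hPs
    omega
  have h1 : ‖z‖ = inner ℝ e z := by
    rw [he, real_inner_smul_left, real_inner_self_eq_norm_sq]; field_simp
  have h2 : inner ℝ e z = inner ℝ u z + inner ℝ (e - u) z := by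
    rw [← inner_add_left]; congr 1; abel
  have h3 : inner ℝ (e - u) z ≤ 1 / 2 * ‖z‖ :=
    (real_inner_le_norm _ _).trans (mul_le_mul_of_nonneg_right hue.le hz'.le)
  linarith [h u hu]

/-! ### Subgaussian vectors: moment generating functions -/

/-- Second order Taylor bound for the exponential with a global remainder. -/
lemma exp_le_one_add_add_sq_mul_exp_abs (y : ℝ) : Real.exp y ≤ 1 + y + y ^ 2 * Real.exp |y| := by
  have h := Complex.norm_exp_sub_sum_le_norm_mul_exp (y : ℂ) 2
  have e1 : Complex.exp y - ∑ m ∈ Finset.range 2, (y : ℂ) ^ m / (m.factorial : ℂ) =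
      ((Real.exp y - (1 + y) : ℝ) : ℂ) := by
    simp [Finset.sum_range_succ]
  rw [e1, Complex.norm_real, Complex.norm_real, Real.norm_eq_abs, Real.norm_eq_abs, sq_abs] at h
  linarith [le_abs_self (Real.exp y - (1 + y))]

section Subgaussian

variable {d : ℕ} {K : ℝ≥0} {ν : Measure (EuclideanSpace ℝ (Fin d))}

/-- `L = K + 1` exceeds the subgaussian norm strictly, hence also some scale that is admissible in
the infimum defining it; no attainment argument is needed. -/
lemma lintegral_exp_inner_sq_le (h : IsIsotropicSubgaussian K ν) {L : ℝ} (hL : L = K + 1)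
    {u : EuclideanSpace ℝ (Fin d)} (hu : ‖u‖ ≤ 1) :
    ∫⁻ x, ENNReal.ofReal (Real.exp (inner ℝ u x ^ 2 / L ^ 2)) ∂ν ≤ 2 := by
  have := h.prob
  have hL0 : 0 < L := by rw [hL]; positivity
  rcases eq_or_ne u 0 with rfl | hu0
  · simp
  have hu' : 0 < ‖u‖ := norm_pos_iff.2 hu0
  set e := ‖u‖⁻¹ • u with he
  have hen : ‖e‖ = 1 := by rw [he, norm_smul, norm_inv, norm_norm, inv_mul_cancel₀ hu'.ne']
  have h1 : psi2Norm ν (fun x => inner ℝ e x) < ((K + 1 : ℝ≥0) : ℝ≥0∞) := by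
    have h2 : psi2Norm ν (fun x => inner ℝ e x) ≤ vecPsi2Norm ν :=
      le_iSup₂ (f := fun (u : EuclideanSpace ℝ (Fin d)) (_ : ‖u‖ = 1) =>
        psi2Norm ν (fun x => inner ℝ u x)) e hen
    refine (h2.trans h.subgaussian).trans_lt ?_
    exact_mod_cast lt_add_one K
  unfold psi2Norm at h1
  simp only [iInf_lt_iff] at h1
  obtain ⟨s, hs0, hs, hsK⟩ := h1
  refine le_trans (lintegral_mono fun x => ?_) hs
  refine ENNReal.ofReal_le_ofReal (Real.exp_le_exp.2 ?_)
  have hs0' : (0 : ℝ) < s := by exact_mod_cast hs0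
  have hsL : (s : ℝ) ≤ L := by
    rw [hL]; exact_mod_cast hsK.le
  have hux : inner ℝ u x = ‖u‖ * inner ℝ e x := by
    rw [he, real_inner_smul_left]; field_simp
  rw [hux, mul_pow]
  refine div_le_div₀ (sq_nonneg _) ?_ (by positivity) (by gcongr)
  exact mul_le_of_le_one_left (sq_nonneg _) (pow_le_one₀ (norm_nonneg _) hu)

lemma lintegral_exp_abs_inner_mul_inner_le (h : IsIsotropicSubgaussian K ν) {L : ℝ}
    (hL : L = K + 1) {a b : EuclideanSpace ℝ (Fin d)} (ha : ‖a‖ ≤ 1) (hb : ‖b‖ ≤ 1) :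
    ∫⁻ x, ENNReal.ofReal (Real.exp (|inner ℝ a x * inner ℝ b x| / L ^ 2)) ∂ν ≤ 2 := by
  have hL0 : 0 < L := by rw [hL]; positivity
  have key : ∀ x, ENNReal.ofReal (Real.exp (|inner ℝ a x * inner ℝ b x| / L ^ 2)) ≤
      2⁻¹ * ENNReal.ofReal (Real.exp (inner ℝ a x ^ 2 / L ^ 2)) +
      2⁻¹ * ENNReal.ofReal (Real.exp (inner ℝ b x ^ 2 / L ^ 2)) := by
    intro x
    have h2 : (2⁻¹ : ℝ≥0∞) = ENNReal.ofReal 2⁻¹ := by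
      rw [ENNReal.ofReal_inv_of_pos two_pos]; simp
    rw [h2, ← ENNReal.ofReal_mul (by norm_num), ← ENNReal.ofReal_mul (by norm_num),
      ← ENNReal.ofReal_add (by positivity) (by positivity)]
    refine ENNReal.ofReal_le_ofReal ?_
    set s := inner ℝ a x ^ 2 / L ^ 2
    set t := inner ℝ b x ^ 2 / L ^ 2
    have h1 : |inner ℝ a x * inner ℝ b x| / L ^ 2 ≤ s / 2 + t / 2 := by
      have : |inner ℝ a x * inner ℝ b x| ≤ (inner ℝ a x ^ 2 + inner ℝ b x ^ 2) / 2 := by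
        rw [abs_mul, ← sq_abs (inner ℝ a x), ← sq_abs (inner ℝ b x)]
        nlinarith [sq_nonneg (|inner ℝ a x| - |inner ℝ b x|)]
      calc _ ≤ (inner ℝ a x ^ 2 + inner ℝ b x ^ 2) / 2 / L ^ 2 := by gcongr
        _ = _ := by ring
    refine (Real.exp_le_exp.2 h1).trans ?_
    have hsq : ∀ r : ℝ, Real.exp r = Real.exp (r / 2) ^ 2 := fun r => by
      rw [← Real.exp_nat_mul]; congr 1; push_cast; ring
    rw [hsq s, hsq t, Real.exp_add]
    nlinarith [sq_nonneg (Real.exp (s / 2) - Real.exp (t / 2))]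
  refine (lintegral_mono key).trans ?_
  rw [lintegral_add_left (by fun_prop), lintegral_const_mul _ (by fun_prop),
    lintegral_const_mul _ (by fun_prop)]
  calc _ ≤ (2⁻¹ : ℝ≥0∞) * 2 + 2⁻¹ * 2 := by
        gcongr
        · exact lintegral_exp_inner_sq_le h hL ha
        · exact lintegral_exp_inner_sq_le h hL hb
    _ = 2 := by
        rw [ENNReal.inv_mul_cancel two_ne_zero ENNReal.ofNat_ne_top]; norm_num

lemma integrable_exp_abs_inner_mul_inner (h : IsIsotropicSubgaussian K ν) {L : ℝ}
    (hL : L = K + 1) {a b : EuclideanSpace ℝ (Fin d)} (ha : ‖a‖ ≤ 1) (hb : ‖b‖ ≤ 1) :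
    Integrable (fun x => Real.exp (|inner ℝ a x * inner ℝ b x| / L ^ 2)) ν ∧
      ∫ x, Real.exp (|inner ℝ a x * inner ℝ b x| / L ^ 2) ∂ν ≤ 2 := by
  have h1 := lintegral_exp_abs_inner_mul_inner_le h hL ha hb
  have hm : AEStronglyMeasurable
      (fun x => Real.exp (|inner ℝ a x * inner ℝ b x| / L ^ 2)) ν := by
    have : Measurable (fun x => Real.exp (|inner ℝ a x * inner ℝ b x| / L ^ 2)) := by fun_prop
    exact this.aestronglyMeasurable
  constructor
  · refine ⟨hm, ?_⟩
    rw [hasFiniteIntegral_iff_ofReal (Filter.Eventually.of_forall fun x => (Real.exp_pos _).le)]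
    exact h1.trans_lt ENNReal.ofNat_lt_top
  · rw [integral_eq_lintegral_of_nonneg_ae
      (Filter.Eventually.of_forall fun x => (Real.exp_pos _).le) hm]
    exact ENNReal.toReal_le_of_le_ofReal (by norm_num) (by simpa using h1)

lemma integrable_inner_mul_inner (h : IsIsotropicSubgaussian K ν)
    {a b : EuclideanSpace ℝ (Fin d)} (ha : ‖a‖ ≤ 1) (hb : ‖b‖ ≤ 1) :
    Integrable (fun x => inner ℝ a x * inner ℝ b x) ν := by
  have h1 := ((integrable_exp_abs_inner_mul_inner h (L := K + 1) rfl ha hb).1).const_mul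
    (((K : ℝ) + 1) ^ 2)
  refine h1.mono' ?_ (Filter.Eventually.of_forall fun x => ?_)
  · have : Measurable (fun x => inner ℝ a x * inner ℝ b x) := by fun_prop
    exact this.aestronglyMeasurable
  · rw [Real.norm_eq_abs]
    have hL : (0 : ℝ) < (K + 1) ^ 2 := by positivity
    have := Real.add_one_le_exp (|inner ℝ a x * inner ℝ b x| / ((K : ℝ) + 1) ^ 2)
    have h2 := mul_le_mul_of_nonneg_left this hL.le
    rw [mul_add, mul_div_cancel₀ _ hL.ne'] at h2
    linarith

lemma integral_inner_mul_inner (h : IsIsotropicSubgaussian K ν)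
    (a b : EuclideanSpace ℝ (Fin d)) : ∫ x, inner ℝ a x * inner ℝ b x ∂ν = inner ℝ a b := by
  have hs : ∀ i : Fin d, ‖EuclideanSpace.single i (1 : ℝ)‖ ≤ 1 := by intro i; simp
  have hint : ∀ i j : Fin d, Integrable (fun x : EuclideanSpace ℝ (Fin d) => x i * x j) ν := by
    intro i j
    have := integrable_inner_mul_inner h (hs i) (hs j)
    simpa [EuclideanSpace.inner_single_left] using this
  have e : ∀ x : EuclideanSpace ℝ (Fin d), inner ℝ a x * inner ℝ b x =
      ∑ i, ∑ j, a i * b j * (x i * x j) := by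
    intro x
    rw [inner_eq_dotProduct, inner_eq_dotProduct, dotProduct, dotProduct, Finset.sum_mul_sum]
    refine Finset.sum_congr rfl fun i _ => Finset.sum_congr rfl fun j _ => ?_
    ring
  simp only [e]
  rw [integral_finsetSum _ fun i _ => integrable_finsetSum _ fun j _ => (hint i j).const_mul _]
  rw [inner_eq_dotProduct, dotProduct]
  refine Finset.sum_congr rfl fun i _ => ?_
  rw [integral_finsetSum _ fun j _ => (hint i j).const_mul _]
  simp only [integral_const_mul, h.cov]
  simp

/-- Moment generating function of a centred product of two linear functionals. -/
lemma lintegral_exp_inner_mul_inner_sub_le (h : IsIsotropicSubgaussian K ν) {L : ℝ}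
    (hL : L = K + 1) {a b : EuclideanSpace ℝ (Fin d)} (ha : ‖a‖ ≤ 1) (hb : ‖b‖ ≤ 1) {l : ℝ}
    (hl : |l| ≤ 1 / (2 * L ^ 2)) :
    ∫⁻ x, ENNReal.ofReal (Real.exp (l * (inner ℝ a x * inner ℝ b x - inner ℝ a b))) ∂ν ≤
      ENNReal.ofReal (Real.exp (16 * L ^ 4 * l ^ 2)) := by
  have := h.prob
  have hL0 : 0 < L := by rw [hL]; positivity
  obtain ⟨hi, hi2⟩ := integrable_exp_abs_inner_mul_inner h hL ha hb
  set Z : EuclideanSpace ℝ (Fin d) → ℝ := fun x => inner ℝ a x * inner ℝ b x with hZ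
  have hZm : Measurable Z := by fun_prop
  have hZi : Integrable Z ν := integrable_inner_mul_inner h ha hb
  have hpt : ∀ x, Real.exp (l * Z x) ≤
      1 + l * Z x + 8 * L ^ 4 * l ^ 2 * Real.exp (|Z x| / L ^ 2) := by
    intro x
    refine (exp_le_one_add_add_sq_mul_exp_abs _).trans ?_
    have h1 : |l * Z x| ≤ |Z x| / L ^ 2 / 2 := by
      rw [abs_mul]
      calc |l| * |Z x| ≤ 1 / (2 * L ^ 2) * |Z x| := by gcongr
        _ = _ := by field_simp
    set y := |Z x| / L ^ 2 / 2 with hy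
    have hy0 : 0 ≤ y := by positivity
    have h2 : Z x ^ 2 = 4 * L ^ 4 * y ^ 2 := by
      rw [hy, ← sq_abs (Z x)]; field_simp; ring
    have h3 : y ^ 2 ≤ 2 * Real.exp y := by
      have := Real.quadratic_le_exp_of_nonneg hy0
      nlinarith
    have h4 : Real.exp (|Z x| / L ^ 2) = Real.exp y * Real.exp y := by
      rw [← Real.exp_add]; congr 1; rw [hy]; ring
    calc 1 + l * Z x + (l * Z x) ^ 2 * Real.exp |l * Z x|
        ≤ 1 + l * Z x + (l ^ 2 * (4 * L ^ 4 * (2 * Real.exp y))) * Real.exp y := by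
          rw [mul_pow, h2]
          gcongr
      _ = _ := by rw [h4]; ring
  have hint : Integrable (fun x => Real.exp (l * Z x)) ν := by
    refine (((integrable_const (1 : ℝ)).add (hZi.const_mul l)).add
      (hi.const_mul (8 * L ^ 4 * l ^ 2))).mono' ?_ (Filter.Eventually.of_forall fun x => ?_)
    · have : Measurable (fun x => Real.exp (l * Z x)) := by fun_prop
      exact this.aestronglyMeasurable
    · rw [Real.norm_of_nonneg (Real.exp_pos _).le]
      exact hpt x
  have hle : ∫ x, Real.exp (l * Z x) ∂ν ≤ Real.exp (l * inner ℝ a b + 16 * L ^ 4 * l ^ 2) := by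
    have h1 : ∫ x, Real.exp (l * Z x) ∂ν ≤
        ∫ x, (1 + l * Z x + 8 * L ^ 4 * l ^ 2 * Real.exp (|Z x| / L ^ 2)) ∂ν :=
      integral_mono hint (((integrable_const (1 : ℝ)).add (hZi.const_mul l)).add
        (hi.const_mul (8 * L ^ 4 * l ^ 2))) hpt
    have i1 : Integrable (fun x => 1 + l * Z x) ν :=
      (integrable_const (1 : ℝ)).add (hZi.const_mul l)
    have i2 : Integrable (fun x => 8 * L ^ 4 * l ^ 2 * Real.exp (|Z x| / L ^ 2)) ν :=
      hi.const_mul (8 * L ^ 4 * l ^ 2)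
    rw [integral_add i1 i2, integral_add (integrable_const (1 : ℝ))
      (hZi.const_mul l), integral_const_mul, integral_const_mul,
      integral_inner_mul_inner h a b] at h1
    have h2 := Real.add_one_le_exp (l * inner ℝ a b + 16 * L ^ 4 * l ^ 2)
    have h3 : 8 * L ^ 4 * l ^ 2 * ∫ x, Real.exp (|Z x| / L ^ 2) ∂ν ≤ 8 * L ^ 4 * l ^ 2 * 2 := by
      gcongr
    simp at h1
    linarith
  have e : ∀ x, ENNReal.ofReal (Real.exp (l * (inner ℝ a x * inner ℝ b x - inner ℝ a b))) =
      ENNReal.ofReal (Real.exp (-(l * inner ℝ a b))) * ENNReal.ofReal (Real.exp (l * Z x)) := by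
    intro x
    rw [← ENNReal.ofReal_mul (Real.exp_pos _).le, ← Real.exp_add]
    congr 2; simp only [hZ]; ring
  simp only [e]
  rw [lintegral_const_mul _ (by fun_prop), ← ofReal_integral_eq_lintegral_ofReal hint
    (Filter.Eventually.of_forall fun x => (Real.exp_pos _).le),
    ← ENNReal.ofReal_mul (Real.exp_pos _).le]
  refine ENNReal.ofReal_le_ofReal ?_
  calc _ ≤ Real.exp (-(l * inner ℝ a b)) * Real.exp (l * inner ℝ a b + 16 * L ^ 4 * l ^ 2) := by
        gcongr
    _ = _ := by rw [← Real.exp_add]; congr 1; ring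

end Subgaussian

/-! ### Tail bounds -/

section Tails

/-- Chernoff's bound. -/
lemma measure_lt_le_of_lintegral_exp_le {Ω : Type*} [MeasurableSpace Ω] {P : Measure Ω}
    {Y : Ω → ℝ}
    (hY : Measurable Y) {b t : ℝ}
    (h : ∫⁻ ω, ENNReal.ofReal (Real.exp (Y ω)) ∂P ≤ ENNReal.ofReal (Real.exp b)) :
    P {ω | t < Y ω} ≤ ENNReal.ofReal (Real.exp (b - t)) := by
  have h1 := mul_meas_ge_le_lintegral (μ := P)
    (f := fun ω => ENNReal.ofReal (Real.exp (Y ω))) (by fun_prop) (ENNReal.ofReal (Real.exp t))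
  have h2 : {ω | t < Y ω} ⊆
      {ω | ENNReal.ofReal (Real.exp t) ≤ ENNReal.ofReal (Real.exp (Y ω))} := fun ω hω =>
    ENNReal.ofReal_le_ofReal (Real.exp_le_exp.2 (le_of_lt hω))
  have h3 : ENNReal.ofReal (Real.exp (-t)) * ENNReal.ofReal (Real.exp t) = 1 := by
    rw [← ENNReal.ofReal_mul (Real.exp_pos _).le, ← Real.exp_add]; simp
  calc P {ω | t < Y ω}
      ≤ P {ω | ENNReal.ofReal (Real.exp t) ≤ ENNReal.ofReal (Real.exp (Y ω))} := measure_mono h2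
    _ = ENNReal.ofReal (Real.exp (-t)) * (ENNReal.ofReal (Real.exp t) *
        P {ω | ENNReal.ofReal (Real.exp t) ≤ ENNReal.ofReal (Real.exp (Y ω))}) := by
        rw [← mul_assoc, h3, one_mul]
    _ ≤ ENNReal.ofReal (Real.exp (-t)) * ENNReal.ofReal (Real.exp b) := by
        gcongr; exact h1.trans h
    _ = _ := by
        rw [← ENNReal.ofReal_mul (Real.exp_pos _).le, ← Real.exp_add]; congr 2; ring

lemma lintegral_pi_prod {ι : Type*} [Fintype ι] {X : ι → Type*} [∀ i, MeasurableSpace (X i)]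
    (μ : ∀ i, Measure (X i)) [∀ i, IsProbabilityMeasure (μ i)] (f : ∀ i, X i → ℝ≥0∞)
    (hf : ∀ i, Measurable (f i)) :
    ∫⁻ x, ∏ i, f i (x i) ∂Measure.pi μ = ∏ i, ∫⁻ y, f i y ∂μ i := by
  have h := iIndepFun_pi (μ := μ) (X := f) fun i => (hf i).aemeasurable
  refine (lintegral_prod_eq_prod_lintegral_of_indepFun Finset.univ
    (fun i (ω : ∀ i, X i) => f i (ω i)) h fun i => (hf i).comp (measurable_pi_apply i)).trans ?_
  refine Finset.prod_congr rfl fun i _ => ?_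
  rw [← (measurePreserving_eval μ i).lintegral_comp (hf i)]

variable {n l d : ℕ} {K : ℝ≥0} {p : Fin n → Measure (EuclideanSpace ℝ (Fin d))}

/-- The law of one mini-batch of size `l` per client. -/
noncomputable abbrev batchLaw (l : ℕ) (p : Fin n → Measure (EuclideanSpace ℝ (Fin d))) :
    Measure (Fin n → Fin l → EuclideanSpace ℝ (Fin d)) :=
  Measure.pi fun i => Measure.pi fun _ : Fin l => p i

/-- Moment generating function of a weighted sum over all data points of a batch. -/
lemma lintegral_exp_batch_le (hp : ∀ i, IsIsotropicSubgaussian K (p i)) {L : ℝ} (hL : L = K + 1)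
    (a b : Fin n → EuclideanSpace ℝ (Fin d)) (ha : ∀ i, ‖a i‖ ≤ 1) (hb : ∀ i, ‖b i‖ ≤ 1)
    (c : Fin n → ℝ) (hc : ∀ i, |c i| ≤ 1 / (2 * L ^ 2)) :
    ∫⁻ x, ENNReal.ofReal (Real.exp (∑ i, ∑ j,
      c i * (inner ℝ (a i) (x i j) * inner ℝ (b i) (x i j) - inner ℝ (a i) (b i)))) ∂batchLaw l p ≤
      ENNReal.ofReal (Real.exp (16 * L ^ 4 * l * ∑ i, c i ^ 2)) := by
  have := fun i => (hp i).prob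
  have e : ∀ x : Fin n → Fin l → EuclideanSpace ℝ (Fin d), ENNReal.ofReal (Real.exp (∑ i, ∑ j,
      c i * (inner ℝ (a i) (x i j) * inner ℝ (b i) (x i j) - inner ℝ (a i) (b i)))) =
      ∏ i, ∏ j, ENNReal.ofReal (Real.exp
        (c i * (inner ℝ (a i) (x i j) * inner ℝ (b i) (x i j) - inner ℝ (a i) (b i)))) := by
    intro x
    rw [Real.exp_sum, ENNReal.ofReal_prod_of_nonneg fun i _ => (Real.exp_pos _).le]
    refine Finset.prod_congr rfl fun i _ => ?_
    rw [Real.exp_sum, ENNReal.ofReal_prod_of_nonneg fun j _ => (Real.exp_pos _).le]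
  simp only [e]
  rw [lintegral_pi_prod _ (fun i (y : Fin l → EuclideanSpace ℝ (Fin d)) =>
    ∏ j, ENNReal.ofReal (Real.exp
        (c i * (inner ℝ (a i) (y j) * inner ℝ (b i) (y j) - inner ℝ (a i) (b i)))))
    (fun i => Finset.measurable_fun_prod _ fun j _ => by fun_prop)]
  have h1 : ∀ i, ∫⁻ y : Fin l → EuclideanSpace ℝ (Fin d), ∏ j, ENNReal.ofReal (Real.exp
        (c i * (inner ℝ (a i) (y j) * inner ℝ (b i) (y j) - inner ℝ (a i) (b i))))
        ∂(Measure.pi fun _ : Fin l => p i) ≤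
      ENNReal.ofReal (Real.exp (16 * L ^ 4 * c i ^ 2)) ^ l := by
    intro i
    rw [lintegral_pi_prod _ (fun _ (y : EuclideanSpace ℝ (Fin d)) => ENNReal.ofReal (Real.exp
        (c i * (inner ℝ (a i) y * inner ℝ (b i) y - inner ℝ (a i) (b i)))))
        (fun j => by fun_prop)]
    rw [Finset.prod_const, Finset.card_univ, Fintype.card_fin]
    gcongr
    exact lintegral_exp_inner_mul_inner_sub_le (hp i) hL (ha i) (hb i) (hc i)
  refine (Finset.prod_le_prod' fun i _ => h1 i).trans (le_of_eq ?_)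
  rw [Finset.prod_pow, ← ENNReal.ofReal_prod_of_nonneg fun i _ => (Real.exp_pos _).le,
    ← Real.exp_sum, ← ENNReal.ofReal_pow (Real.exp_pos _).le, ← Real.exp_nat_mul,
    ← Finset.mul_sum]
  congr 2; ring

/-- Bernstein's inequality for one client: an entry of its empirical second moment matrix. -/
lemma measure_client_deviation_le (hp : ∀ i, IsIsotropicSubgaussian K (p i)) {L : ℝ}
    (hL : L = K + 1) (i : Fin n) {a b : EuclideanSpace ℝ (Fin d)} (ha : ‖a‖ ≤ 1) (hb : ‖b‖ ≤ 1)
    {τ : ℝ} (hτ0 : 0 ≤ τ) (hτ : τ ≤ 1) :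
    batchLaw l p {x | τ * l < ∑ j, (inner ℝ a (x i j) * inner ℝ b (x i j) - inner ℝ a b)} ≤
      ENNReal.ofReal (Real.exp (-(l * τ ^ 2 / (64 * L ^ 4)))) := by
  have hL1 : 1 ≤ L := by rw [hL]; exact le_add_of_nonneg_left K.2
  have hL0 : 0 < L := by linarith
  rcases hτ0.eq_or_lt with rfl | hτ0
  · have := fun i => (hp i).prob
    simpa using prob_le_one
  -- tilt the data of client `i` only, at the rate that optimizes Chernoff's bound
  set c : Fin n → ℝ := fun i' => if i' = i then τ / (32 * L ^ 4) else 0 with hc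
  have hcb : ∀ i', |c i'| ≤ 1 / (2 * L ^ 2) := by
    intro i'
    by_cases hi : i' = i
    · simp only [hc, hi, if_true]
      rw [abs_of_nonneg (by positivity), div_le_div_iff₀ (by positivity) (by positivity)]
      nlinarith [pow_le_pow_right₀ hL1 (show 2 ≤ 4 by norm_num), pow_pos hL0 2]
    · simp only [hc, hi, if_false, abs_zero]; positivity
  have h1 := lintegral_exp_batch_le (l := l) hp hL (fun _ => a) (fun _ => b) (fun _ => ha)
    (fun _ => hb) c hcb
  have h2 := measure_lt_le_of_lintegral_exp_le (P := batchLaw l p) (t := τ / (32 * L ^ 4) * (τ * l))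
    (Finset.measurable_fun_sum _ fun i _ => Finset.measurable_fun_sum _ fun j _ => by fun_prop) h1
  refine (measure_mono ?_).trans (h2.trans (le_of_eq ?_))
  · intro x hx
    simp only [Set.mem_ofPred_eq] at hx ⊢
    rw [Finset.sum_eq_single i]
    · simp only [hc, if_true]
      rw [← Finset.mul_sum]
      exact mul_lt_mul_of_pos_left hx (by positivity)
    · intro i' _ hi'; simp [hc, hi']
    · simp
  · congr 2
    have : ∑ i', c i' ^ 2 = (τ / (32 * L ^ 4)) ^ 2 := by
      rw [Finset.sum_eq_single i] <;> simp +contextual [hc]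
    rw [this]; field_simp; ring

/-- Bernstein's inequality for the pooled sample of all clients. -/
lemma measure_pooled_deviation_le (hp : ∀ i, IsIsotropicSubgaussian K (p i)) {L : ℝ}
    (hL : L = K + 1) (a : Fin n → EuclideanSpace ℝ (Fin d)) {b : EuclideanSpace ℝ (Fin d)}
    (c : Fin n → ℝ) {R : ℝ} (hR : 0 ≤ R) (hac : ∀ i, |c i| * ‖a i‖ ≤ R) (hb : ‖b‖ ≤ 1)
    {τ : ℝ} (hτ0 : 0 ≤ τ) (hτ : τ ≤ 1) :
    batchLaw l p {x | τ * R * (n * l) <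
      ∑ i, ∑ j, c i * (inner ℝ (a i) (x i j) * inner ℝ b (x i j) - inner ℝ (a i) b)} ≤
      ENNReal.ofReal (Real.exp (-(n * l * τ ^ 2 / (64 * L ^ 4)))) := by
  have hL1 : 1 ≤ L := by rw [hL]; exact le_add_of_nonneg_left K.2
  have hL0 : 0 < L := by linarith
  have := fun i => (hp i).prob
  rcases hτ0.eq_or_lt with rfl | hτ0
  · simpa using prob_le_one
  rcases hR.eq_or_lt with rfl | hR
  · have hz : ∀ (i : Fin n) (y : EuclideanSpace ℝ (Fin d)), c i * inner ℝ (a i) y = 0 := by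
      intro i y
      have h0 : |c i| * ‖a i‖ = 0 := le_antisymm (hac i) (by positivity)
      rcases mul_eq_zero.1 h0 with h | h
      · rw [abs_eq_zero.1 h, zero_mul]
      · rw [norm_eq_zero.1 h, inner_zero_left, mul_zero]
    have : ∀ x : Fin n → Fin l → EuclideanSpace ℝ (Fin d), ∑ i, ∑ j, c i *
        (inner ℝ (a i) (x i j) * inner ℝ b (x i j) - inner ℝ (a i) b) = 0 := by
      intro x
      refine Finset.sum_eq_zero fun i _ => Finset.sum_eq_zero fun j _ => ?_
      rw [mul_sub, ← mul_assoc, hz, hz]; simp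
    simp [this]
  -- the rate that optimizes Chernoff's bound, after the weights are absorbed into the `a i`
  set s : ℝ := τ / (32 * L ^ 4) with hs
  have hs0 : 0 < s := by positivity
  have hcb : ∀ i : Fin n, |s| ≤ 1 / (2 * L ^ 2) := by
    intro _
    rw [abs_of_pos hs0, hs, div_le_div_iff₀ (by positivity) (by positivity)]
    nlinarith [pow_le_pow_right₀ hL1 (show 2 ≤ 4 by norm_num), pow_pos hL0 2]
  have ha' : ∀ i, ‖(c i / R) • a i‖ ≤ 1 := by
    intro i
    rw [norm_smul, Real.norm_eq_abs, abs_div, abs_of_pos hR, div_mul_eq_mul_div, div_le_one hR]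
    exact hac i
  have h1 := lintegral_exp_batch_le (l := l) hp hL (fun i => (c i / R) • a i) (fun _ => b) ha'
    (fun _ => hb) (fun _ => s) hcb
  have h2 := measure_lt_le_of_lintegral_exp_le (P := batchLaw l p) (t := s * (τ * (n * l)))
    (Finset.measurable_fun_sum _ fun i _ => Finset.measurable_fun_sum _ fun j _ => by fun_prop) h1
  refine (measure_mono ?_).trans (h2.trans (le_of_eq ?_))
  · intro x hx
    simp only [Set.mem_ofPred_eq] at hx ⊢
    have e : ∑ i, ∑ j, s * (inner ℝ ((c i / R) • a i) (x i j) * inner ℝ b (x i j) -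
        inner ℝ ((c i / R) • a i) b) = s / R * ∑ i, ∑ j, c i *
        (inner ℝ (a i) (x i j) * inner ℝ b (x i j) - inner ℝ (a i) b) := by
      rw [Finset.mul_sum]
      refine Finset.sum_congr rfl fun i _ => ?_
      rw [Finset.mul_sum]
      refine Finset.sum_congr rfl fun j _ => ?_
      rw [real_inner_smul_left, real_inner_smul_left]; field_simp
    rw [e]
    calc s * (τ * (n * l)) = s / R * (τ * R * (n * l)) := by field_simp
      _ < _ := mul_lt_mul_of_pos_left hx (by positivity)
  · congr 2
    rw [Finset.sum_const, Finset.card_univ, Fintype.card_fin, hs, nsmul_eq_mul]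
    field_simp; ring

lemma measurePreserving_batch_eval [∀ i, IsProbabilityMeasure (p i)] (i : Fin n) (j : Fin l) :
    MeasurePreserving (fun x : Fin n → Fin l → EuclideanSpace ℝ (Fin d) => x i j)
      (batchLaw l p) (p i) :=
  (measurePreserving_eval (fun _ : Fin l => p i) j).comp
    (measurePreserving_eval (fun i => Measure.pi fun _ : Fin l => p i) i)

lemma measure_abs_inner_gt_le (hp : ∀ i, IsIsotropicSubgaussian K (p i)) {L : ℝ}
    (hL : L = K + 1) (i : Fin n) (j : Fin l) (q : EuclideanSpace ℝ (Fin d)) {s : ℝ} (hs : 0 ≤ s) :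
    batchLaw l p {x | s * ‖q‖ < |inner ℝ q (x i j)|} ≤
      ENNReal.ofReal (2 * Real.exp (-(s ^ 2 / L ^ 2))) := by
  have := fun i => (hp i).prob
  have hL0 : 0 < L := by rw [hL]; positivity
  rcases eq_or_ne q 0 with rfl | hq
  · simp
  have hq' : 0 < ‖q‖ := norm_pos_iff.2 hq
  set u := ‖q‖⁻¹ • q with hu
  have hun : ‖u‖ ≤ 1 := by rw [hu, norm_smul, norm_inv, norm_norm, inv_mul_cancel₀ hq'.ne']
  have h1 : {x : Fin n → Fin l → EuclideanSpace ℝ (Fin d) | s * ‖q‖ < |inner ℝ q (x i j)|} ⊆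
      (fun x => x i j) ⁻¹' {y | s ^ 2 / L ^ 2 < inner ℝ u y ^ 2 / L ^ 2} := by
    intro x hx
    simp only [Set.mem_ofPred_eq, Set.mem_preimage] at hx ⊢
    have : inner ℝ q (x i j) = ‖q‖ * inner ℝ u (x i j) := by
      rw [hu, real_inner_smul_left]; field_simp
    rw [this, abs_mul, abs_of_pos hq', mul_comm] at hx
    have h2 := lt_of_mul_lt_mul_left hx hq'.le
    rw [← sq_abs (inner ℝ u (x i j))]
    gcongr
  refine (measure_mono h1).trans ?_
  have hm : Measurable (fun y : EuclideanSpace ℝ (Fin d) => inner ℝ u y ^ 2 / L ^ 2) := by fun_prop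
  rw [(measurePreserving_batch_eval i j).measure_preimage
    (measurableSet_lt measurable_const hm).nullMeasurableSet]
  have h3 := lintegral_exp_inner_sq_le (hp i) hL hun
  have h4 : (2 : ℝ≥0∞) = ENNReal.ofReal (Real.exp (Real.log 2)) := by
    rw [Real.exp_log two_pos]; simp
  refine (measure_lt_le_of_lintegral_exp_le hm (h3.trans h4.le)).trans (le_of_eq ?_)
  rw [sub_eq_add_neg, Real.exp_add, Real.exp_log two_pos]

/-- A bilinear form in a Gaussian matrix is subgaussian. -/
lemma gaussMatrix_deviation_le {d k : ℕ} {u : EuclideanSpace ℝ (Fin d)}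
    {v : EuclideanSpace ℝ (Fin k)} (hu : ‖u‖ ≤ 1) (hv : ‖v‖ ≤ 1) {t : ℝ} (ht : 0 ≤ t) :
    gaussMatrix d k {W | t < inner ℝ u (op (Matrix.of W) v)} ≤
      ENNReal.ofReal (Real.exp (-(t ^ 2 / 2))) := by
  have hform : ∀ W : Fin d → Fin k → ℝ, inner ℝ u (op (Matrix.of W) v) =
      ∑ a, ∑ b, u a * v b * W a b := by
    intro W
    rw [inner_eq_dotProduct, ofLp_op]
    simp only [dotProduct, Matrix.mulVec, Finset.mul_sum, Matrix.of_apply]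
    refine Finset.sum_congr rfl fun a _ => Finset.sum_congr rfl fun b _ => ?_
    ring
  have h1 : ∀ s : ℝ, ∫⁻ x, ENNReal.ofReal (Real.exp (s * x)) ∂gaussianReal 0 1 =
      ENNReal.ofReal (Real.exp (s ^ 2 / 2)) := by
    intro s
    rw [← ofReal_integral_eq_lintegral_ofReal (integrable_exp_mul_gaussianReal s)
      (Filter.Eventually.of_forall fun x => (Real.exp_pos _).le)]
    have := congrFun (mgf_id_gaussianReal (μ := 0) (v := 1)) s
    simp only [mgf, id] at this
    rw [this]; simp
  have h2 : ∫⁻ W, ENNReal.ofReal (Real.exp (t * ∑ a, ∑ b, u a * v b * W a b)) ∂gaussMatrix d k ≤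
      ENNReal.ofReal (Real.exp (t ^ 2 / 2)) := by
    have e : ∀ W : Fin d → Fin k → ℝ,
        ENNReal.ofReal (Real.exp (t * ∑ a, ∑ b, u a * v b * W a b)) =
        ∏ a, ∏ b, ENNReal.ofReal (Real.exp (t * u a * v b * W a b)) := by
      intro W
      rw [Finset.mul_sum, Real.exp_sum,
        ENNReal.ofReal_prod_of_nonneg fun i _ => (Real.exp_pos _).le]
      refine Finset.prod_congr rfl fun i _ => ?_
      rw [Finset.mul_sum, Real.exp_sum,
        ENNReal.ofReal_prod_of_nonneg fun j _ => (Real.exp_pos _).le]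
      refine Finset.prod_congr rfl fun j _ => ?_
      congr 2; ring
    simp only [e]
    unfold gaussMatrix
    rw [lintegral_pi_prod _ (fun a (y : Fin k → ℝ) =>
      ∏ b, ENNReal.ofReal (Real.exp (t * u a * v b * y b)))
      (fun i => Finset.measurable_fun_prod _ fun j _ => by fun_prop)]
    have h3 : ∀ a : Fin d, ∫⁻ y : Fin k → ℝ, ∏ b, ENNReal.ofReal (Real.exp (t * u a * v b * y b))
        ∂(Measure.pi fun _ => gaussianReal 0 1) =
        ENNReal.ofReal (Real.exp (t ^ 2 * u a ^ 2 * ‖v‖ ^ 2 / 2)) := by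
      intro a
      rw [lintegral_pi_prod _ (fun b (y : ℝ) => ENNReal.ofReal (Real.exp (t * u a * v b * y)))
        (fun j => by fun_prop)]
      simp only [h1]
      rw [← ENNReal.ofReal_prod_of_nonneg fun i _ => (Real.exp_pos _).le, ← Real.exp_sum,
        EuclideanSpace.norm_sq_eq, Finset.mul_sum, Finset.sum_div]
      congr 2
      refine Finset.sum_congr rfl fun b _ => ?_
      rw [Real.norm_eq_abs, sq_abs]; ring
    simp only [h3]
    rw [← ENNReal.ofReal_prod_of_nonneg fun i _ => (Real.exp_pos _).le, ← Real.exp_sum]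
    refine ENNReal.ofReal_le_ofReal (Real.exp_le_exp.2 ?_)
    have : ∑ a, t ^ 2 * u a ^ 2 * ‖v‖ ^ 2 / 2 = t ^ 2 / 2 * (‖u‖ ^ 2 * ‖v‖ ^ 2) := by
      rw [EuclideanSpace.norm_sq_eq u, Finset.sum_mul, Finset.mul_sum]
      refine Finset.sum_congr rfl fun b _ => ?_
      rw [Real.norm_eq_abs, sq_abs]; ring
    rw [this]
    refine mul_le_of_le_one_right (by positivity) ?_
    exact mul_le_one₀ (pow_le_one₀ (norm_nonneg _) hu) (sq_nonneg _)
      (pow_le_one₀ (norm_nonneg _) hv)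
  rcases ht.eq_or_lt with rfl | ht
  · simpa using prob_le_one
  have hm : Measurable (fun W : Fin d → Fin k → ℝ => t * ∑ a, ∑ b, u a * v b * W a b) :=
    (Finset.measurable_fun_sum _ fun i _ => Finset.measurable_fun_sum _ fun j _ => by
      fun_prop).const_mul _
  have h3 := measure_lt_le_of_lintegral_exp_le hm h2 (t := t * t)
  refine (measure_mono ?_).trans (h3.trans (le_of_eq ?_))
  · intro W hW
    simp only [Set.mem_ofPred_eq] at hW ⊢
    rw [hform] at hW
    exact mul_lt_mul_of_pos_left hW ht
  · congr 2; ring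

end Tails

/-! ### Local heads and gradients -/

/-- Testing an operator on nets on both sides determines its norm up to a factor `4`. -/
lemma norm_apply_le_of_net {V E : Type*} [NormedAddCommGroup V] [InnerProductSpace ℝ V]
    [FiniteDimensional ℝ V] [NormedAddCommGroup E] [InnerProductSpace ℝ E] [FiniteDimensional ℝ E]
    {NV : Finset V} {NE : Finset E} (hV : IsHalfNet NV) (hE : IsHalfNet NE) (T : V →L[ℝ] E)
    {t : ℝ} (ht : 0 ≤ t) (h : ∀ u ∈ NE, ∀ v ∈ NV, inner ℝ u (T v) ≤ t) (v : V) :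
    ‖T v‖ ≤ 4 * t * ‖v‖ := by
  have h1 : ∀ x, ‖adjoint T x‖ ≤ 2 * (2 * t * ‖x‖) := by
    intro x
    refine hV _ _ (by positivity) fun u hu => ?_
    rw [adjoint_inner_right]
    exact (real_inner_le_norm _ _).trans (mul_le_mul_of_nonneg_right
      (hE _ _ ht fun w hw => h w hw u hu) (norm_nonneg _))
  have h2 : ‖T v‖ * ‖T v‖ ≤ 4 * t * ‖v‖ * ‖T v‖ := by
    calc ‖T v‖ * ‖T v‖ = inner ℝ v (adjoint T (T v)) := by
          rw [adjoint_inner_right, real_inner_self_eq_norm_mul_norm]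
      _ ≤ ‖v‖ * (2 * (2 * t * ‖T v‖)) :=
          (real_inner_le_norm _ _).trans (mul_le_mul_of_nonneg_left (h1 _) (norm_nonneg _))
      _ = _ := by ring
  rcases (norm_nonneg (T v)).eq_or_lt with h0 | h0
  · rw [← h0]; positivity
  · exact le_of_mul_le_mul_right h2 h0

section Batch

variable {d k l : ℕ}

lemma dotProduct_transpose_mulVec (B : Mat d k) (w : Fin k → ℝ) (x : EuclideanSpace ℝ (Fin d)) :
    w ⬝ᵥ (Bᵀ *ᵥ x.ofLp) = inner ℝ (op B (WithLp.toLp 2 w)) x := by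
  rw [← adjoint_inner_right, adjoint_op, inner_eq_dotProduct, ofLp_op]

/-- The second moment matrix `(1/l) ∑ⱼ (Bᵀ xⱼ) (Bᵀ xⱼ)ᵀ` of the projected inputs. -/
noncomputable def gramMat (B : Mat d k) (x : Fin l → EuclideanSpace ℝ (Fin d)) : Mat k k :=
  (1 / (l : ℝ)) • ∑ j, Matrix.vecMulVec (Bᵀ *ᵥ (x j).ofLp) (Bᵀ *ᵥ (x j).ofLp)

/-- The least squares head `(Bᵀ Σ B)⁻¹ Bᵀ Σ B* w*` of a client with inputs `x`. It is a measurable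
function of the data everywhere, and the minimizer of the local loss where `Bᵀ Σ B` is
invertible. -/
noncomputable def headOf (B Bst : Mat d k) (ws : Fin k → ℝ)
    (x : Fin l → EuclideanSpace ℝ (Fin d)) : EuclideanSpace ℝ (Fin k) :=
  WithLp.toLp 2 ((gramMat B x)⁻¹ *ᵥ ((1 / (l : ℝ)) •
    ∑ j, inner ℝ (op Bst (WithLp.toLp 2 ws)) (x j) • (Bᵀ *ᵥ (x j).ofLp)))

/-- The residual predictor `B w - B* w*` of a client. -/
noncomputable def predErr (B Bst : Mat d k) (ws : Fin k → ℝ)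
    (x : Fin l → EuclideanSpace ℝ (Fin d)) : EuclideanSpace ℝ (Fin d) :=
  op B (headOf B Bst ws x) - op Bst (WithLp.toLp 2 ws)

/-- The gradient `(1/l) ∑ⱼ ⟨q, xⱼ⟩ xⱼ wᵀ`. -/
noncomputable def gradOf (q : EuclideanSpace ℝ (Fin d)) (w : EuclideanSpace ℝ (Fin k))
    (x : Fin l → EuclideanSpace ℝ (Fin d)) : Mat d k :=
  (1 / (l : ℝ)) • ∑ j, inner ℝ q (x j) • Matrix.vecMulVec (x j).ofLp w.ofLp

lemma op_gramMat (B : Mat d k) (x : Fin l → EuclideanSpace ℝ (Fin d))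
    (u : EuclideanSpace ℝ (Fin k)) :
    op (gramMat B x) u = (1 / (l : ℝ)) • ∑ j, inner ℝ (op B u) (x j) • adjoint (op B) (x j) := by
  unfold gramMat
  rw [op_smul, op_sum, _root_.smul_apply, _root_.sum_apply]
  congr 1
  refine Finset.sum_congr rfl fun j _ => ?_
  have := op_vecMulVec (op Bᵀ (x j)) (op Bᵀ (x j)) u
  rw [ofLp_op] at this
  rw [this, ← adjoint_op, adjoint_inner_left, real_inner_comm]

lemma inner_op_gramMat (B : Mat d k) (x : Fin l → EuclideanSpace ℝ (Fin d))
    (u v : EuclideanSpace ℝ (Fin k)) :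
    inner ℝ u (op (gramMat B x) v) =
      (1 / (l : ℝ)) * ∑ j, inner ℝ (op B u) (x j) * inner ℝ (op B v) (x j) := by
  rw [op_gramMat, real_inner_smul_right, inner_sum]
  congr 1
  refine Finset.sum_congr rfl fun j _ => ?_
  rw [real_inner_smul_right, adjoint_inner_right, mul_comm]

/-- Deviation bounds, on a net, for one client's first batch: for the second moments of the projected
inputs, and for their correlation with a vector `v`, in practice the part of `B* w*` that `B`
misses. -/
def HeadEvent (NV : Finset (EuclideanSpace ℝ (Fin k))) (δ : ℝ) (B : Mat d k)
    (v : EuclideanSpace ℝ (Fin d)) (x : Fin l → EuclideanSpace ℝ (Fin d)) : Prop :=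
  (∀ u ∈ NV, ∀ u' ∈ NV, ∑ j, (inner ℝ (op B u) (x j) * inner ℝ (op B u') (x j) -
    inner ℝ (op B u) (op B u')) ≤ 1 / 8 * l) ∧
  ∀ u ∈ NV, ∑ j, (inner ℝ (op B u) (x j) * inner ℝ v (x j) - inner ℝ (op B u) v) ≤
    δ / 4 * ‖v‖ * l

variable {NV : Finset (EuclideanSpace ℝ (Fin k))} {δ : ℝ} {B Bst : Mat d k}
  {x : Fin l → EuclideanSpace ℝ (Fin d)}

lemma norm_le_two_mul_norm_gramMat (hl : 0 < l) (hNV : IsHalfNet NV) (hB : Bᵀ * B = 1)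
    {v : EuclideanSpace ℝ (Fin d)} (h : HeadEvent NV δ B v x) (u : EuclideanSpace ℝ (Fin k)) :
    ‖u‖ ≤ 2 * ‖op (gramMat B x) u‖ := by
  have hl' : (0 : ℝ) < l := by exact_mod_cast hl
  have h1 := norm_apply_le_of_net hNV hNV (op (gramMat B x) - 1) (t := 1 / 8) (by norm_num)
    (fun a ha b hb => by
      rw [_root_.sub_apply, one_apply_eq_self, inner_sub_right, inner_op_gramMat,
        ← inner_op_of_isometry hB]
      have := h.1 a ha b hb
      rw [Finset.sum_sub_distrib, Finset.sum_const, Finset.card_univ, Fintype.card_fin,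
        nsmul_eq_mul] at this
      rw [one_div, inv_mul_eq_div, sub_le_iff_le_add, div_le_iff₀ hl']
      linarith) u
  rw [_root_.sub_apply, one_apply_eq_self] at h1
  have h2 : ‖u‖ ≤ ‖op (gramMat B x) u‖ + ‖op (gramMat B x) u - u‖ := by
    have := norm_sub_norm_le u (op (gramMat B x) u)
    rw [norm_sub_rev] at this
    linarith
  linarith

lemma isUnit_gramMat (hl : 0 < l) (hNV : IsHalfNet NV) (hB : Bᵀ * B = 1)
    {v : EuclideanSpace ℝ (Fin d)} (h : HeadEvent NV δ B v x) : IsUnit (gramMat B x) := by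
  rw [← Matrix.mulVec_injective_iff_isUnit]
  refine (injective_iff_map_eq_zero (Matrix.mulVecLin (gramMat B x))).2 fun u hu => ?_
  have h1 := norm_le_two_mul_norm_gramMat hl hNV hB h (WithLp.toLp 2 u)
  rw [op_toLp] at h1
  rw [Matrix.mulVecLin_apply] at hu
  rw [hu] at h1
  have h2 : ‖(WithLp.toLp 2 u : EuclideanSpace ℝ (Fin k))‖ ≤ 0 := by simpa using h1
  have h3 := norm_le_zero_iff.1 h2
  simpa using h3

lemma gramMat_headOf (hM : IsUnit (gramMat B x)) (ws : Fin k → ℝ) :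
    op (gramMat B x) (headOf B Bst ws x) = (1 / (l : ℝ)) •
      ∑ j, inner ℝ (op Bst (WithLp.toLp 2 ws)) (x j) • adjoint (op B) (x j) := by
  rw [headOf, op_toLp, Matrix.mulVec_mulVec,
    Matrix.mul_nonsing_inv _ ((Matrix.isUnit_iff_isUnit_det _).1 hM), Matrix.one_mulVec]
  refine WithLp.ofLp_injective 2 ?_
  simp [adjoint_op, ofLp_op]

/-- The local head is close to `Bᵀ B* w*`; the error is proportional to the part of `B* w*` that the
current representation misses. -/
lemma norm_headOf_sub_le (hl : 0 < l) (hNV : IsHalfNet NV) (hδ : 0 ≤ δ) (hB : Bᵀ * B = 1)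
    (ws : Fin k → ℝ)
    (h : HeadEvent NV δ B (residual (op B) (op Bst (WithLp.toLp 2 ws))) x) :
    ‖headOf B Bst ws x - adjoint (op B) (op Bst (WithLp.toLp 2 ws))‖ ≤
      δ * ‖residual (op B) (op Bst (WithLp.toLp 2 ws))‖ := by
  have hl' : (0 : ℝ) < l := by exact_mod_cast hl
  set y := op Bst (WithLp.toLp 2 ws) with hy
  have h1 := gramMat_headOf (Bst := Bst) (isUnit_gramMat hl hNV hB h) ws
  have h2 : op (gramMat B x) (headOf B Bst ws x - adjoint (op B) y) =
      (1 / (l : ℝ)) • ∑ j, inner ℝ (residual (op B) y) (x j) • adjoint (op B) (x j) := by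
    rw [map_sub, h1, op_gramMat, ← smul_sub, ← Finset.sum_sub_distrib]
    congr 1
    refine Finset.sum_congr rfl fun j _ => ?_
    rw [← sub_smul, ← inner_sub_left, residual_apply]
  have h3 : ‖op (gramMat B x) (headOf B Bst ws x - adjoint (op B) y)‖ ≤
      2 * (δ / 4 * ‖residual (op B) y‖) := by
    refine hNV _ _ (by positivity) fun u hu => ?_
    have h4 := h.2 u hu
    have h5 : inner ℝ (op B u) (residual (op B) y) = 0 := by
      rw [← adjoint_inner_right, adjoint_residual (inner_op_of_isometry hB), inner_zero_right]
    rw [h2, real_inner_smul_right, inner_sum, one_div, inv_mul_eq_div, div_le_iff₀ hl']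
    refine le_trans (le_of_eq ?_) h4
    refine Finset.sum_congr rfl fun j _ => ?_
    rw [real_inner_smul_right, adjoint_inner_right, h5, sub_zero, mul_comm]
  have h4 := norm_le_two_mul_norm_gramMat hl hNV hB h (headOf B Bst ws x - adjoint (op B) y)
  linarith

lemma localLoss_map {m : ℕ} (X : Fin m → EuclideanSpace ℝ (Fin d)) (e : Fin l ↪ Fin m)
    (ws w : Fin k → ℝ) :
    localLoss X (fun j => response Bst ws (X j)) (Finset.univ.map e) w B =
      (1 / (l : ℝ)) * ∑ r, (1 / 2) * inner ℝ (op B (WithLp.toLp 2 w) -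
        op Bst (WithLp.toLp 2 ws)) (X (e r)) ^ 2 := by
  unfold localLoss response
  rw [Finset.card_map, Finset.card_univ, Fintype.card_fin, Finset.sum_map]
  congr 1
  refine Finset.sum_congr rfl fun r _ => ?_
  dsimp only
  rw [dotProduct_transpose_mulVec, dotProduct_transpose_mulVec, inner_sub_left]

/-- The head computed by the algorithm is the explicit one as soon as it is unique. -/
lemma localHead_eq_headOf {m : ℕ} (hl : 0 < l) (X : Fin m → EuclideanSpace ℝ (Fin d))
    (e : Fin l ↪ Fin m) (ws : Fin k → ℝ) (hM : IsUnit (gramMat B fun r => X (e r))) :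
    localHead X (fun j => response Bst ws (X j)) (Finset.univ.map e) B =
      (headOf B Bst ws fun r => X (e r)).ofLp := by
  have hl' : (0 : ℝ) < l := by exact_mod_cast hl
  set x : Fin l → EuclideanSpace ℝ (Fin d) := fun r => X (e r) with hx
  set w0 := headOf B Bst ws x with hw0
  set y := op Bst (WithLp.toLp 2 ws) with hy
  -- the normal equations
  have hnormal : ∑ r, inner ℝ (op B w0 - y) (x r) • adjoint (op B) (x r) = 0 := by
    have h1 := gramMat_headOf (Bst := Bst) hM ws
    rw [op_gramMat, ← sub_eq_zero, ← smul_sub, ← Finset.sum_sub_distrib, smul_eq_zero] at h1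
    rcases h1 with h1 | h1
    · exact absurd h1 (by positivity)
    · rw [← h1]
      refine Finset.sum_congr rfl fun r _ => ?_
      rw [← sub_smul, ← inner_sub_left]
  -- the loss exceeds its value at the explicit head by a quadratic form in `w - w0`
  have hquad : ∀ w : Fin k → ℝ,
      localLoss X (fun j => response Bst ws (X j)) (Finset.univ.map e) w B =
      localLoss X (fun j => response Bst ws (X j)) (Finset.univ.map e) w0.ofLp B +
      (1 / (l : ℝ)) * ∑ r, (1 / 2) * inner ℝ (op B (WithLp.toLp 2 w - w0)) (x r) ^ 2 := by
    intro w
    have h2 : ∑ r, inner ℝ (op B w0 - y) (x r) *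
        inner ℝ (op B (WithLp.toLp 2 w - w0)) (x r) = 0 := by
      have := congrArg (fun z => inner ℝ (WithLp.toLp 2 w - w0) z) hnormal
      simp only [inner_sum, inner_zero_right, real_inner_smul_right, adjoint_inner_right] at this
      exact this
    rw [localLoss_map, localLoss_map, ← mul_add, ← Finset.sum_add_distrib]
    congr 1
    rw [← sub_eq_zero, ← Finset.sum_sub_distrib, ← h2]
    refine Finset.sum_congr rfl fun r _ => ?_
    have : op B (WithLp.toLp 2 w) - op Bst (WithLp.toLp 2 ws) =
        (op B w0 - y) + op B (WithLp.toLp 2 w - w0) := by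
      rw [map_sub]; abel
    rw [this, inner_add_left, WithLp.toLp_ofLp]
    ring
  have hex : ∃ w, ∀ w', localLoss X (fun j => response Bst ws (X j)) (Finset.univ.map e) w B ≤
      localLoss X (fun j => response Bst ws (X j)) (Finset.univ.map e) w' B :=
    ⟨w0.ofLp, fun w' => by rw [hquad w']; exact le_add_of_nonneg_right (by positivity)⟩
  have hmin := Classical.epsilon_spec hex w0.ofLp
  set w1 : Fin k → ℝ := Classical.epsilon fun w => ∀ w', localLoss X
    (fun j => response Bst ws (X j)) (Finset.univ.map e) w B ≤
      localLoss X (fun j => response Bst ws (X j)) (Finset.univ.map e) w' B with hw1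
  change w1 = w0.ofLp
  rw [hquad w1] at hmin
  have h3 : ∑ r, (1 / 2 : ℝ) * inner ℝ (op B (WithLp.toLp 2 w1 - w0)) (x r) ^ 2 = 0 := by
    refine le_antisymm ?_ (by positivity)
    have : (1 / (l : ℝ)) * ∑ r, (1 / 2) * inner ℝ (op B (WithLp.toLp 2 w1 - w0)) (x r) ^ 2 ≤ 0 := by
      linarith
    by_contra hcon
    push Not at hcon
    exact absurd this (not_le.2 (by positivity))
  have h4 : ∀ r, inner ℝ (op B (WithLp.toLp 2 w1 - w0)) (x r) = 0 := by
    intro r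
    have := (Finset.sum_eq_zero_iff_of_nonneg fun r _ => by positivity).1 h3 r (Finset.mem_univ r)
    simpa using this
  have h5 : op (gramMat B x) (WithLp.toLp 2 w1 - w0) = 0 := by
    rw [op_gramMat]; simp only [h4, zero_smul, Finset.sum_const_zero, smul_zero]
  have h6 : gramMat B x *ᵥ (WithLp.toLp 2 w1 - w0).ofLp = gramMat B x *ᵥ 0 := by
    rw [← ofLp_op, h5]; simp
  have h7 := Matrix.mulVec_injective_iff_isUnit.2 hM h6
  simpa [sub_eq_zero] using h7

/-- On mini-batches listed by `e₁` and `e₂`, the gradient that a client returns is the explicit one. -/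
lemma client_eq_gradOf {m : ℕ} (hl : 0 < l) (X : Fin m → EuclideanSpace ℝ (Fin d))
    (e₁ e₂ : Fin l ↪ Fin m) (ws : Fin k → ℝ) (hM : IsUnit (gramMat B fun r => X (e₁ r))) :
    client X (fun j => response Bst ws (X j)) (Finset.univ.map e₁) (Finset.univ.map e₂) B =
      gradOf (predErr B Bst ws fun r => X (e₁ r)) (headOf B Bst ws fun r => X (e₁ r))
        (fun r => X (e₂ r)) := by
  unfold client
  rw [localHead_eq_headOf hl X e₁ ws hM]
  unfold localGrad gradOf predErr response
  rw [Finset.card_map, Finset.card_univ, Fintype.card_fin, Finset.sum_map]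
  congr 1
  refine Finset.sum_congr rfl fun r _ => ?_
  dsimp only
  rw [dotProduct_transpose_mulVec, dotProduct_transpose_mulVec, inner_sub_left, WithLp.toLp_ofLp]

lemma op_gradOf (q : EuclideanSpace ℝ (Fin d)) (w u : EuclideanSpace ℝ (Fin k)) :
    op (gradOf q w x) u = (1 / (l : ℝ)) • ∑ j, (inner ℝ w u * inner ℝ q (x j)) • x j := by
  unfold gradOf
  rw [op_smul, op_sum, _root_.smul_apply, _root_.sum_apply]
  congr 1
  refine Finset.sum_congr rfl fun j _ => ?_
  rw [op_smul, _root_.smul_apply, op_vecMulVec, smul_smul, mul_comm]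

lemma frobNorm_vecMulVec (g : EuclideanSpace ℝ (Fin d)) (w : EuclideanSpace ℝ (Fin k)) :
    frobNorm (Matrix.vecMulVec g.ofLp w.ofLp) = ‖g‖ * ‖w‖ := by
  unfold frobNorm
  rw [EuclideanSpace.norm_eq, EuclideanSpace.norm_eq, ← Real.sqrt_mul (by positivity),
    Finset.sum_mul_sum]
  congr 1
  refine Finset.sum_congr rfl fun a _ => Finset.sum_congr rfl fun b _ => ?_
  rw [Matrix.vecMulVec_apply, Real.norm_eq_abs, Real.norm_eq_abs, sq_abs, sq_abs, mul_pow]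

lemma frobNorm_gradOf_le (hl : 0 < l) (q : EuclideanSpace ℝ (Fin d))
    (w : EuclideanSpace ℝ (Fin k)) {r s : ℝ} (hr0 : 0 ≤ r) (hr : ∀ j, |inner ℝ q (x j)| ≤ r)
    (hs : ∀ j, ‖x j‖ ≤ s) : frobNorm (gradOf q w x) ≤ r * s * ‖w‖ := by
  have hl' : (0 : ℝ) < l := by exact_mod_cast hl
  have h1 : gradOf q w x = Matrix.vecMulVec
      ((1 / (l : ℝ)) • ∑ j, inner ℝ q (x j) • x j).ofLp w.ofLp := by
    ext a b
    simp [gradOf, Matrix.vecMulVec_apply, Matrix.sum_apply, Finset.sum_mul, Finset.mul_sum,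
      mul_assoc]
  rw [h1, frobNorm_vecMulVec]
  refine mul_le_mul_of_nonneg_right ?_ (norm_nonneg _)
  rw [norm_smul, Real.norm_of_nonneg (by positivity), one_div, inv_mul_eq_div, div_le_iff₀ hl']
  calc ‖∑ j, inner ℝ q (x j) • x j‖ ≤ ∑ j : Fin l, r * s := by
        refine norm_sum_le_of_le _ fun j _ => ?_
        rw [norm_smul, Real.norm_eq_abs]
        exact mul_le_mul (hr j) (hs j) (norm_nonneg _) hr0
    _ = r * s * l := by
        rw [Finset.sum_const, Finset.card_univ, Fintype.card_fin, nsmul_eq_mul, mul_comm]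

lemma clip_eq_self {ζ : ℝ} {A : Mat d k} (h : frobNorm A ≤ ζ) : clip ζ A = A := by
  unfold clip
  rcases (Real.sqrt_nonneg (∑ a, ∑ b, A a b ^ 2)).eq_or_lt with h0 | h0
  · have hA : A = 0 := by
      ext a b
      have h1 : ∑ a, ∑ b, A a b ^ 2 = 0 := (Real.sqrt_eq_zero (by positivity)).1 h0.symm
      have h2 := (Finset.sum_eq_zero_iff_of_nonneg fun a _ => by positivity).1 h1 a
        (Finset.mem_univ a)
      have h3 := (Finset.sum_eq_zero_iff_of_nonneg fun b _ => by positivity).1 h2 b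
        (Finset.mem_univ b)
      simpa using h3
    rw [hA, smul_zero]
  · have : 1 ≤ ζ / frobNorm A := (one_le_div h0).2 h
    rw [min_eq_left this, one_smul]

end Batch

/-! ### Deterministic analysis of one step -/

/-- The standing assumptions of the analysis of one step: the ground truth, the parameters of
the main loop, and a noise level `ν = η σ ζ √d / n` with `3200 κ² ν ≤ 1`. For larger noise the
claim is void, distances being at most `1`. The scale `L` is at least the subgaussian norm of the
inputs. -/
structure Regime {n d k : ℕ} (Bst : Mat d k) (Wst : Matrix (Fin n) (Fin k) ℝ)
    (μ s₁ s_k κ L : ℝ) (h : Hyper) : Prop where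
  two_le : 2 ≤ n
  one_le : 1 ≤ k
  k_le : k ≤ d
  isometry : Bstᵀ * Bst = 1
  one_le_L : 1 ≤ L
  s₁_eq : s₁ = headSingVal Wst 1
  s_k_eq : s_k = headSingVal Wst k
  s_k_pos : 0 < s_k
  κ_eq : κ = s₁ / s_k
  μ_pos : 0 < μ
  incoherent : ∀ i, ‖(WithLp.toLp 2 (Wst i) : EuclideanSpace ℝ (Fin k))‖ ≤ μ * √k * s_k
  dim : k * Real.log n ≤ d
  batch_pos : 0 < h.mbar
  ζ_eq : h.ζg = 4 * L ^ 2 * μ ^ 2 * k * s_k ^ 2 * √(d * k * Real.log n)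
  η_eq : h.ηg = 1 / (4 * s₁ ^ 2)
  σ_pos : 0 < h.σg
  noise : 3200 * (κ ^ 2 * (h.ηg * h.σg * h.ζg * √d / n)) ≤ 1

/-- The noise level `ν = η σ ζ √d / n`. -/
noncomputable def noiseLevel (n d : ℕ) (h : Hyper) : ℝ := h.ηg * h.σg * h.ζg * √d / n

section Regime

variable {n d k : ℕ} {Bst : Mat d k} {Wst : Matrix (Fin n) (Fin k) ℝ} {μ s₁ s_k κ L : ℝ}
  {h : Hyper}

/-- The true head of a client as a Euclidean vector. -/
noncomputable abbrev trueHead (Wst : Matrix (Fin n) (Fin k) ℝ) (i : Fin n) :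
    EuclideanSpace ℝ (Fin k) := WithLp.toLp 2 (Wst i)

namespace Regime

variable (r : Regime Bst Wst μ s₁ s_k κ L h)

include r

lemma n_pos : (0 : ℝ) < n := by
  have := r.two_le
  exact_mod_cast (show 0 < n by omega)

lemma k_pos : (0 : ℝ) < k := by exact_mod_cast r.one_le

lemma log_pos : 0 < Real.log n := Real.log_pos (by exact_mod_cast r.two_le)

lemma d_pos : (0 : ℝ) < d := (mul_pos r.k_pos r.log_pos).trans_le r.dim

lemma lower (u : EuclideanSpace ℝ (Fin k)) :
    n * s_k ^ 2 * ‖u‖ ^ 2 ≤ ∑ i, inner ℝ (trueHead Wst i) u ^ 2 := by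
  rw [r.s_k_eq]
  exact (headSingVal_bounds (by have := r.two_le; omega) Wst u).1

lemma upper (u : EuclideanSpace ℝ (Fin k)) :
    ∑ i, inner ℝ (trueHead Wst i) u ^ 2 ≤ n * s₁ ^ 2 * ‖u‖ ^ 2 := by
  rw [r.s₁_eq]
  exact (headSingVal_bounds (by have := r.two_le; omega) Wst u).2

lemma s_k_le : s_k ≤ s₁ := by
  rw [r.s₁_eq, r.s_k_eq]
  exact headSingVal_antitone r.one_le

lemma s₁_pos : 0 < s₁ := r.s_k_pos.trans_le r.s_k_le

lemma one_le_κ : 1 ≤ κ := by rw [r.κ_eq, one_le_div r.s_k_pos]; exact r.s_k_le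

lemma norm_trueHead_sq_le (i : Fin n) : ‖trueHead Wst i‖ ^ 2 ≤ μ ^ 2 * k * s_k ^ 2 := by
  have := pow_le_pow_left₀ (norm_nonneg _) (r.incoherent i) 2
  rwa [mul_pow, mul_pow, Real.sq_sqrt r.k_pos.le] at this

/-- The heads have mean square at least `s_k²` in every direction, so the incoherence bound forces
`μ² k ≥ 1`. -/
lemma one_le_μ_sq_mul : 1 ≤ μ ^ 2 * k := by
  set e : EuclideanSpace ℝ (Fin k) := EuclideanSpace.single ⟨0, r.one_le⟩ 1 with he
  have hen : ‖e‖ = 1 := by rw [he, PiLp.norm_single, norm_one]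
  have h1 := r.lower e
  have h2 : ∑ i, inner ℝ (trueHead Wst i) e ^ 2 ≤ ∑ i : Fin n, μ ^ 2 * k * s_k ^ 2 := by
    refine Finset.sum_le_sum fun i _ => ?_
    refine le_trans ?_ (r.norm_trueHead_sq_le i)
    rw [← sq_abs]
    refine pow_le_pow_left₀ (abs_nonneg _) ?_ 2
    simpa [hen] using abs_real_inner_le_norm (trueHead Wst i) e
  rw [Finset.sum_const, Finset.card_univ, Fintype.card_fin, nsmul_eq_mul] at h2
  have h3 := h1.trans h2
  rw [hen, one_pow, mul_one] at h3
  have h4 := le_of_mul_le_mul_left h3 r.n_pos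
  have := pow_pos r.s_k_pos 2
  exact le_of_mul_le_mul_right (by linarith) this

lemma sum_norm_trueHead_sq_le : ∑ i, ‖trueHead Wst i‖ ^ 2 ≤ k * (n * s₁ ^ 2) := by
  calc ∑ i, ‖trueHead Wst i‖ ^ 2
      = ∑ b : Fin k, ∑ i, inner ℝ (trueHead Wst i) (EuclideanSpace.single b 1) ^ 2 := by
        rw [Finset.sum_comm]
        refine Finset.sum_congr rfl fun i _ => ?_
        rw [EuclideanSpace.norm_sq_eq]
        refine Finset.sum_congr rfl fun b _ => ?_
        rw [EuclideanSpace.inner_single_right]; simp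
    _ ≤ ∑ b : Fin k, n * s₁ ^ 2 := by
        refine Finset.sum_le_sum fun b _ => (r.upper _).trans (le_of_eq ?_)
        rw [PiLp.norm_single]; simp
    _ = _ := by rw [Finset.sum_const, Finset.card_univ, Fintype.card_fin, nsmul_eq_mul]

lemma noiseLevel_nonneg : 0 ≤ noiseLevel n d h := by
  unfold noiseLevel
  have h1 := r.σ_pos
  have h2 : 0 ≤ h.ηg := by rw [r.η_eq]; positivity
  have h3 : 0 ≤ h.ζg := by rw [r.ζ_eq]; have := r.log_pos; positivity
  positivity

end Regime

/-- Accuracy of the local heads that one step needs, relative to the part of `B* w*` that the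
representation misses. -/
noncomputable def headTol (κ : ℝ) (k : ℕ) : ℝ := 0.1 / (κ * √k)

/-- Bound on `‖q i‖ ‖w i‖` for a representation at distance `D`. -/
noncomputable def gradScale (μ s_k : ℝ) (k : ℕ) (D : ℝ) : ℝ := 2 * D * (μ ^ 2 * k * s_k ^ 2)

/-- The next raw iterate `B - η GM({G i})` before orthonormalization, computed with the explicit
heads, from the two mini-batches `x₁`, `x₂` of each client and the noise `W`. -/
noncomputable def rawStep (h : Hyper) (Bst : Mat d k) (Wst : Matrix (Fin n) (Fin k) ℝ) {l : ℕ}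
    (B : Mat d k) (x₁ x₂ : Fin n → Fin l → EuclideanSpace ℝ (Fin d)) (W : Fin d → Fin k → ℝ) :
    Mat d k :=
  B - h.ηg • gaussMech h.ζg h.σg
    (fun i => gradOf (predErr B Bst (Wst i) (x₁ i)) (headOf B Bst (Wst i) (x₁ i)) (x₂ i))
    (Matrix.of W)

section Events

variable {l : ℕ}

/-- The residual predictors are small on all points of the second batches. -/
def PredEvent (L : ℝ) (k : ℕ) (q : Fin n → EuclideanSpace ℝ (Fin d))
    (x : Fin n → Fin l → EuclideanSpace ℝ (Fin d)) : Prop :=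
  ∀ i j, |inner ℝ (q i) (x i j)| ≤ 2 * L * √(k * Real.log n) * ‖q i‖

/-- The inputs have length of order `√d`, tested on a net. -/
def InputEvent (L : ℝ) (NE : Finset (EuclideanSpace ℝ (Fin d)))
    (x : Fin n → Fin l → EuclideanSpace ℝ (Fin d)) : Prop :=
  ∀ i j, ∀ u ∈ NE, inner ℝ u (x i j) ≤ 2 * L * √d

/-- The pooled gradient is close to its mean, tested on nets. -/
def GradEvent (NV : Finset (EuclideanSpace ℝ (Fin k))) (NE : Finset (EuclideanSpace ℝ (Fin d)))
    (τ R : ℝ) (q : Fin n → EuclideanSpace ℝ (Fin d)) (w : Fin n → EuclideanSpace ℝ (Fin k))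
    (x : Fin n → Fin l → EuclideanSpace ℝ (Fin d)) : Prop :=
  (∀ i, ‖w i‖ * ‖q i‖ ≤ R) → ∀ u ∈ NE, ∀ u' ∈ NV,
    ∑ i, ∑ j, inner ℝ (w i) u' * (inner ℝ (q i) (x i j) * inner ℝ u (x i j) - inner ℝ (q i) u) ≤
      τ * R * (n * l)

/-- The noise matrix has norm of order `√d`, tested on nets. -/
def NoiseEvent (NV : Finset (EuclideanSpace ℝ (Fin k))) (NE : Finset (EuclideanSpace ℝ (Fin d)))
    (W : Fin d → Fin k → ℝ) : Prop :=
  ∀ u ∈ NE, ∀ u' ∈ NV, inner ℝ u (op (Matrix.of W) u') ≤ 4 * √d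

end Events

section Step

variable {NV : Finset (EuclideanSpace ℝ (Fin k))} {NE : Finset (EuclideanSpace ℝ (Fin d))}
  {B : Mat d k} {x₁ x₂ : Fin n → Fin h.mbar → EuclideanSpace ℝ (Fin d)} {W : Fin d → Fin k → ℝ}

namespace Regime

lemma headTol_pos (r : Regime Bst Wst μ s₁ s_k κ L h) : 0 < headTol κ k := by
  have := r.one_le_κ; have := r.k_pos
  unfold headTol; positivity

lemma headTol_le (r : Regime Bst Wst μ s₁ s_k κ L h) : headTol κ k ≤ 0.1 := by
  have h1 := r.one_le_κ
  have h2 : 1 ≤ √(k : ℝ) := Real.one_le_sqrt.2 (by exact_mod_cast r.one_le)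
  unfold headTol
  exact div_le_self (by norm_num) (one_le_mul_of_one_le_of_one_le h1 h2)

variable (r : Regime Bst Wst μ s₁ s_k κ L h) (hNV : IsHalfNet NV) (hB : Bᵀ * B = 1)
  (hD : angleDist B Bst ≤ 0.2)
  (hhead : ∀ i, HeadEvent NV (headTol κ k) B (residual (op B) (op Bst (trueHead Wst i))) (x₁ i))

include r hNV hB hhead

lemma norm_head_sub_le (i : Fin n) :
    ‖headOf B Bst (Wst i) (x₁ i) - adjoint (op B) (op Bst (trueHead Wst i))‖ ≤
      headTol κ k * (angleDist B Bst * ‖trueHead Wst i‖) :=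
  (norm_headOf_sub_le r.batch_pos hNV r.headTol_pos.le hB (Wst i) (hhead i)).trans
    (mul_le_mul_of_nonneg_left (norm_residual_le_angleDist B Bst _) r.headTol_pos.le)

include hD in
/-- The total error of the heads is small compared with `s_k²`: the factor `1 / (κ √k)` in the
tolerance cancels `∑ ‖w*ᵢ‖² ≤ k n s₁²`. -/
lemma sum_norm_head_sub_sq_le :
    ∑ i, ‖headOf B Bst (Wst i) (x₁ i) - adjoint (op B) (op Bst (trueHead Wst i))‖ ^ 2 ≤
      n * (0.0004 * s_k ^ 2) := by
  have hκ := r.one_le_κ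
  have hk := r.k_pos
  have hD0 := angleDist_nonneg B Bst
  calc _ ≤ ∑ i, (0.0004 / (κ ^ 2 * k)) * ‖trueHead Wst i‖ ^ 2 := by
        refine Finset.sum_le_sum fun i _ => ?_
        refine (pow_le_pow_left₀ (norm_nonneg _) (r.norm_head_sub_le hNV hB hhead i) 2).trans ?_
        rw [← mul_assoc, mul_pow]
        refine mul_le_mul_of_nonneg_right ?_ (sq_nonneg _)
        have h1 : headTol κ k ^ 2 = 0.01 / (κ ^ 2 * k) := by
          unfold headTol
          rw [div_pow, mul_pow, Real.sq_sqrt hk.le]; norm_num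
        rw [mul_pow, h1]
        calc 0.01 / (κ ^ 2 * k) * angleDist B Bst ^ 2 ≤ 0.01 / (κ ^ 2 * k) * 0.2 ^ 2 := by
              gcongr
          _ = _ := by ring
    _ = (0.0004 / (κ ^ 2 * k)) * ∑ i, ‖trueHead Wst i‖ ^ 2 := by rw [Finset.mul_sum]
    _ ≤ (0.0004 / (κ ^ 2 * k)) * (k * (n * s₁ ^ 2)) := by
        gcongr; exact r.sum_norm_trueHead_sq_le
    _ = _ := by
        have := r.s_k_pos; have := r.s₁_pos
        rw [r.κ_eq]; field_simp

include hD in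
lemma norm_head_mul_norm_predErr_le (i : Fin n) :
    ‖headOf B Bst (Wst i) (x₁ i)‖ * ‖predErr B Bst (Wst i) (x₁ i)‖ ≤
      gradScale μ s_k k (angleDist B Bst) := by
  set D := angleDist B Bst with hDdef
  have hD0 : 0 ≤ D := angleDist_nonneg B Bst
  set w := headOf B Bst (Wst i) (x₁ i) with hw
  set y := op Bst (trueHead Wst i) with hy
  set t := ‖trueHead Wst i‖ with ht
  have ht0 : 0 ≤ t := norm_nonneg _
  have h1 : ‖w - adjoint (op B) y‖ ≤ 0.1 * (D * t) :=
    (r.norm_head_sub_le hNV hB hhead i).trans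
      (mul_le_mul_of_nonneg_right r.headTol_le (by positivity))
  have hyn : ‖y‖ = t := norm_isometry (inner_op_of_isometry r.isometry) _
  have h2 : ‖adjoint (op B) y‖ ≤ t := hyn ▸ norm_adjoint_le (inner_op_of_isometry hB) y
  have hwn : ‖w‖ ≤ 1.02 * t := by
    have h3 := norm_sub_norm_le w (adjoint (op B) y)
    have h4 : D * t ≤ 0.2 * t := by gcongr
    linarith
  have hq : ‖predErr B Bst (Wst i) (x₁ i)‖ ≤ 1.1 * (D * t) := by
    have e : predErr B Bst (Wst i) (x₁ i) =
        op B (w - adjoint (op B) y) - residual (op B) y := by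
      rw [residual_apply, map_sub]; unfold predErr; abel
    rw [e]
    refine (norm_sub_le _ _).trans ?_
    rw [norm_isometry (inner_op_of_isometry hB)]
    have h5 : ‖residual (op B) y‖ ≤ D * t := norm_residual_le_angleDist B Bst _
    linarith
  have ht2 := r.norm_trueHead_sq_le i
  calc ‖w‖ * ‖predErr B Bst (Wst i) (x₁ i)‖ ≤ (1.02 * t) * (1.1 * (D * t)) := by
        gcongr
    _ = 1.122 * D * t ^ 2 := by ring
    _ ≤ 1.122 * D * (μ ^ 2 * k * s_k ^ 2) := by gcongr
    _ ≤ _ := by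
        unfold gradScale
        have : 0 ≤ D * (μ ^ 2 * k * s_k ^ 2) := by positivity
        linarith

variable (hNE : IsHalfNet NE)
  (hpred : PredEvent L k (fun i => predErr B Bst (Wst i) (x₁ i)) x₂)
  (hinput : InputEvent L NE x₂)
  (hgrad : GradEvent NV NE (1 / (80 * (μ ^ 2 * k))) (gradScale μ s_k k (angleDist B Bst))
    (fun i => predErr B Bst (Wst i) (x₁ i)) (fun i => headOf B Bst (Wst i) (x₁ i)) x₂)
  (hnoise : NoiseEvent NV NE W)

include hD hNE hpred hinput in
/-- Clipping is inactive. -/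
lemma frobNorm_gradOf_le_ζ (i : Fin n) :
    frobNorm (gradOf (predErr B Bst (Wst i) (x₁ i)) (headOf B Bst (Wst i) (x₁ i)) (x₂ i)) ≤
      h.ζg := by
  have hL := r.one_le_L
  have hlog := r.log_pos
  have h1 := frobNorm_gradOf_le r.batch_pos (predErr B Bst (Wst i) (x₁ i))
    (headOf B Bst (Wst i) (x₁ i)) (by positivity) (hpred i)
    (fun j => hNE (x₂ i j) (2 * L * √d) (by positivity) (hinput i j))
  refine h1.trans ?_
  have h2 := r.norm_head_mul_norm_predErr_le hNV hB hD hhead i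
  have h3 : √(d * k * Real.log n) = √(k * Real.log n) * √d := by
    rw [← Real.sqrt_mul (by positivity)]; congr 1; ring
  rw [r.ζ_eq, h3]
  calc _ = 8 * L ^ 2 * (√(k * Real.log n) * √d) *
        (‖headOf B Bst (Wst i) (x₁ i)‖ * ‖predErr B Bst (Wst i) (x₁ i)‖) := by ring
    _ ≤ 8 * L ^ 2 * (√(k * Real.log n) * √d) * (2 * 0.2 * (μ ^ 2 * k * s_k ^ 2)) := by
        have h4 : gradScale μ s_k k (angleDist B Bst) ≤ 2 * 0.2 * (μ ^ 2 * k * s_k ^ 2) := by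
          unfold gradScale; gcongr
        exact mul_le_mul_of_nonneg_left (h2.trans h4) (by positivity)
    _ ≤ _ := by
        have : 0 ≤ L ^ 2 * (√(k * Real.log n) * √d) * (μ ^ 2 * k * s_k ^ 2) := by positivity
        linarith

include hD hNE hgrad in
/-- The pooled sampling error of the gradient. -/
lemma norm_sum_gradOf_sub_le (u : EuclideanSpace ℝ (Fin k)) :
    ‖∑ i, (op (gradOf (predErr B Bst (Wst i) (x₁ i)) (headOf B Bst (Wst i) (x₁ i)) (x₂ i)) u -
      inner ℝ (headOf B Bst (Wst i) (x₁ i)) u • predErr B Bst (Wst i) (x₁ i))‖ ≤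
      n * (0.1 * angleDist B Bst * s_k ^ 2) * ‖u‖ := by
  have hl : (0 : ℝ) < h.mbar := by exact_mod_cast r.batch_pos
  have hD0 := angleDist_nonneg B Bst
  have hμk := r.one_le_μ_sq_mul
  set q := fun i => predErr B Bst (Wst i) (x₁ i) with hq
  set w := fun i => headOf B Bst (Wst i) (x₁ i) with hw
  set A : Mat d k := ∑ i, (gradOf (q i) (w i) (x₂ i) - Matrix.vecMulVec (q i).ofLp (w i).ofLp)
    with hA
  have hop : ∀ v, op A v = ∑ i, (op (gradOf (q i) (w i) (x₂ i)) v - inner ℝ (w i) v • q i) := by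
    intro v
    rw [hA, op_sum, _root_.sum_apply]
    refine Finset.sum_congr rfl fun i _ => ?_
    rw [op_sub, _root_.sub_apply, op_vecMulVec]
  have hR : 1 / (80 * (μ ^ 2 * k)) * gradScale μ s_k k (angleDist B Bst) =
      0.025 * angleDist B Bst * s_k ^ 2 := by
    have := r.μ_pos; have := r.k_pos
    unfold gradScale; field_simp; ring
  have hnet : ∀ v ∈ NE, ∀ u' ∈ NV, inner ℝ v (op A u') ≤
      n * (0.025 * angleDist B Bst * s_k ^ 2) := by
    intro v hv u' hu'
    have h1 := hgrad (r.norm_head_mul_norm_predErr_le hNV hB hD hhead) v hv u' hu'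
    rw [hR] at h1
    have h2 : inner ℝ v (op A u') = (1 / (h.mbar : ℝ)) * ∑ i, ∑ j, inner ℝ (w i) u' *
        (inner ℝ (q i) (x₂ i j) * inner ℝ v (x₂ i j) - inner ℝ (q i) v) := by
      rw [hop, inner_sum, Finset.mul_sum]
      refine Finset.sum_congr rfl fun i _ => ?_
      rw [inner_sub_right, op_gradOf, real_inner_smul_right, inner_sum, real_inner_smul_right,
        ← Finset.mul_sum, Finset.sum_sub_distrib, Finset.sum_const, Finset.card_univ,
        Fintype.card_fin, nsmul_eq_mul, real_inner_comm v (q i)]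
      simp only [real_inner_smul_right]
      rw [mul_sub, mul_sub, Finset.mul_sum, Finset.mul_sum, Finset.mul_sum]
      congr 1
      · refine Finset.sum_congr rfl fun j _ => ?_
        ring
      · field_simp
    rw [h2, one_div, inv_mul_eq_div, div_le_iff₀ hl]
    linarith
  have h3 := norm_apply_le_of_net hNV hNE (op A) (by positivity) hnet u
  rw [hop] at h3
  refine h3.trans (le_of_eq ?_)
  ring

include hD hNE hpred hinput hgrad hnoise in
/-- On the good event one step of the main loop contracts the distance, up to the noise level. -/
lemma angleDist_qrQ_rawStep_le :
    (qrQ (rawStep h Bst Wst B x₁ x₂ W))ᵀ * qrQ (rawStep h Bst Wst B x₁ x₂ W) = 1 ∧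
    angleDist (qrQ (rawStep h Bst Wst B x₁ x₂ W)) Bst ≤
      angleDist B Bst * (1 - 0.05 / κ ^ 2) + 32 * noiseLevel n d h := by
  set D := angleDist B Bst with hDdef
  have hD0 : 0 ≤ D := angleDist_nonneg B Bst
  have hn := r.n_pos
  have hs1 := r.s₁_pos
  have hsk := r.s_k_pos
  have hκ := r.one_le_κ
  have hν := r.noiseLevel_nonneg
  have hη0 : 0 < h.ηg := by rw [r.η_eq]; positivity
  have hζ0 : 0 ≤ h.ζg := by rw [r.ζ_eq]; have := r.log_pos; positivity
  have hκν : κ ^ 2 * noiseLevel n d h ≤ 1 / 3200 := by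
    have := r.noise; unfold noiseLevel; linarith
  have hν1 : noiseLevel n d h ≤ 1 / 3200 := by
    refine le_trans (le_mul_of_one_le_left hν ?_) hκν
    exact one_le_pow₀ hκ
  have hκinv : 1 / κ ^ 2 ≤ 1 := (div_le_one (by positivity)).2 (one_le_pow₀ hκ)
  have hκi : (s_k / s₁) ^ 2 = 1 / κ ^ 2 := by rw [r.κ_eq]; field_simp
  set e : ℝ := 0.025 * D * (1 / κ ^ 2) + 16 * noiseLevel n d h with he
  have he0 : 0 ≤ e := by positivity
  have he1 : e ≤ 0.02 := by
    have : D * (1 / κ ^ 2) ≤ 0.2 * 1 := by gcongr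
    linarith
  set q := fun i => predErr B Bst (Wst i) (x₁ i) with hq
  set w := fun i => headOf B Bst (Wst i) (x₁ i) with hw
  set A := rawStep h Bst Wst B x₁ x₂ W with hA
  -- the total perturbation of the population step
  set Z : EuclideanSpace ℝ (Fin k) →L[ℝ] EuclideanSpace ℝ (Fin d) :=
    op (h.ηg • ((1 / (n : ℝ)) • ((∑ i, (gradOf (q i) (w i) (x₂ i) -
      Matrix.vecMulVec (q i).ofLp (w i).ofLp)) + (h.σg * h.ζg) • Matrix.of W))) with hZ
  have hZle : ∀ u, ‖Z u‖ ≤ e * ‖u‖ := by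
    intro u
    have h1 := r.norm_sum_gradOf_sub_le hNV hB hD hhead hNE hgrad u
    have h2 := norm_apply_le_of_net hNV hNE (op (Matrix.of W)) (t := 4 * √d) (by positivity)
      hnoise u
    have h3 : Z u = h.ηg • ((1 / (n : ℝ)) • (∑ i, (op (gradOf (q i) (w i) (x₂ i)) u -
        inner ℝ (w i) u • q i) + (h.σg * h.ζg) • op (Matrix.of W) u)) := by
      rw [hZ, op_smul, op_smul, op_add, op_smul, op_sum]
      simp only [_root_.smul_apply, _root_.add_apply, _root_.sum_apply, op_sub, _root_.sub_apply,
        op_vecMulVec]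
    rw [h3, norm_smul, norm_smul, Real.norm_of_nonneg hη0.le, Real.norm_of_nonneg (by positivity)]
    have hσ := r.σ_pos
    calc _ ≤ h.ηg * (1 / n * (n * (0.1 * D * s_k ^ 2) * ‖u‖ +
          (h.σg * h.ζg) * (4 * (4 * √d) * ‖u‖))) := by
          gcongr
          refine (norm_add_le _ _).trans (add_le_add h1 ?_)
          rw [norm_smul, Real.norm_of_nonneg (by positivity)]
          gcongr
      _ = (h.ηg * s_k ^ 2 * (0.1 * D) + 16 * noiseLevel n d h) * ‖u‖ := by
          unfold noiseLevel; field_simp; ring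
      _ = e * ‖u‖ := by
          rw [he, r.η_eq, ← hκi]; congr 2; field_simp; norm_num; ring
  have hAop : ∀ u, op A u = op B u - (1 / (4 * s₁ ^ 2)) • ((1 / (n : ℝ)) •
      ∑ i, inner ℝ (w i) u • (op B (w i) - op Bst (trueHead Wst i))) - Z u := by
    intro u
    have hclip : ∀ i, clip h.ζg (gradOf (q i) (w i) (x₂ i)) = gradOf (q i) (w i) (x₂ i) :=
      fun i => clip_eq_self (r.frobNorm_gradOf_le_ζ hNV hB hD hhead hNE hpred hinput i)
    have h1 : A = B - h.ηg • ((1 / (n : ℝ)) • ((∑ i, gradOf (q i) (w i) (x₂ i)) +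
        (h.σg * h.ζg) • Matrix.of W)) := by
      rw [hA]; unfold rawStep gaussMech
      congr 4
      exact Finset.sum_congr rfl fun i _ => hclip i
    rw [h1, hZ, ← r.η_eq]
    simp only [op_sub, op_smul, op_add, op_sum, _root_.sub_apply, _root_.smul_apply,
      _root_.add_apply, _root_.sum_apply, op_vecMulVec, Finset.sum_sub_distrib]
    change _ = _ - h.ηg • ((1 / (n : ℝ)) • ∑ i, inner ℝ (w i) u • q i) - _
    module
  have hstep := step_contraction (by have := r.two_le; omega) (inner_op_of_isometry hB)
    (inner_op_of_isometry r.isometry) hD0 hD (norm_residual_le_angleDist B Bst) hsk r.s_k_le w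
    (trueHead Wst) r.lower r.upper (r.sum_norm_head_sub_sq_le hNV hB hD hhead) Z hZle he0 he1
    (op A) hAop
  have hinj : Function.Injective (op A) := by
    refine (injective_iff_map_eq_zero (op A)).2 fun u hu => ?_
    have := (hstep u).2
    rw [hu, norm_zero] at this
    exact norm_le_zero_iff.1 (by linarith)
  refine ⟨qrQ_isometry hinj, ?_⟩
  have hρ : D * (1 - 0.11 * (s_k / s₁) ^ 2) + 2 * e ≤
      D * (1 - 0.05 / κ ^ 2) + 32 * noiseLevel n d h := by
    have h1 : 0 ≤ D * (1 / κ ^ 2) := by positivity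
    have h2 : 0.05 / κ ^ 2 = 0.05 * (1 / κ ^ 2) := by ring
    rw [hκi, he, h2]
    linarith
  have hρ0 : 0 ≤ D * (1 - 0.11 * (s_k / s₁) ^ 2) + 2 * e := by
    rw [hκi]
    have : 0 ≤ D * (1 - 0.11 * (1 / κ ^ 2)) := mul_nonneg hD0 (by linarith)
    linarith
  have hρ1 : D * (1 - 0.11 * (s_k / s₁) ^ 2) + 2 * e < 1 := by
    rw [hκi]
    have : 0 ≤ D * (1 / κ ^ 2) := by positivity
    linarith
  exact (angleDist_qrQ_le r.isometry hinj hρ0 hρ1 fun u => (hstep u).1).trans hρ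

end Regime

end Step

end Regime

/-! ### Measurability -/

/-- Matrices carry the product σ-algebra of their entries. -/
instance matMeasurableSpace (d k : ℕ) : MeasurableSpace (Mat d k) :=
  inferInstanceAs (MeasurableSpace (Fin d → Fin k → ℝ))

section Measurability

variable {Ω : Type*} [MeasurableSpace Ω] {d k l : ℕ}

lemma measurable_mat_iff {f : Ω → Mat d k} :
    Measurable f ↔ ∀ a b, Measurable fun ω => f ω a b := by
  have h1 : Measurable f ↔ ∀ a, Measurable fun ω => f ω a :=
    measurable_pi_iff (X := fun _ : Fin d => Fin k → ℝ)
  rw [h1]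
  exact forall_congr' fun a => measurable_pi_iff

lemma measurable_of : Measurable (fun W : Fin d → Fin k → ℝ => (Matrix.of W : Mat d k)) :=
  measurable_id

lemma measurable_matrix_transpose {f : Ω → Mat d k} (hf : Measurable f) :
    Measurable fun ω => ((f ω)ᵀ : Mat k d) :=
  measurable_mat_iff.2 fun a b => measurable_mat_iff.1 hf b a

lemma measurable_matrix_mul {f : Ω → Mat d k} {g : Ω → Mat k l} (hf : Measurable f)
    (hg : Measurable g) : Measurable fun ω => (f ω * g ω : Mat d l) :=
  measurable_mat_iff.2 fun a b => by
    simp only [Matrix.mul_apply]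
    exact Finset.measurable_fun_sum _ fun c _ =>
      (measurable_mat_iff.1 hf a c).mul (measurable_mat_iff.1 hg c b)

lemma measurable_matrix_add {f g : Ω → Mat d k} (hf : Measurable f) (hg : Measurable g) :
    Measurable fun ω => (f ω + g ω : Mat d k) :=
  measurable_mat_iff.2 fun a b => (measurable_mat_iff.1 hf a b).add (measurable_mat_iff.1 hg a b)

lemma measurable_matrix_sub {f g : Ω → Mat d k} (hf : Measurable f) (hg : Measurable g) :
    Measurable fun ω => (f ω - g ω : Mat d k) :=
  measurable_mat_iff.2 fun a b => (measurable_mat_iff.1 hf a b).sub (measurable_mat_iff.1 hg a b)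

lemma measurable_matrix_smul {c : Ω → ℝ} {f : Ω → Mat d k} (hc : Measurable c)
    (hf : Measurable f) : Measurable fun ω => (c ω • f ω : Mat d k) :=
  measurable_mat_iff.2 fun a b => hc.mul (measurable_mat_iff.1 hf a b)

lemma measurable_matrix_sum {ι : Type*} (s : Finset ι) {f : ι → Ω → Mat d k}
    (hf : ∀ i, Measurable (f i)) : Measurable fun ω => (∑ i ∈ s, f i ω : Mat d k) :=
  measurable_mat_iff.2 fun a b => by
    simp only [Matrix.sum_apply]
    exact Finset.measurable_fun_sum _ fun i _ => measurable_mat_iff.1 (hf i) a b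

lemma measurable_euclidean_iff {f : Ω → EuclideanSpace ℝ (Fin d)} :
    Measurable f ↔ ∀ a, Measurable fun ω => f ω a := by
  constructor
  · intro h a
    exact (measurable_pi_apply a).comp ((WithLp.measurable_ofLp 2 _).comp h)
  · intro h
    exact (WithLp.measurable_toLp 2 _).comp (measurable_pi_iff.2 h)

lemma measurable_vecMulVec {f : Ω → EuclideanSpace ℝ (Fin d)}
    {g : Ω → EuclideanSpace ℝ (Fin k)}
    (hf : Measurable f) (hg : Measurable g) :
    Measurable fun ω => (Matrix.vecMulVec (f ω).ofLp (g ω).ofLp : Mat d k) :=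
  measurable_mat_iff.2 fun a b =>
    (measurable_euclidean_iff.1 hf a).mul (measurable_euclidean_iff.1 hg b)

lemma measurable_op {f : Ω → Mat d k} {g : Ω → EuclideanSpace ℝ (Fin k)} (hf : Measurable f)
    (hg : Measurable g) : Measurable fun ω => op (f ω) (g ω) :=
  measurable_euclidean_iff.2 fun a => by
    simp only [ofLp_op, Matrix.mulVec, dotProduct]
    exact Finset.measurable_fun_sum _ fun c _ =>
      (measurable_mat_iff.1 hf a c).mul (measurable_euclidean_iff.1 hg c)

lemma measurable_matrix_det {f : Ω → Mat k k} (hf : Measurable f) :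
    Measurable fun ω => (f ω).det := by
  simp only [Matrix.det_apply']
  exact Finset.measurable_fun_sum _ fun σ _ => measurable_const.mul
    (Finset.measurable_fun_prod _ fun i _ => measurable_mat_iff.1 hf _ _)

lemma measurable_matrix_inv {f : Ω → Mat k k} (hf : Measurable f) :
    Measurable fun ω => ((f ω)⁻¹ : Mat k k) := by
  simp only [Matrix.inv_def, Ring.inverse_eq_inv']
  refine measurable_matrix_smul (measurable_matrix_det hf).inv (measurable_mat_iff.2 fun a b => ?_)
  simp only [Matrix.adjugate_apply]
  refine measurable_matrix_det (measurable_mat_iff.2 fun i j => ?_)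
  simp only [Matrix.updateRow_apply]
  split_ifs
  · exact measurable_const
  · exact measurable_mat_iff.1 hf i j

lemma measurable_frobNorm {f : Ω → Mat d k} (hf : Measurable f) :
    Measurable fun ω => frobNorm (f ω) := by
  unfold frobNorm
  exact (Finset.measurable_fun_sum _ fun a _ => Finset.measurable_fun_sum _ fun b _ =>
    (measurable_mat_iff.1 hf a b).pow_const 2).sqrt

lemma measurable_clip {f : Ω → Mat d k} (hf : Measurable f) (ζ : ℝ) :
    Measurable fun ω => clip ζ (f ω) :=
  measurable_matrix_smul (measurable_const.min (measurable_const.div (measurable_frobNorm hf))) hf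

lemma measurable_gaussMech {s : ℕ} {A : Ω → Fin s → Mat d k} {W : Ω → Mat d k} (ζ σ : ℝ)
    (hA : ∀ i, Measurable fun ω => A ω i) (hW : Measurable W) :
    Measurable fun ω => gaussMech ζ σ (A ω) (W ω) :=
  measurable_matrix_smul measurable_const (measurable_matrix_add
    (measurable_matrix_sum _ fun i => measurable_clip (hA i) ζ)
    (measurable_matrix_smul measurable_const hW))

lemma continuous_op : Continuous fun W : Fin d → Fin k → ℝ => op (Matrix.of W : Mat d k) := by
  let f : (Fin d → Fin k → ℝ) →ₗ[ℝ] (EuclideanSpace ℝ (Fin k) →L[ℝ] EuclideanSpace ℝ (Fin d)) :=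
    { toFun := fun W => op (Matrix.of W)
      map_add' := fun W W' => op_add _ _
      map_smul' := fun c W => op_smul _ _ }
  exact f.continuous_of_finiteDimensional

lemma measurable_angleDist {f g : Ω → Mat d k} (hf : Measurable f) (hg : Measurable g) :
    Measurable fun ω => angleDist (f ω) (g ω) := by
  unfold angleDist
  have h1 : Measurable fun ω => ((1 - f ω * (f ω)ᵀ) * g ω : Mat d k) :=
    measurable_matrix_mul (measurable_matrix_sub measurable_const
      (measurable_matrix_mul hf (measurable_matrix_transpose hf))) hg
  exact (continuous_op.norm.measurable).comp h1

lemma measurable_gramSchmidt {f : Ω → Fin k → EuclideanSpace ℝ (Fin d)}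
    (hf : ∀ b, Measurable fun ω => f ω b) (b : Fin k) :
    Measurable fun ω => InnerProductSpace.gramSchmidt ℝ (f ω) b := by
  induction b using WellFoundedLT.induction with
  | ind b ih =>
    have e : (fun ω => InnerProductSpace.gramSchmidt ℝ (f ω) b) = fun ω => f ω b -
        ∑ c ∈ Finset.Iio b, (inner ℝ (InnerProductSpace.gramSchmidt ℝ (f ω) c) (f ω b) /
          ‖InnerProductSpace.gramSchmidt ℝ (f ω) c‖ ^ 2) •
            InnerProductSpace.gramSchmidt ℝ (f ω) c := by
      funext ω
      rw [InnerProductSpace.gramSchmidt_def]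
      simp only [Submodule.starProjection_singleton]
      rfl
    rw [e]
    refine (hf b).sub (Finset.measurable_fun_sum _ fun c hc => ?_)
    have hc' := ih c (Finset.mem_Iio.1 hc)
    exact ((hc'.inner (hf b)).div (hc'.norm.pow_const 2)).smul hc'

lemma measurable_qrQ {f : Ω → Mat d k} (hf : Measurable f) :
    Measurable fun ω => qrQ (f ω) := by
  refine measurable_mat_iff.2 fun a b => ?_
  have h1 : ∀ b', Measurable fun ω => cols (f ω) b' := fun b' =>
    measurable_euclidean_iff.2 fun a' => measurable_mat_iff.1 hf a' b'
  have h2 := measurable_gramSchmidt h1 b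
  have h3 : Measurable fun ω => InnerProductSpace.gramSchmidtNormed ℝ (cols (f ω)) b := by
    have e : (fun ω => InnerProductSpace.gramSchmidtNormed ℝ (cols (f ω)) b) = fun ω =>
        (‖InnerProductSpace.gramSchmidt ℝ (cols (f ω)) b‖⁻¹ : ℝ) •
          InnerProductSpace.gramSchmidt ℝ (cols (f ω)) b := rfl
    rw [e]
    exact h2.norm.inv.smul h2
  exact measurable_euclidean_iff.1 h3 a

lemma measurable_gramMat {B : Ω → Mat d k} {x : Ω → Fin l → EuclideanSpace ℝ (Fin d)}
    (hB : Measurable B) (hx : Measurable x) : Measurable fun ω => gramMat (B ω) (x ω) := by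
  unfold gramMat
  refine measurable_matrix_smul measurable_const (measurable_matrix_sum _ fun j => ?_)
  have h1 : Measurable fun ω => op (B ω)ᵀ (x ω j) :=
    measurable_op (measurable_matrix_transpose hB) ((measurable_pi_apply j).comp hx)
  have h2 := measurable_vecMulVec h1 h1
  simpa only [ofLp_op] using h2

lemma measurable_headOf {B : Ω → Mat d k} {x : Ω → Fin l → EuclideanSpace ℝ (Fin d)}
    (Bst : Mat d k) (ws : Fin k → ℝ) (hB : Measurable B) (hx : Measurable x) :
    Measurable fun ω => headOf (B ω) Bst ws (x ω) := by
  have e : ∀ ω, headOf (B ω) Bst ws (x ω) = op (gramMat (B ω) (x ω))⁻¹ ((1 / (l : ℝ)) •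
      ∑ j, inner ℝ (op Bst (WithLp.toLp 2 ws)) (x ω j) • op (B ω)ᵀ (x ω j)) := by
    intro ω
    unfold headOf
    rw [← op_toLp]
    congr 1
    refine WithLp.ofLp_injective 2 ?_
    simp [ofLp_op]
  simp only [e]
  have hsum : Measurable fun ω => ∑ j, inner ℝ (op Bst (WithLp.toLp 2 ws)) (x ω j) •
      op (B ω)ᵀ (x ω j) := by
    refine Finset.measurable_fun_sum _ fun j _ => ?_
    have hj : Measurable fun ω => x ω j := (measurable_pi_apply j).comp hx
    have hi : Measurable fun ω => inner ℝ (op Bst (WithLp.toLp 2 ws)) (x ω j) :=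
      measurable_const.inner hj
    exact hi.smul (measurable_op (measurable_matrix_transpose hB) hj)
  have hsum' : Measurable fun ω => (1 / (l : ℝ)) • ∑ j,
      inner ℝ (op Bst (WithLp.toLp 2 ws)) (x ω j) •
      op (B ω)ᵀ (x ω j) := hsum.const_smul (1 / (l : ℝ))
  exact measurable_op (measurable_matrix_inv (measurable_gramMat hB hx)) hsum'

lemma measurable_predErr {B : Ω → Mat d k} {x : Ω → Fin l → EuclideanSpace ℝ (Fin d)}
    (Bst : Mat d k) (ws : Fin k → ℝ) (hB : Measurable B) (hx : Measurable x) :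
    Measurable fun ω => predErr (B ω) Bst ws (x ω) :=
  (measurable_op hB (measurable_headOf Bst ws hB hx)).sub measurable_const

lemma measurable_gradOf {q : Ω → EuclideanSpace ℝ (Fin d)} {w : Ω → EuclideanSpace ℝ (Fin k)}
    {x : Ω → Fin l → EuclideanSpace ℝ (Fin d)} (hq : Measurable q) (hw : Measurable w)
    (hx : Measurable x) : Measurable fun ω => gradOf (q ω) (w ω) (x ω) :=
  measurable_matrix_smul measurable_const (measurable_matrix_sum _ fun j =>
    measurable_matrix_smul (hq.inner ((measurable_pi_apply j).comp hx))
      (measurable_vecMulVec ((measurable_pi_apply j).comp hx) hw))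

lemma measurable_rawStep {n : ℕ} (h : Hyper) (Bst : Mat d k) (Wst : Matrix (Fin n) (Fin k) ℝ)
    {B : Ω → Mat d k} {x₁ x₂ : Ω → Fin n → Fin l → EuclideanSpace ℝ (Fin d)}
    {W : Ω → Fin d → Fin k → ℝ} (hB : Measurable B) (hx₁ : Measurable x₁) (hx₂ : Measurable x₂)
    (hW : Measurable W) : Measurable fun ω => rawStep h Bst Wst (B ω) (x₁ ω) (x₂ ω) (W ω) := by
  have h1 : ∀ i, Measurable fun ω => x₁ ω i := fun i => (measurable_pi_apply i).comp hx₁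
  have h2 : ∀ i, Measurable fun ω => x₂ ω i := fun i => (measurable_pi_apply i).comp hx₂
  exact measurable_matrix_sub hB (measurable_matrix_smul measurable_const
    (measurable_gaussMech _ _ (fun i => measurable_gradOf (measurable_predErr Bst (Wst i) hB (h1 i))
      (measurable_headOf Bst (Wst i) hB (h1 i)) (h2 i)) (measurable_of.comp hW)))

lemma measurable_le_prop {f g : Ω → ℝ} (hf : Measurable f) (hg : Measurable g) :
    Measurable fun ω => f ω ≤ g ω :=
  measurableSet_setOfPred.1 (measurableSet_le hf hg)

lemma measurable_forall_mem {ι : Type*} (N : Finset ι) {P : ι → Ω → Prop}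
    (h : ∀ i, Measurable (P i)) : Measurable fun ω => ∀ i ∈ N, P i ω := by
  refine measurableSet_setOfPred.1 ?_
  have : {ω | ∀ i ∈ N, P i ω} = ⋂ i ∈ N, {ω | P i ω} := by ext; simp
  rw [this]
  exact Finset.measurableSet_biInter N fun i _ => measurableSet_setOfPred.2 (h i)

lemma measurable_headEvent (NV : Finset (EuclideanSpace ℝ (Fin k))) (δ : ℝ) {B : Ω → Mat d k}
    {v : Ω → EuclideanSpace ℝ (Fin d)} {x : Ω → Fin l → EuclideanSpace ℝ (Fin d)}
    (hB : Measurable B) (hv : Measurable v) (hx : Measurable x) :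
    Measurable fun ω => HeadEvent NV δ (B ω) (v ω) (x ω) := by
  have hj : ∀ j, Measurable fun ω => x ω j := fun j => (measurable_pi_apply j).comp hx
  have ho : ∀ u, Measurable fun ω => op (B ω) u := fun u => measurable_op hB measurable_const
  refine Measurable.and ?_ ?_
  · refine measurable_forall_mem _ fun u => measurable_forall_mem _ fun u' =>
      measurable_le_prop (Finset.measurable_fun_sum _ fun j _ => ?_) measurable_const
    exact (((ho u).inner (hj j)).mul ((ho u').inner (hj j))).sub ((ho u).inner (ho u'))
  · refine measurable_forall_mem _ fun u => measurable_le_prop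
      (Finset.measurable_fun_sum _ fun j _ => ?_) ((hv.norm.const_mul _).mul_const _)
    exact (((ho u).inner (hj j)).mul (hv.inner (hj j))).sub ((ho u).inner hv)

lemma measurable_residual {B : Ω → Mat d k} (hB : Measurable B) (y : EuclideanSpace ℝ (Fin d)) :
    Measurable fun ω => residual (op (B ω)) y := by
  simp only [residual_apply, adjoint_op]
  exact measurable_const.sub
    (measurable_op hB (measurable_op (measurable_matrix_transpose hB) measurable_const))

section Batches

variable {n : ℕ} {x : Ω → Fin n → Fin l → EuclideanSpace ℝ (Fin d)}
  {q : Ω → Fin n → EuclideanSpace ℝ (Fin d)} {w : Ω → Fin n → EuclideanSpace ℝ (Fin k)}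

lemma measurable_predEvent (L : ℝ) (hq : Measurable q) (hx : Measurable x) :
    Measurable fun ω => PredEvent L k (q ω) (x ω) := by
  refine Measurable.forall fun i => Measurable.forall fun j => ?_
  have hq' : Measurable fun ω => q ω i := (measurable_pi_apply i).comp hq
  have hx' : Measurable fun ω => x ω i j :=
    (measurable_pi_apply j).comp ((measurable_pi_apply i).comp hx)
  have hi : Measurable fun ω => |inner ℝ (q ω i) (x ω i j)| := by
    simpa only [Real.norm_eq_abs] using (hq'.inner (𝕜 := ℝ) hx').norm
  exact measurable_le_prop hi (hq'.norm.const_mul _)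

lemma measurable_inputEvent (L : ℝ) (NE : Finset (EuclideanSpace ℝ (Fin d)))
    (hx : Measurable x) :
    Measurable fun ω => InputEvent L NE (x ω) := by
  refine Measurable.forall fun i => Measurable.forall fun j => measurable_forall_mem _ fun u => ?_
  have hx' : Measurable fun ω => x ω i j :=
    (measurable_pi_apply j).comp ((measurable_pi_apply i).comp hx)
  exact measurable_le_prop (measurable_const.inner hx') measurable_const

lemma measurable_gradEvent (NV : Finset (EuclideanSpace ℝ (Fin k)))
    (NE : Finset (EuclideanSpace ℝ (Fin d))) (τ : ℝ) {R : Ω → ℝ} (hR : Measurable R)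
    (hq : Measurable q) (hw : Measurable w) (hx : Measurable x) :
    Measurable fun ω => GradEvent NV NE τ (R ω) (q ω) (w ω) (x ω) := by
  have hq' : ∀ i, Measurable fun ω => q ω i := fun i => (measurable_pi_apply i).comp hq
  have hw' : ∀ i, Measurable fun ω => w ω i := fun i => (measurable_pi_apply i).comp hw
  have hx' : ∀ i j, Measurable fun ω => x ω i j := fun i j =>
    (measurable_pi_apply j).comp ((measurable_pi_apply i).comp hx)
  refine Measurable.imp (Measurable.forall fun i =>
    measurable_le_prop ((hw' i).norm.mul (hq' i).norm) hR) ?_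
  refine measurable_forall_mem _ fun u => measurable_forall_mem _ fun u' =>
    measurable_le_prop (Finset.measurable_fun_sum _ fun i _ => Finset.measurable_fun_sum _
      fun j _ => ?_) ((hR.const_mul _).mul_const _)
  exact ((hw' i).inner measurable_const).mul
    ((((hq' i).inner (hx' i j)).mul (measurable_const.inner (hx' i j))).sub
      ((hq' i).inner measurable_const))

lemma measurable_noiseEvent (NV : Finset (EuclideanSpace ℝ (Fin k)))
    (NE : Finset (EuclideanSpace ℝ (Fin d))) {W : Ω → Fin d → Fin k → ℝ} (hW : Measurable W) :
    Measurable fun ω => NoiseEvent NV NE (W ω) :=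
  measurable_forall_mem _ fun _ => measurable_forall_mem _ fun _ =>
    measurable_le_prop (measurable_const.inner
      (measurable_op (measurable_of.comp hW) measurable_const)) measurable_const

end Batches

/-! ### Measurability of the initialization -/

lemma measurable_forall_le_singVal {f : Ω → Mat d k} (hf : Measurable f) (c : ℝ) :
    Measurable fun ω => ∀ i < k, c ≤ singVal (f ω) i := by
  rcases le_or_gt c 0 with hc | hc
  · have : (fun ω => ∀ i < k, c ≤ singVal (f ω) i) = fun _ => True := by
      funext ω
      exact eq_true fun i _ => hc.trans (LinearMap.singularValues_nonneg _ _)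
    rw [this]; exact measurable_const
  · have h1 : ∀ ω, (∀ i < k, c ≤ singVal (f ω) i) ↔ ∀ v, c * ‖v‖ ≤ ‖op (f ω) v‖ := fun ω =>
      forall_le_singularValues_iff (Matrix.toEuclideanLin (f ω)) finrank_euclideanSpace_fin hc
    simp only [h1]
    have h2 : IsClosed {W : Fin d → Fin k → ℝ |
        ∀ v, c * ‖v‖ ≤ ‖op (Matrix.of W : Mat d k) v‖} := by
      simp only [Set.ofPred_forall]
      exact isClosed_iInter fun v => isClosed_le continuous_const
        ((continuous_op.clm_apply continuous_const).norm)
    exact measurableSet_setOfPred.1 (hf h2.measurableSet)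

/-- The selected index depends only on the set of candidates that pass, which has finitely many
values. -/
lemma measurable_crossValidate {T₀ : ℕ} [NeZero T₀] (ε : ℝ) {f : Ω → Fin T₀ → Mat d k}
    (hf : ∀ c, Measurable fun ω => f ω c) : Measurable fun ω => crossValidate ε (f ω) := by
  classical
  have h1 : ∀ c', Measurable fun ω => passesTest ε (f ω) c' := by
    intro c'
    have h2 : Measurable fun ω => {c : Fin T₀ | ∀ i < k,
        1 - 2 * ε ^ 2 ≤ singVal ((f ω c)ᵀ * f ω c') i} :=
      measurable_set_iff.2 fun c => measurable_forall_le_singVal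
        (measurable_matrix_mul (measurable_matrix_transpose (hf c)) (hf c')) _
    exact (Measurable.of_discrete (f := fun s : Set (Fin T₀) => T₀ ≤ 2 * s.ncard)).comp h2
  have h3 : Measurable fun ω => {c' | passesTest ε (f ω) c'} := measurable_set_iff.2 h1
  have h4 : Measurable fun ω => Classical.epsilon (passesTest ε (f ω)) :=
    (Measurable.of_discrete
      (f := fun s : Set (Fin T₀) => Classical.epsilon fun c' => c' ∈ s)).comp h3
  have h5 : Measurable fun p : Ω × Fin T₀ => f p.1 p.2 :=
    measurable_from_prod_countable_left hf
  exact h5.comp (measurable_id.prodMk h4)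

lemma measurable_ppm {n m L : ℕ} (σ₀ ζ₀ : ℝ) {X : Ω → Inputs n m d} {y : Ω → Fin n → Fin m → ℝ}
    (S : Fin n → Fin L → Finset (Fin m)) {X0 : Ω → Mat d k} {W : Ω → Fin L → Mat d k}
    (hX : ∀ i j, Measurable fun ω => X ω i j) (hy : ∀ i j, Measurable fun ω => y ω i j)
    (hX0 : Measurable X0) (hW : ∀ l, Measurable fun ω => W ω l) :
    Measurable fun ω => ppm σ₀ ζ₀ (X ω) (y ω) S (X0 ω) (W ω) := by
  unfold ppm
  induction Fin.last L using Fin.induction with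
  | zero => exact measurable_qrQ hX0
  | succ l ih =>
    simp only [Fin.induction_succ]
    refine measurable_qrQ (measurable_gaussMech _ _ (fun i => measurable_matrix_mul
      (measurable_matrix_smul measurable_const (measurable_matrix_sum _ fun j =>
        measurable_matrix_smul ((hy i j).pow_const 2)
          (measurable_vecMulVec (hX i j) (hX i j)))) ih) (hW l))

end Measurability

/-! ### Failure probability of one step -/

section Union

variable {Ω Ω' ι : Type*} [MeasurableSpace Ω] [MeasurableSpace Ω'] {P : Measure Ω} {Q : Measure Ω'}

lemma measure_exists_mem_le (N : Finset ι) {p : ι → Ω → Prop} {c M : ℝ} (hc : 0 ≤ c)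
    (hN : (N.card : ℝ) ≤ M) (h : ∀ i ∈ N, P {ω | p i ω} ≤ ENNReal.ofReal c) :
    P {ω | ∃ i ∈ N, p i ω} ≤ ENNReal.ofReal (M * c) := by
  have e : {ω | ∃ i ∈ N, p i ω} = ⋃ i ∈ N, {ω | p i ω} := by ext; simp
  rw [e]
  calc P (⋃ i ∈ N, {ω | p i ω}) ≤ ∑ i ∈ N, P {ω | p i ω} := measure_biUnion_finset_le _ _
    _ ≤ ∑ i ∈ N, ENNReal.ofReal c := Finset.sum_le_sum h
    _ = ENNReal.ofReal (N.card * c) := by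
        rw [Finset.sum_const, nsmul_eq_mul, ENNReal.ofReal_mul (Nat.cast_nonneg _),
          ENNReal.ofReal_natCast]
    _ ≤ _ := ENNReal.ofReal_le_ofReal (by gcongr)

lemma measure_exists_le {n : ℕ} {p : Fin n → Ω → Prop} {c : ℝ} (hc : 0 ≤ c)
    (h : ∀ i, P {ω | p i ω} ≤ ENNReal.ofReal c) :
    P {ω | ∃ i, p i ω} ≤ ENNReal.ofReal (n * c) := by
  simpa using measure_exists_mem_le (P := P) Finset.univ (p := p) (M := n) hc (by simp)
    fun i _ => h i

lemma measure_or_le {p q : Ω → Prop} {a b : ℝ} (ha : 0 ≤ a) (hb : 0 ≤ b)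
    (h1 : P {ω | p ω} ≤ ENNReal.ofReal a) (h2 : P {ω | q ω} ≤ ENNReal.ofReal b) :
    P {ω | p ω ∨ q ω} ≤ ENNReal.ofReal (a + b) := by
  rw [ENNReal.ofReal_add ha hb]
  exact (measure_union_le {ω | p ω} {ω | q ω}).trans (add_le_add h1 h2)

lemma prod_measure_le_of_forall [IsProbabilityMeasure P] [SFinite Q] {s : Set (Ω × Ω')} {c : ℝ≥0∞}
    (hs : MeasurableSet s) (h : ∀ x, Q (Prod.mk x ⁻¹' s) ≤ c) : P.prod Q s ≤ c := by
  rw [Measure.prod_apply hs]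
  exact (lintegral_mono h).trans (by simp)

lemma prod_measure_fst [SFinite P] [IsProbabilityMeasure Q] (p : Ω → Prop) :
    P.prod Q {z | p z.1} = P {x | p x} := by
  have e : {z : Ω × Ω' | p z.1} = {x | p x} ×ˢ Set.univ := by ext; simp
  rw [e, Measure.prod_prod, measure_univ, mul_one]

lemma prod_measure_snd [IsProbabilityMeasure P] [SFinite Q] (p : Ω' → Prop) :
    P.prod Q {z | p z.2} = Q {x | p x} := by
  have e : {z : Ω × Ω' | p z.2} = Set.univ ×ˢ {x | p x} := by ext; simp
  rw [e, Measure.prod_prod, measure_univ, one_mul]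

end Union

/-- The randomness of one round: two mini-batches per client, and the noise matrix. -/
abbrev StepData (n l d k : ℕ) :=
  (Fin n → Fin l → EuclideanSpace ℝ (Fin d)) × (Fin n → Fin l → EuclideanSpace ℝ (Fin d)) ×
    (Fin d → Fin k → ℝ)

/-- The law of the randomness of one round. -/
noncomputable def stepLaw {n d : ℕ} (l k : ℕ) (p : Fin n → Measure (EuclideanSpace ℝ (Fin d))) :
    Measure (StepData n l d k) :=
  (batchLaw l p).prod ((batchLaw l p).prod (gaussMatrix d k))

instance {n d : ℕ} (l k : ℕ) (p : Fin n → Measure (EuclideanSpace ℝ (Fin d)))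
    [∀ i, IsProbabilityMeasure (p i)] : IsProbabilityMeasure (stepLaw l k p) := by
  unfold stepLaw; infer_instance

section Step

variable {n d k : ℕ} {Bst : Mat d k} {Wst : Matrix (Fin n) (Fin k) ℝ} {μ s₁ s_k κ L : ℝ}
  {h : Hyper} {NV : Finset (EuclideanSpace ℝ (Fin k))} {NE : Finset (EuclideanSpace ℝ (Fin d))}

/-- All the deviation events that one round needs, for the current representation `B`. -/
def GoodStep (Bst : Mat d k) (Wst : Matrix (Fin n) (Fin k) ℝ) (μ s_k κ L : ℝ) {l : ℕ}
    (NV : Finset (EuclideanSpace ℝ (Fin k))) (NE : Finset (EuclideanSpace ℝ (Fin d)))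
    (B : Mat d k) (ξ : StepData n l d k) : Prop :=
  (∀ i, HeadEvent NV (headTol κ k) B (residual (op B) (op Bst (trueHead Wst i))) (ξ.1 i)) ∧
  PredEvent L k (fun i => predErr B Bst (Wst i) (ξ.1 i)) ξ.2.1 ∧
  InputEvent L NE ξ.2.1 ∧
  GradEvent NV NE (1 / (80 * (μ ^ 2 * k))) (gradScale μ s_k k (angleDist B Bst))
    (fun i => predErr B Bst (Wst i) (ξ.1 i)) (fun i => headOf B Bst (Wst i) (ξ.1 i)) ξ.2.1 ∧
  NoiseEvent NV NE ξ.2.2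

lemma measurable_goodStep {Ω : Type*} [MeasurableSpace Ω] {l : ℕ} {B : Ω → Mat d k}
    {ξ : Ω → StepData n l d k} (hB : Measurable B) (hξ : Measurable ξ) :
    Measurable fun ω => GoodStep Bst Wst μ s_k κ L NV NE (B ω) (ξ ω) := by
  have h1 : Measurable fun ω => (ξ ω).1 := measurable_fst.comp hξ
  have h2 : Measurable fun ω => (ξ ω).2.1 := measurable_fst.comp (measurable_snd.comp hξ)
  have h3 : Measurable fun ω => (ξ ω).2.2 := measurable_snd.comp (measurable_snd.comp hξ)
  have h1i : ∀ i, Measurable fun ω => (ξ ω).1 i := fun i => (measurable_pi_apply i).comp h1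
  have hq : Measurable fun ω i => predErr (B ω) Bst (Wst i) ((ξ ω).1 i) :=
    measurable_pi_iff.2 fun i => measurable_predErr Bst (Wst i) hB (h1i i)
  have hw : Measurable fun ω i => headOf (B ω) Bst (Wst i) ((ξ ω).1 i) :=
    measurable_pi_iff.2 fun i => measurable_headOf Bst (Wst i) hB (h1i i)
  have hR : Measurable fun ω => gradScale μ s_k k (angleDist (B ω) Bst) :=
    ((measurable_angleDist hB measurable_const).const_mul 2).mul_const _
  exact (Measurable.forall fun i => measurable_headEvent NV _ hB (measurable_residual hB _)
    (h1i i)).and ((measurable_predEvent L hq h2).and ((measurable_inputEvent L NE h2).and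
      ((measurable_gradEvent NV NE _ hR hq hw h2).and (measurable_noiseEvent NV NE h3))))

lemma five_pow_le_exp_two_mul (d : ℕ) : (5 : ℝ) ^ d ≤ Real.exp (2 * d) := by
  have h1 : (5 : ℝ) ≤ Real.exp 2 := by
    have h2 := Real.exp_one_gt_d9
    have h3 : Real.exp 2 = Real.exp 1 * Real.exp 1 := by rw [← Real.exp_add]; norm_num
    rw [h3]; nlinarith
  calc (5 : ℝ) ^ d ≤ Real.exp 2 ^ d := by gcongr
    _ = _ := by rw [← Real.exp_nat_mul]; congr 1; ring

namespace Regime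

variable (r : Regime Bst Wst μ s₁ s_k κ L h)

include r

lemma natCast_le_exp : (n : ℝ) ≤ Real.exp (k * Real.log n) := by
  rw [← Real.exp_log r.n_pos]
  refine Real.exp_le_exp.2 ?_
  rw [Real.log_exp]
  exact le_mul_of_one_le_left r.log_pos.le (by exact_mod_cast r.one_le)

lemma five_pow_k_le : (5 : ℝ) ^ k ≤ Real.exp (3 * (k * Real.log n)) := by
  have h1 : (5 : ℝ) ≤ Real.exp (3 * Real.log n) := by
    have : Real.exp (3 * Real.log n) = (n : ℝ) ^ 3 := by
      rw [show 3 * Real.log n = ((3 : ℕ) : ℝ) * Real.log n by norm_num, Real.exp_nat_mul,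
        Real.exp_log r.n_pos]
    rw [this]
    have h2 : (2 : ℝ) ≤ n := by exact_mod_cast r.two_le
    calc (5 : ℝ) ≤ 2 ^ 3 := by norm_num
      _ ≤ _ := by gcongr
  calc (5 : ℝ) ^ k ≤ (Real.exp (3 * Real.log n)) ^ k := by gcongr
    _ = _ := by rw [← Real.exp_nat_mul]; congr 1; ring

lemma exp_neg_eq : Real.exp (-(k * Real.log n)) = 1 / (n : ℝ) ^ k := by
  rw [Real.exp_neg, Real.exp_nat_mul, Real.exp_log r.n_pos, one_div]

variable {K : ℝ≥0} {p : Fin n → Measure (EuclideanSpace ℝ (Fin d))}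
  (hp : ∀ i, IsIsotropicSubgaussian K (p i)) (hL : L = K + 1)
  (hm₁ : 2 ^ 21 * L ^ 4 * (κ ^ 2 * k ^ 2 * Real.log n) ≤ h.mbar)
  (hm₂ : 2 ^ 21 * L ^ 4 * (μ ^ 4 * k ^ 2 * d / n) ≤ h.mbar)
  (hNV : NV.card ≤ 5 ^ k) (hNV1 : ∀ u ∈ NV, ‖u‖ ≤ 1)
  (hNE : NE.card ≤ 5 ^ d) (hNE1 : ∀ u ∈ NE, ‖u‖ ≤ 1)

include hp hL hm₁ hNV hNV1 in
lemma measure_headEvent_le {B : Mat d k} (hB : Bᵀ * B = 1) :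
    batchLaw h.mbar p {x | ∃ i, ¬ HeadEvent NV (headTol κ k) B
      (residual (op B) (op Bst (trueHead Wst i))) (x i)} ≤
      ENNReal.ofReal (2 * (1 / (n : ℝ) ^ k)) := by
  have hBn := norm_isometry (inner_op_of_isometry hB)
  have hcard : (NV.card : ℝ) ≤ 5 ^ k := by exact_mod_cast hNV
  have hL0 : 0 < L := by have := r.one_le_L; linarith
  have hκ := r.one_le_κ
  have hk : (1 : ℝ) ≤ k := by exact_mod_cast r.one_le
  have hlog := r.log_pos
  set X := k * Real.log n with hX
  have hX0 : 0 < X := by positivity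
  -- both exponents are at least `20 k log n`, which pays for `n` clients and `5 ^ k * 5 ^ k` net points
  have hX1 : 2 ^ 21 * L ^ 4 * (κ ^ 2 * k * X) ≤ h.mbar := by
    refine le_trans (le_of_eq ?_) hm₁; rw [hX]; ring
  have e1 : 20 * X ≤ h.mbar * (1 / 8) ^ 2 / (64 * L ^ 4) := by
    rw [le_div_iff₀ (by positivity)]
    have h1 : 1 * X ≤ κ ^ 2 * k * X := by
      gcongr; exact one_le_mul_of_one_le_of_one_le (one_le_pow₀ hκ) hk
    have h2 : 2 ^ 21 * L ^ 4 * (1 * X) ≤ h.mbar := le_trans (by gcongr) hX1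
    have h3 : 0 ≤ L ^ 4 * X := by positivity
    linarith
  have e2 : 20 * X ≤ h.mbar * (headTol κ k / 4) ^ 2 / (64 * L ^ 4) := by
    have h1 : (headTol κ k / 4) ^ 2 = 1 / (1600 * (κ ^ 2 * k)) := by
      unfold headTol
      rw [div_pow, div_pow, mul_pow, Real.sq_sqrt (by linarith)]
      field_simp; norm_num
    rw [h1, le_div_iff₀ (by positivity), mul_one_div, le_div_iff₀ (by positivity)]
    have h3 : 0 ≤ L ^ 4 * (κ ^ 2 * k * X) := by positivity
    linarith
  have hδ0 := r.headTol_pos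
  have hδ1 := r.headTol_le
  have hone : ∀ i, batchLaw h.mbar p {x | ¬ HeadEvent NV (headTol κ k) B
      (residual (op B) (op Bst (trueHead Wst i))) (x i)} ≤
      ENNReal.ofReal (5 ^ k * (5 ^ k * Real.exp (-(20 * X))) + 5 ^ k * Real.exp (-(20 * X))) := by
    intro i
    set v := residual (op B) (op Bst (trueHead Wst i)) with hv
    have hsub : {x : Fin n → Fin h.mbar → EuclideanSpace ℝ (Fin d) |
        ¬ HeadEvent NV (headTol κ k) B v (x i)} ⊆
        {x | (∃ u ∈ NV, ∃ u' ∈ NV, 1 / 8 * h.mbar < ∑ j, (inner ℝ (op B u) (x i j) *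
          inner ℝ (op B u') (x i j) - inner ℝ (op B u) (op B u'))) ∨
          ∃ u ∈ NV, headTol κ k / 4 * ‖v‖ * h.mbar < ∑ j, (inner ℝ (op B u) (x i j) *
            inner ℝ v (x i j) - inner ℝ (op B u) v)} := by
      intro x hx
      simp only [HeadEvent, Set.mem_ofPred_eq, not_and_or, not_forall, not_le, exists_prop] at hx
      exact hx
    refine (measure_mono hsub).trans (measure_or_le (by positivity) (by positivity) ?_ ?_)
    · refine measure_exists_mem_le NV (by positivity) hcard fun u hu =>
        measure_exists_mem_le NV (by positivity) hcard fun u' hu' => ?_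
      refine (measure_client_deviation_le hp hL i (by rw [hBn]; exact hNV1 u hu)
        (by rw [hBn]; exact hNV1 u' hu') (by norm_num) (by norm_num)).trans ?_
      exact ENNReal.ofReal_le_ofReal (Real.exp_le_exp.2 (neg_le_neg e1))
    · refine measure_exists_mem_le NV (by positivity) hcard fun u hu => ?_
      rcases eq_or_ne v 0 with h0 | h0
      · simp [h0]
      have hv0 : 0 < ‖v‖ := norm_pos_iff.2 h0
      have h1 := measure_client_deviation_le (l := h.mbar) hp hL i (a := op B u) (b := ‖v‖⁻¹ • v)
        (by rw [hBn]; exact hNV1 u hu)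
        (by rw [norm_smul, norm_inv, norm_norm, inv_mul_cancel₀ hv0.ne'])
        (τ := headTol κ k / 4) (by positivity) (by linarith)
      refine (measure_mono ?_).trans (h1.trans
        (ENNReal.ofReal_le_ofReal (Real.exp_le_exp.2 (neg_le_neg e2))))
      intro x hx
      simp only [Set.mem_ofPred_eq] at hx ⊢
      have h2 : ∑ j, (inner ℝ (op B u) (x i j) * inner ℝ (‖v‖⁻¹ • v) (x i j) -
          inner ℝ (op B u) (‖v‖⁻¹ • v)) = ‖v‖⁻¹ * ∑ j, (inner ℝ (op B u) (x i j) *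
            inner ℝ v (x i j) - inner ℝ (op B u) v) := by
        rw [Finset.mul_sum]
        refine Finset.sum_congr rfl fun j _ => ?_
        rw [real_inner_smul_left, real_inner_smul_right]; ring
      rw [h2, inv_mul_eq_div, lt_div_iff₀ hv0]
      linarith
  refine (measure_exists_le (by positivity) hone).trans (ENNReal.ofReal_le_ofReal ?_)
  rw [← r.exp_neg_eq]
  have h5 := r.five_pow_k_le
  have hn := r.natCast_le_exp
  have key : (n : ℝ) * (5 ^ k * (5 ^ k * Real.exp (-(20 * X)))) ≤ Real.exp (-X) := by
    calc _ ≤ Real.exp X * (Real.exp (3 * X) * (Real.exp (3 * X) * Real.exp (-(20 * X)))) := by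
          gcongr
      _ = Real.exp (-13 * X) := by
          rw [← Real.exp_add, ← Real.exp_add, ← Real.exp_add]; congr 1; ring
      _ ≤ _ := Real.exp_le_exp.2 (by linarith)
  have key2 : (n : ℝ) * (5 ^ k * Real.exp (-(20 * X))) ≤ Real.exp (-X) := by
    calc _ ≤ Real.exp X * (Real.exp (3 * X) * Real.exp (-(20 * X))) := by gcongr
      _ = Real.exp (-16 * X) := by
          rw [← Real.exp_add, ← Real.exp_add]; congr 1; ring
      _ ≤ _ := Real.exp_le_exp.2 (by linarith)
  rw [mul_add]
  linarith

include hp hL in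
lemma measure_predEvent_le (q : Fin n → EuclideanSpace ℝ (Fin d)) :
    batchLaw h.mbar p {x | ¬ PredEvent L k q x} ≤
      ENNReal.ofReal (2 * h.mbar * (1 / (n : ℝ) ^ k)) := by
  have hL0 : 0 < L := by have := r.one_le_L; linarith
  have hlog := r.log_pos
  have hsub : {x : Fin n → Fin h.mbar → EuclideanSpace ℝ (Fin d) | ¬ PredEvent L k q x} ⊆
      {x | ∃ i, ∃ j, 2 * L * √(k * Real.log n) * ‖q i‖ < |inner ℝ (q i) (x i j)|} := by
    intro x hx
    simpa only [PredEvent, Set.mem_ofPred_eq, not_forall, not_le] using hx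
  refine (measure_mono hsub).trans ((measure_exists_le
    (c := h.mbar * (2 * Real.exp (-(4 * (k * Real.log n))))) (by positivity) fun i =>
    measure_exists_le (by positivity) fun j => ?_).trans (ENNReal.ofReal_le_ofReal ?_))
  · refine (measure_abs_inner_gt_le hp hL i j (q i) (by positivity)).trans (le_of_eq ?_)
    rw [mul_pow, mul_pow, Real.sq_sqrt (by positivity)]
    congr 4
    field_simp; ring
  · rw [← r.exp_neg_eq]
    have hn := r.natCast_le_exp
    set X := k * Real.log n
    have hX0 : 0 ≤ X := by positivity
    calc (n : ℝ) * (h.mbar * (2 * Real.exp (-(4 * X))))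
        ≤ Real.exp X * (h.mbar * (2 * Real.exp (-(4 * X)))) := by gcongr
      _ = 2 * h.mbar * (Real.exp X * Real.exp (-(4 * X))) := by ring
      _ ≤ _ := by
          rw [← Real.exp_add]
          gcongr
          linarith

include hp hL hNE hNE1 in
lemma measure_inputEvent_le :
    batchLaw h.mbar p {x | ¬ InputEvent L NE x} ≤
      ENNReal.ofReal (2 * h.mbar * (1 / (n : ℝ) ^ k)) := by
  have hL0 : 0 < L := by have := r.one_le_L; linarith
  have hcard : (NE.card : ℝ) ≤ 5 ^ d := by exact_mod_cast hNE
  have hsub : {x : Fin n → Fin h.mbar → EuclideanSpace ℝ (Fin d) | ¬ InputEvent L NE x} ⊆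
      {x | ∃ i, ∃ j, ∃ u ∈ NE, 2 * L * √d < inner ℝ u (x i j)} := by
    intro x hx
    simpa only [InputEvent, Set.mem_ofPred_eq, not_forall, not_le, exists_prop] using hx
  refine (measure_mono hsub).trans ((measure_exists_le
    (c := h.mbar * (5 ^ d * (2 * Real.exp (-(4 * d))))) (by positivity) fun i =>
    measure_exists_le (by positivity) fun j => measure_exists_mem_le NE (by positivity) hcard
    fun u hu => ?_).trans (ENNReal.ofReal_le_ofReal ?_))
  · have h1 := measure_abs_inner_gt_le (l := h.mbar) hp hL i j u (s := 2 * L * √d) (by positivity)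
    refine (measure_mono ?_).trans (h1.trans (le_of_eq ?_))
    · intro x hx
      simp only [Set.mem_ofPred_eq] at hx ⊢
      refine lt_of_le_of_lt ?_ (hx.trans_le (le_abs_self _))
      exact mul_le_of_le_one_right (by positivity) (hNE1 u hu)
    · rw [mul_pow, mul_pow, Real.sq_sqrt (by positivity)]
      congr 4
      field_simp; ring
  · rw [← r.exp_neg_eq]
    have hn := r.natCast_le_exp
    have h5 := five_pow_le_exp_two_mul d
    have hdim := r.dim
    set X := k * Real.log n
    calc (n : ℝ) * (h.mbar * (5 ^ d * (2 * Real.exp (-(4 * d)))))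
        ≤ Real.exp X * (h.mbar * (Real.exp (2 * d) * (2 * Real.exp (-(4 * d))))) := by gcongr
      _ = 2 * h.mbar * (Real.exp X * (Real.exp (2 * d) * Real.exp (-(4 * d)))) := by ring
      _ ≤ _ := by
          rw [← Real.exp_add, ← Real.exp_add]
          gcongr
          linarith

include hp hL hm₂ hNV hNV1 hNE hNE1 in
lemma measure_gradEvent_le {R : ℝ} (hR : 0 ≤ R) (q : Fin n → EuclideanSpace ℝ (Fin d))
    (w : Fin n → EuclideanSpace ℝ (Fin k)) :
    batchLaw h.mbar p {x | ¬ GradEvent NV NE (1 / (80 * (μ ^ 2 * k))) R q w x} ≤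
      ENNReal.ofReal (1 / (n : ℝ) ^ k) := by
  have hL0 : 0 < L := by have := r.one_le_L; linarith
  have hcardE : (NE.card : ℝ) ≤ 5 ^ d := by exact_mod_cast hNE
  have hcardV : (NV.card : ℝ) ≤ 5 ^ k := by exact_mod_cast hNV
  have hμk := r.one_le_μ_sq_mul
  have hn := r.n_pos
  have hμ := r.μ_pos
  have hk := r.k_pos
  -- the event holds trivially if the gradients exceed the scale `R`
  by_cases hwq : ∀ i, ‖w i‖ * ‖q i‖ ≤ R
  swap
  · have : {x : Fin n → Fin h.mbar → EuclideanSpace ℝ (Fin d) |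
        ¬ GradEvent NV NE (1 / (80 * (μ ^ 2 * k))) R q w x} = ∅ := by
      ext x
      simp [GradEvent, hwq]
    rw [this]; simp
  -- this exponent pays for `5 ^ d * 5 ^ k` net points
  have e1 : 5 * (d : ℝ) ≤ n * h.mbar * (1 / (80 * (μ ^ 2 * k))) ^ 2 / (64 * L ^ 4) := by
    rw [le_div_iff₀ (by positivity), one_div, inv_pow, ← div_eq_mul_inv,
      le_div_iff₀ (by positivity)]
    have h1 : 2 ^ 21 * L ^ 4 * (μ ^ 4 * k ^ 2 * d) ≤ h.mbar * n := by
      rw [← mul_div_assoc, div_le_iff₀ hn] at hm₂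
      exact hm₂
    have h2 : 0 ≤ L ^ 4 * (μ ^ 4 * k ^ 2 * d) := by positivity
    nlinarith
  have hsub : {x : Fin n → Fin h.mbar → EuclideanSpace ℝ (Fin d) |
      ¬ GradEvent NV NE (1 / (80 * (μ ^ 2 * k))) R q w x} ⊆
      {x | ∃ u ∈ NE, ∃ u' ∈ NV, 1 / (80 * (μ ^ 2 * k)) * R * (n * h.mbar) <
        ∑ i, ∑ j, inner ℝ (w i) u' * (inner ℝ (q i) (x i j) * inner ℝ u (x i j) -
          inner ℝ (q i) u)} := by
    intro x hx
    simp only [GradEvent, Set.mem_ofPred_eq, Classical.not_imp, not_forall, not_le] at hx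
    obtain ⟨-, u, hu, u', hu', hx⟩ := hx
    exact ⟨u, hu, u', hu', hx⟩
  refine (measure_mono hsub).trans ((measure_exists_mem_le
    (c := 5 ^ k * Real.exp (-(5 * d))) NE (by positivity) hcardE fun u hu =>
    measure_exists_mem_le NV (by positivity) hcardV fun u' hu' => ?_).trans
    (ENNReal.ofReal_le_ofReal ?_))
  · refine (measure_pooled_deviation_le (l := h.mbar) hp hL q (fun i => inner ℝ (w i) u') hR
      (fun i => ?_) (hNE1 u hu) (by positivity) ?_).trans
      (ENNReal.ofReal_le_ofReal (Real.exp_le_exp.2 (neg_le_neg e1)))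
    · refine le_trans ?_ (hwq i)
      refine mul_le_mul_of_nonneg_right ?_ (norm_nonneg _)
      exact (abs_real_inner_le_norm _ _).trans
        (mul_le_of_le_one_right (norm_nonneg _) (hNV1 u' hu'))
    · rw [div_le_one (by positivity)]; linarith
  · rw [← r.exp_neg_eq]
    have h5 := five_pow_le_exp_two_mul d
    have h5k : (5 : ℝ) ^ k ≤ Real.exp (2 * d) :=
      (pow_le_pow_right₀ (by norm_num) r.k_le).trans h5
    have hdim := r.dim
    calc (5 : ℝ) ^ d * (5 ^ k * Real.exp (-(5 * d)))
        ≤ Real.exp (2 * d) * (Real.exp (2 * d) * Real.exp (-(5 * d))) := by gcongr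
      _ ≤ _ := by
          rw [← Real.exp_add, ← Real.exp_add]
          exact Real.exp_le_exp.2 (by linarith)

include hNV hNV1 hNE hNE1 in
lemma measure_noiseEvent_le :
    gaussMatrix d k {W | ¬ NoiseEvent NV NE W} ≤ ENNReal.ofReal (1 / (n : ℝ) ^ k) := by
  have hcardE : (NE.card : ℝ) ≤ 5 ^ d := by exact_mod_cast hNE
  have hcardV : (NV.card : ℝ) ≤ 5 ^ k := by exact_mod_cast hNV
  have hsub : {W : Fin d → Fin k → ℝ | ¬ NoiseEvent NV NE W} ⊆
      {W | ∃ u ∈ NE, ∃ u' ∈ NV, 4 * √d < inner ℝ u (op (Matrix.of W) u')} := by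
    intro x hx
    simpa only [NoiseEvent, Set.mem_ofPred_eq, not_forall, not_le, exists_prop] using hx
  refine (measure_mono hsub).trans ((measure_exists_mem_le
    (c := 5 ^ k * Real.exp (-(8 * d))) NE (by positivity) hcardE fun u hu =>
    measure_exists_mem_le NV (by positivity) hcardV fun u' hu' => ?_).trans
    (ENNReal.ofReal_le_ofReal ?_))
  · refine (gaussMatrix_deviation_le (hNE1 u hu) (hNV1 u' hu') (by positivity)).trans (le_of_eq ?_)
    rw [mul_pow, Real.sq_sqrt (by positivity)]
    congr 3; ring
  · rw [← r.exp_neg_eq]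
    have h5 := five_pow_le_exp_two_mul d
    have h5k : (5 : ℝ) ^ k ≤ Real.exp (2 * d) :=
      (pow_le_pow_right₀ (by norm_num) r.k_le).trans h5
    have hdim := r.dim
    calc (5 : ℝ) ^ d * (5 ^ k * Real.exp (-(8 * d)))
        ≤ Real.exp (2 * d) * (Real.exp (2 * d) * Real.exp (-(8 * d))) := by gcongr
      _ ≤ _ := by
          rw [← Real.exp_add, ← Real.exp_add]
          exact Real.exp_le_exp.2 (by have := r.d_pos; linarith)

include hp hL hm₁ hm₂ hNV hNV1 hNE hNE1 in
/-- For a column orthonormal representation `B`, a round fails with probability of order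
`mbar n ^ (-k)`. -/
lemma measure_not_goodStep_le {B : Mat d k} (hB : Bᵀ * B = 1) :
    stepLaw h.mbar k p {ξ | ¬ GoodStep Bst Wst μ s_k κ L NV NE B ξ} ≤
      ENNReal.ofReal (8 * h.mbar / (n : ℝ) ^ k) := by
  have := fun i => (hp i).prob
  set ρ : ℝ := 1 / (n : ℝ) ^ k with hρ
  have hρ0 : 0 ≤ ρ := by positivity
  have hl : (1 : ℝ) ≤ h.mbar := by exact_mod_cast r.batch_pos
  have hRm : 0 ≤ gradScale μ s_k k (angleDist B Bst) := by
    have := angleDist_nonneg B Bst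
    unfold gradScale; positivity
  unfold stepLaw
  have m1 : Measurable fun ξ : StepData n h.mbar d k => ξ.1 := measurable_fst
  have m2 : Measurable fun ξ : StepData n h.mbar d k => ξ.2.1 := measurable_fst.comp measurable_snd
  have m1i : ∀ i, Measurable fun ξ : StepData n h.mbar d k => ξ.1 i := fun i =>
    (measurable_pi_apply i).comp m1
  have hq : Measurable fun (ξ : StepData n h.mbar d k) i => predErr B Bst (Wst i) (ξ.1 i) :=
    measurable_pi_iff.2 fun i => measurable_predErr Bst (Wst i) measurable_const (m1i i)
  have hw : Measurable fun (ξ : StepData n h.mbar d k) i => headOf B Bst (Wst i) (ξ.1 i) :=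
    measurable_pi_iff.2 fun i => measurable_headOf Bst (Wst i) measurable_const (m1i i)
  -- events on the second batches, for given first batches
  have hcond : ∀ (P : (Fin n → Fin h.mbar → EuclideanSpace ℝ (Fin d)) →
      (Fin n → Fin h.mbar → EuclideanSpace ℝ (Fin d)) → Prop) (c : ℝ≥0∞),
      Measurable (fun ξ : StepData n h.mbar d k => P ξ.1 ξ.2.1) →
      (∀ x, batchLaw h.mbar p {y | ¬ P x y} ≤ c) →
      ((batchLaw h.mbar p).prod ((batchLaw h.mbar p).prod (gaussMatrix d k)))
        {ξ | ¬ P ξ.1 ξ.2.1} ≤ c := fun P c hP hbound =>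
    prod_measure_le_of_forall (measurableSet_setOfPred.2 hP.not) fun x =>
      (prod_measure_fst fun y => ¬ P x y).le.trans (hbound x)
  have b1 := r.measure_headEvent_le hp hL hm₁ hNV hNV1 hB
  rw [← prod_measure_fst (Q := (batchLaw h.mbar p).prod (gaussMatrix d k))] at b1
  have b2 := hcond (fun x y => PredEvent L k (fun i => predErr B Bst (Wst i) (x i)) y) _
    (measurable_predEvent L hq m2) fun x => r.measure_predEvent_le hp hL _
  have b3 := hcond (fun x y => InputEvent L NE y) _ (measurable_inputEvent L NE m2)
    fun x => r.measure_inputEvent_le hp hL hNE hNE1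
  have b4 := hcond (fun x y => GradEvent NV NE (1 / (80 * (μ ^ 2 * k)))
    (gradScale μ s_k k (angleDist B Bst)) (fun i => predErr B Bst (Wst i) (x i))
    (fun i => headOf B Bst (Wst i) (x i)) y) _
    (measurable_gradEvent NV NE _ measurable_const hq hw m2)
    fun x => r.measure_gradEvent_le hp hL hm₂ hNV hNV1 hNE hNE1 hRm _ _
  have b5 := r.measure_noiseEvent_le hNV hNV1 hNE hNE1
  rw [← prod_measure_snd (P := batchLaw h.mbar p), ← prod_measure_snd (P := batchLaw h.mbar p)]
    at b5
  refine (measure_mono ?_).trans ((measure_or_le (by positivity) (by positivity) b1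
    (measure_or_le (by positivity) (by positivity) b2 (measure_or_le (by positivity)
      (by positivity) b3 (measure_or_le (by positivity) (by positivity) b4 b5)))).trans
    (ENNReal.ofReal_le_ofReal ?_))
  · intro ξ hξ
    simpa only [GoodStep, Set.mem_ofPred_eq, not_and_or, not_forall] using hξ
  · rw [← hρ, mul_div_assoc, ← mul_one_div, ← hρ]
    nlinarith

end Regime

end Step

/-! ### Trajectories driven by independent rounds -/

section Chain

variable {S Ξ Ω : Type*} {T : ℕ}

/-- The states visited from `b` when round `t` applies `F` with the randomness `ξ t`. -/
def traj (F : S → Ξ → S) (b : S) (ξ : Fin T → Ξ) : Fin (T + 1) → S :=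
  Fin.induction b fun t s => F s (ξ t)

lemma traj_zero (F : S → Ξ → S) (b : S) (ξ : Fin T → Ξ) : traj F b ξ 0 = b := rfl

lemma traj_succ (F : S → Ξ → S) (b : S) (ξ : Fin T → Ξ) (t : Fin T) :
    traj F b ξ t.succ = F (traj F b ξ t.castSucc) (ξ t) := Fin.induction_succ _ _ t

lemma traj_congr (F : S → Ξ → S) (b : S) {ξ ξ' : Fin T → Ξ} (t : Fin (T + 1))
    (h : ∀ s : Fin T, s.castSucc < t → ξ s = ξ' s) : traj F b ξ t = traj F b ξ' t := by
  induction t using Fin.induction with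
  | zero => rfl
  | succ t ih =>
    rw [traj_succ, traj_succ, h t (Fin.castSucc_lt_succ), ih fun s hs =>
      h s (hs.trans Fin.castSucc_lt_succ)]

variable [MeasurableSpace S] [MeasurableSpace Ξ] [MeasurableSpace Ω]

lemma measurable_traj {F : S → Ξ → S} (hF : Measurable fun z : S × Ξ => F z.1 z.2) {b : Ω → S}
    {ξ : Ω → Fin T → Ξ} (hb : Measurable b) (hξ : Measurable ξ) (t : Fin (T + 1)) :
    Measurable fun ω => traj F (b ω) (ξ ω) t := by
  induction t using Fin.induction with
  | zero => exact hb
  | succ t ih =>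
    simp only [traj_succ]
    exact hF.comp (ih.prodMk ((measurable_pi_apply t).comp hξ))

/-- A state that does not depend on round `t` meets a bad outcome of round `t` with probability at
most the worst probability over fixed states. -/
lemma pi_measure_le_of_forall {ν : Measure Ξ} [IsProbabilityMeasure ν] {bad : S → Ξ → Prop}
    (hbad : Measurable fun z : S × Ξ => bad z.1 z.2) {c : ℝ≥0∞} (hc : ∀ b, ν {x | bad b x} ≤ c)
    (t : Fin T) {f : (Fin T → Ξ) → S} (hf : Measurable f)
    (hft : ∀ ξ ξ', (∀ s ≠ t, ξ s = ξ' s) → f ξ = f ξ') :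
    (Measure.pi fun _ : Fin T => ν) {ξ | bad (f ξ) (ξ t)} ≤ c := by
  obtain _ | T := T
  · exact t.elim0
  have hms : MeasurableSet {ξ : Fin (T + 1) → Ξ | bad (f ξ) (ξ t)} :=
    measurableSet_setOfPred.2 (hbad.comp (hf.prodMk (measurable_pi_apply t)))
  have mp := (measurePreserving_piFinSuccAbove (fun _ : Fin (T + 1) => ν) t).symm
  rw [← mp.measure_preimage hms.nullMeasurableSet, Measure.prod_apply_symm (mp.measurable hms)]
  obtain ⟨x₀⟩ : Nonempty Ξ := nonempty_of_isProbabilityMeasure ν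
  refine (lintegral_mono (g := fun _ => c) fun y => ?_).trans (by simp)
  refine le_trans (measure_mono ?_) (hc (f (t.insertNth x₀ y)))
  intro x hx
  have e : f (t.insertNth x y) = f (t.insertNth x₀ y) := by
    refine hft _ _ fun s hs => ?_
    obtain ⟨s, rfl⟩ := Fin.exists_succAbove_eq hs
    simp
  have hx' : bad (f (t.insertNth x y)) ((t.insertNth x y : Fin (T + 1) → Ξ) t) := hx
  rw [e, Fin.insertNth_apply_same] at hx'
  exact hx'

/-- Union bound over the rounds, on an event `A` of the initialization. -/
lemma measure_exists_bad_le {P : Measure Ω} [SFinite P] {ν : Measure Ξ} [IsProbabilityMeasure ν]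
    {F : S → Ξ → S} (hF : Measurable fun z : S × Ξ => F z.1 z.2) {bad : S → Ξ → Prop}
    (hbad : Measurable fun z : S × Ξ => bad z.1 z.2) {c : ℝ} (hc0 : 0 ≤ c)
    (hc : ∀ b, ν {x | bad b x} ≤ ENNReal.ofReal c) {b : Ω → S} (hb : Measurable b) {A : Set Ω}
    (hA : MeasurableSet A) :
    P.prod (Measure.pi fun _ : Fin T => ν)
      {z | z.1 ∈ A ∧ ∃ t : Fin T, bad (traj F (b z.1) z.2 t.castSucc) (z.2 t)} ≤
      ENNReal.ofReal (T * c) * P A := by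
  have hms : MeasurableSet {z : Ω × (Fin T → Ξ) |
      z.1 ∈ A ∧ ∃ t : Fin T, bad (traj F (b z.1) z.2 t.castSucc) (z.2 t)} := by
    refine measurableSet_setOfPred.2 (Measurable.and (measurableSet_setOfPred.1 ?_) ?_)
    · exact measurable_fst hA
    · refine Measurable.exists fun t => ?_
      have h1 : Measurable fun z : Ω × (Fin T → Ξ) => traj F (b z.1) z.2 t.castSucc :=
        measurable_traj hF (hb.comp measurable_fst) measurable_snd _
      exact hbad.comp (h1.prodMk ((measurable_pi_apply t).comp measurable_snd))
  rw [Measure.prod_apply hms, ← setLIntegral_const, ← lintegral_indicator hA]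
  refine lintegral_mono fun ω => ?_
  by_cases hω : ω ∈ A
  · rw [Set.indicator_of_mem hω]
    refine le_trans (measure_mono ?_) (measure_exists_le hc0 fun t => pi_measure_le_of_forall
      hbad hc t (f := fun ξ => traj F (b ω) ξ t.castSucc)
      (measurable_traj hF measurable_const measurable_id _)
      fun ξ ξ' hξ => traj_congr F _ _ fun s hs => hξ s (Fin.castSucc_lt_castSucc_iff.1 hs).ne)
    intro ξ hξ
    exact hξ.2
  · rw [Set.indicator_of_notMem hω]
    simp [hω]

end Chain

/-! ### The trajectory of the representations -/

section Rounds

variable {n d k : ℕ} {Bst : Mat d k} {Wst : Matrix (Fin n) (Fin k) ℝ} {μ s₁ s_k κ L : ℝ}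
  {h : Hyper} {NV : Finset (EuclideanSpace ℝ (Fin k))} {NE : Finset (EuclideanSpace ℝ (Fin d))}

/-- One round of the main loop, with the explicit heads. -/
noncomputable def roundStep (h : Hyper) (Bst : Mat d k) (Wst : Matrix (Fin n) (Fin k) ℝ)
    (B : Mat d k) (ξ : StepData n h.mbar d k) : Mat d k :=
  qrQ (rawStep h Bst Wst B ξ.1 ξ.2.1 ξ.2.2)

/-- A round fails if a deviation event fails at a column orthonormal representation. -/
def BadStep (h : Hyper) (Bst : Mat d k) (Wst : Matrix (Fin n) (Fin k) ℝ) (μ s_k κ L : ℝ)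
    (NV : Finset (EuclideanSpace ℝ (Fin k))) (NE : Finset (EuclideanSpace ℝ (Fin d)))
    (B : Mat d k) (ξ : StepData n h.mbar d k) : Prop :=
  Bᵀ * B = 1 ∧ ¬ GoodStep Bst Wst μ s_k κ L NV NE B ξ

lemma measurable_roundStep (h : Hyper) (Bst : Mat d k) (Wst : Matrix (Fin n) (Fin k) ℝ) :
    Measurable fun z : Mat d k × StepData n h.mbar d k => roundStep h Bst Wst z.1 z.2 :=
  measurable_qrQ (measurable_rawStep h Bst Wst measurable_fst (by fun_prop) (by fun_prop)
    (by fun_prop))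

lemma measurable_badStep :
    Measurable fun z : Mat d k × StepData n h.mbar d k =>
      BadStep h Bst Wst μ s_k κ L NV NE z.1 z.2 := by
  refine Measurable.and ?_ (measurable_goodStep measurable_fst measurable_snd).not
  have hm : Measurable fun z : Mat d k × StepData n h.mbar d k => z.1ᵀ * z.1 :=
    measurable_matrix_mul (measurable_matrix_transpose measurable_fst) measurable_fst
  simp only [← Matrix.ext_iff]
  refine Measurable.forall fun a => Measurable.forall fun b => measurableSet_setOfPred.1 ?_
  exact measurableSet_eq_fun (measurable_mat_iff.1 hm a b) measurable_const

namespace Regime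

variable (r : Regime Bst Wst μ s₁ s_k κ L h)

include r

lemma measure_badStep_le {K : ℝ≥0} {p : Fin n → Measure (EuclideanSpace ℝ (Fin d))}
    (hp : ∀ i, IsIsotropicSubgaussian K (p i)) (hL : L = K + 1)
    (hm₁ : 2 ^ 21 * L ^ 4 * (κ ^ 2 * k ^ 2 * Real.log n) ≤ h.mbar)
    (hm₂ : 2 ^ 21 * L ^ 4 * (μ ^ 4 * k ^ 2 * d / n) ≤ h.mbar)
    (hNV : NV.card ≤ 5 ^ k) (hNV1 : ∀ u ∈ NV, ‖u‖ ≤ 1)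
    (hNE : NE.card ≤ 5 ^ d) (hNE1 : ∀ u ∈ NE, ‖u‖ ≤ 1) (B : Mat d k) :
    stepLaw h.mbar k p {ξ | BadStep h Bst Wst μ s_k κ L NV NE B ξ} ≤
      ENNReal.ofReal (8 * h.mbar / (n : ℝ) ^ k) := by
  by_cases hB : Bᵀ * B = 1
  · simpa only [BadStep, hB, true_and] using
      r.measure_not_goodStep_le hp hL hm₁ hm₂ hNV hNV1 hNE hNE1 hB
  · simp [BadStep, hB]

/-- As long as no round fails, the distance decays geometrically down to the noise floor. -/
lemma traj_bound {T : ℕ} (hNV : IsHalfNet NV) (hNE : IsHalfNet NE) {B : Mat d k}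
    {ξ : Fin T → StepData n h.mbar d k} (hB : Bᵀ * B = 1) (hD : angleDist B Bst ≤ 0.2)
    (hgood : ∀ t : Fin T, ¬ BadStep h Bst Wst μ s_k κ L NV NE
      (traj (roundStep h Bst Wst) B ξ t.castSucc) (ξ t)) (t : Fin (T + 1)) :
    (traj (roundStep h Bst Wst) B ξ t)ᵀ * traj (roundStep h Bst Wst) B ξ t = 1 ∧
    angleDist (traj (roundStep h Bst Wst) B ξ t) Bst ≤ 0.2 ∧
    angleDist (traj (roundStep h Bst Wst) B ξ t) Bst ≤
      0.2 * (1 - 0.05 / κ ^ 2) ^ (t : ℕ) + 640 * (κ ^ 2 * noiseLevel n d h) := by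
  have hκ := r.one_le_κ
  have hν := r.noiseLevel_nonneg
  have hκν : κ ^ 2 * noiseLevel n d h ≤ 1 / 3200 := by
    have := r.noise; unfold noiseLevel; linarith
  set a : ℝ := 0.05 / κ ^ 2 with ha
  have ha1 : a ≤ 1 := by
    rw [ha, div_le_one (by positivity)]
    have := one_le_pow₀ (n := 2) hκ
    linarith
  have hfix : 640 * (κ ^ 2 * noiseLevel n d h) * a = 32 * noiseLevel n d h := by
    rw [ha]; field_simp; norm_num; ring
  have hfix2 : 32 * noiseLevel n d h ≤ 0.2 * a := by
    have h0 : 0 ≤ a := by positivity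
    rw [← hfix]
    exact mul_le_mul_of_nonneg_right (by linarith) h0
  induction t using Fin.induction with
  | zero =>
    refine ⟨hB, hD, ?_⟩
    simp only [traj_zero, Fin.val_zero, pow_zero]
    have : 0 ≤ κ ^ 2 * noiseLevel n d h := by positivity
    linarith
  | succ t ih =>
    obtain ⟨i1, i2, i3⟩ := ih
    rw [traj_succ]
    set B' := traj (roundStep h Bst Wst) B ξ t.castSucc
    have hg : GoodStep Bst Wst μ s_k κ L NV NE B' (ξ t) := not_not.1 fun h' => hgood t ⟨i1, h'⟩
    obtain ⟨g1, g2, g3, g4, g5⟩ := hg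
    obtain ⟨s1, s2⟩ := r.angleDist_qrQ_rawStep_le hNV i1 i2 g1 hNE g2 g3 g4 g5
    rw [← ha] at s2
    refine ⟨s1, s2.trans ?_, s2.trans ?_⟩
    · have := mul_le_mul_of_nonneg_right i2 (sub_nonneg.2 ha1)
      linarith
    · have := mul_le_mul_of_nonneg_right i3 (sub_nonneg.2 ha1)
      rw [Fin.val_succ, pow_succ (1 - a)]
      simp only [Fin.val_castSucc] at this
      linarith

end Regime

end Rounds

/-! ### Rearranging independent coordinates -/

section Rearrange

/-- Distinct coordinates of a product measure have the product law. -/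
lemma measurePreserving_comp_of_injective {ι κ E : Type*} [Fintype ι] [Fintype κ]
    [MeasurableSpace E] (μ : ι → Measure E) [∀ i, IsProbabilityMeasure (μ i)] {f : κ → ι}
    (hf : Function.Injective f) :
    MeasurePreserving (fun (x : ι → E) j => x (f j)) (Measure.pi μ)
      (Measure.pi fun j => μ (f j)) := by
  have hm : Measurable fun (x : ι → E) j => x (f j) :=
    measurable_pi_iff.2 fun j => measurable_pi_apply _
  refine ⟨hm, (Measure.pi_eq fun s hs => ?_).symm⟩
  rw [Measure.map_apply hm (MeasurableSet.univ_pi hs)]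
  have e : (fun (x : ι → E) j => x (f j)) ⁻¹' Set.univ.pi s =
      Set.univ.pi fun i => {y | ∀ j, f j = i → y ∈ s j} := by
    ext x
    simp only [Set.mem_preimage, Set.mem_pi, Set.mem_univ, forall_true_left, Set.mem_ofPred_eq]
    exact ⟨fun h i j hj => hj ▸ h j, fun h j => h _ j rfl⟩
  rw [e, Measure.pi_pi]
  refine (Fintype.prod_of_injective f hf _ _ (fun i hi => ?_) fun j => ?_).symm
  · have : {y : E | ∀ j, f j = i → y ∈ s j} = Set.univ := by
      ext y
      simp only [Set.mem_ofPred_eq, Set.mem_univ, iff_true]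
      exact fun j hj => absurd ⟨j, hj⟩ hi
    rw [this, measure_univ]
  · congr 1
    ext y
    simp only [Set.mem_ofPred_eq]
    exact ⟨fun hy j' hj' => hf hj' ▸ hy, fun hy => hy j rfl⟩

lemma measurePreserving_curry {ι κ E : Type*} [Fintype ι] [Fintype κ] [MeasurableSpace E]
    (μ : ι → κ → Measure E) [∀ i j, IsProbabilityMeasure (μ i j)] :
    MeasurePreserving (MeasurableEquiv.curry ι κ E) (Measure.pi fun q : ι × κ => μ q.1 q.2)
      (Measure.pi fun i => Measure.pi (μ i)) := by
  refine ⟨(MeasurableEquiv.curry ι κ E).measurable, ?_⟩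
  simpa only [Measure.infinitePi_eq_pi] using Measure.infinitePi_map_curry μ

lemma measurePreserving_prodSumCurry {ι κ₁ κ₂ E : Type*} [Fintype ι] [Fintype κ₁] [Fintype κ₂]
    [MeasurableSpace E] (μ : ι → Measure E) [∀ i, IsProbabilityMeasure (μ i)] :
    MeasurePreserving (fun (x : (ι × κ₁) ⊕ (ι × κ₂) → E) =>
        ((fun i j => x (.inl (i, j)) : ι → κ₁ → E), (fun i j => x (.inr (i, j)) : ι → κ₂ → E)))
      (Measure.pi fun q => μ (Sum.elim Prod.fst Prod.fst q))
      ((Measure.pi fun i => Measure.pi fun _ : κ₁ => μ i).prod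
        (Measure.pi fun i => Measure.pi fun _ : κ₂ => μ i)) :=
  ((measurePreserving_curry fun i (_ : κ₁) => μ i).prod
    (measurePreserving_curry fun i (_ : κ₂) => μ i)).comp
    (measurePreserving_sumPiEquivProdPi fun q : (ι × κ₁) ⊕ (ι × κ₂) =>
      μ (Sum.elim Prod.fst Prod.fst q))

/-- Regroup five independent components. -/
lemma measurePreserving_regroup {A B C Z D : Type*} [MeasurableSpace A] [MeasurableSpace B]
    [MeasurableSpace C] [MeasurableSpace Z] [MeasurableSpace D] (a : Measure A) (b : Measure B)
    (c : Measure C) (z : Measure Z) (e : Measure D) [SFinite a] [SFinite b] [SFinite c]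
    [SFinite z] [SFinite e] :
    MeasurePreserving (fun x : (A × (B × C)) × (Z × D) =>
        ((x.2.1, (x.1.1, x.1.2.1)), (x.2.2, x.1.2.2)))
      ((a.prod (b.prod c)).prod (z.prod e)) ((z.prod (a.prod b)).prod (e.prod c)) := by
  have h1 := ((measurePreserving_prodAssoc a b c).symm.prod (MeasurePreserving.id (z.prod e)))
  have h2 := measurePreserving_prodAssoc (a.prod b) c (z.prod e)
  have h3 := (MeasurePreserving.id (a.prod b)).prod
    ((measurePreserving_prodAssoc z e c).comp (Measure.measurePreserving_swap (μ := c)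
      (ν := z.prod e)))
  have h4 := (measurePreserving_prodAssoc (a.prod b) z (e.prod c)).symm
  have h5 := (Measure.measurePreserving_swap (μ := a.prod b) (ν := z)).prod
    (MeasurePreserving.id (e.prod c))
  exact h5.comp (h4.comp (h3.comp (h2.comp h1)))

end Rearrange

/-! ### The data in the order in which they are drawn -/

section Draw

variable {n m d k : ℕ}

/-- The data point drawn at position `q`; `0` beyond the end of the data set. -/
noncomputable def drawn (x : Fin m → EuclideanSpace ℝ (Fin d)) (π : Equiv.Perm (Fin m)) (q : ℕ) :
    EuclideanSpace ℝ (Fin d) :=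
  if hq : q < m then x (π.symm ⟨q, hq⟩) else 0

/-- The indices of the data points drawn at the positions `off, …, off + len - 1`. -/
def drawnIdx (π : Equiv.Perm (Fin m)) {off len : ℕ} (hm : off + len ≤ m) : Fin len ↪ Fin m :=
  ⟨fun r => π.symm ⟨off + r, by omega⟩, fun r r' hr => by
    have := congrArg Fin.val (π.symm.injective hr)
    ext; simpa using this⟩

lemma drawn_eq (x : Fin m → EuclideanSpace ℝ (Fin d)) (π : Equiv.Perm (Fin m)) {off len : ℕ}
    (hm : off + len ≤ m) (r : Fin len) : drawn x π (off + r) = x (drawnIdx π hm r) := by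
  unfold drawn
  rw [dif_pos (by omega)]; rfl

lemma val_drawnIdx_one {off len : ℕ} (hm : off + len ≤ m) (r : Fin len) :
    (drawnIdx (1 : Equiv.Perm (Fin m)) hm r : ℕ) = off + r := rfl

lemma batch_eq_map (π : Equiv.Perm (Fin m)) {off len : ℕ} (hm : off + len ≤ m) :
    batch π off len = Finset.univ.map (drawnIdx π hm) := by
  ext j
  simp only [batch, Finset.mem_filter, Finset.mem_univ, true_and, Finset.mem_map]
  change _ ↔ ∃ r : Fin len, π.symm ⟨off + r, _⟩ = j
  constructor
  · rintro ⟨h1, h2⟩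
    refine ⟨⟨π j - off, by omega⟩, ?_⟩
    rw [Equiv.symm_apply_eq]
    ext; simp only; omega
  · rintro ⟨r, hr⟩
    rw [Equiv.symm_apply_eq] at hr
    rw [← hr]
    simp only
    omega

/-- The data used by the initialization, in the order in which they are drawn. -/
noncomputable def initData (N : ℕ) (X : Inputs n m d) (π : Fin n → Equiv.Perm (Fin m)) :
    Inputs n N d := fun i r => drawn (X i) (π i) r

/-- The two mini-batches of round `t`, drawn after the first `N` data points. -/
noncomputable def roundInputs (N l : ℕ) {T : ℕ} (X : Inputs n m d)
    (π : Fin n → Equiv.Perm (Fin m)) (t : Fin T) : Inputs n l d × Inputs n l d :=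
  (fun i r => drawn (X i) (π i) (N + 2 * t * l + r),
    fun i r => drawn (X i) (π i) (N + (2 * t + 1) * l + r))

lemma measurable_drawn (q : ℕ) :
    Measurable fun z : Equiv.Perm (Fin m) × (Fin m → EuclideanSpace ℝ (Fin d)) =>
      drawn z.2 z.1 q := by
  refine measurable_from_prod_countable_right fun π => ?_
  unfold drawn
  split_ifs with hq
  · exact measurable_pi_apply (π.symm ⟨q, hq⟩)
  · exact measurable_const

/-- Uniqueness of quotient and remainder. -/
lemma eq_and_eq_of_mul_add_eq {N l q q' r r' : ℕ} (hr : r < l) (hr' : r' < l)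
    (h : N + q * l + r = N + q' * l + r') : q = q' ∧ r = r' := by
  have hl : 0 < l := by omega
  have h1 : (q * l + r) / l = q := by
    rw [mul_comm, Nat.mul_add_div hl, Nat.div_eq_of_lt hr, add_zero]
  have h2 : (q' * l + r') / l = q' := by
    rw [mul_comm, Nat.mul_add_div hl, Nat.div_eq_of_lt hr', add_zero]
  have h3 : q = q' := by rw [← h1, ← h2, show q * l + r = q' * l + r' by omega]
  subst h3
  exact ⟨rfl, by omega⟩

/-- The data point of a client that is used at a place of the run: in the initialization, or in the
first or the second mini-batch of a round. -/
def place (N l T : ℕ) (hm : N + 2 * T * l ≤ m) (π : Fin n → Equiv.Perm (Fin m)) :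
    (Fin n × Fin N) ⊕ (Fin T × ((Fin n × Fin l) ⊕ (Fin n × Fin l))) → Fin n × Fin m
  | .inl (i, r) => (i, (π i).symm ⟨r, by omega⟩)
  | .inr (t, .inl (i, r)) => (i, (π i).symm ⟨N + 2 * t * l + r, by
      have : (2 * t + 1) * l ≤ 2 * T * l := Nat.mul_le_mul_right _ (by omega)
      rw [add_mul, one_mul] at this; omega⟩)
  | .inr (t, .inr (i, r)) => (i, (π i).symm ⟨N + (2 * t + 1) * l + r, by
      have : (2 * t + 1 + 1) * l ≤ 2 * T * l := Nat.mul_le_mul_right _ (by omega)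
      rw [add_mul _ 1, one_mul] at this; omega⟩)

lemma place_injective (N l T : ℕ) (hm : N + 2 * T * l ≤ m) (π : Fin n → Equiv.Perm (Fin m)) :
    Function.Injective (place N l T hm π) := by
  have key : ∀ {i i' : Fin n} {q q' : Fin m},
      (i, (π i).symm q) = (i', (π i').symm q') → i = i' ∧ (q : ℕ) = q' := by
    intro i i' q q' h
    obtain ⟨rfl, h2⟩ := Prod.mk.inj h
    exact ⟨rfl, congrArg Fin.val ((π i).symm.injective h2)⟩
  rintro (⟨i, r⟩ | ⟨t, ⟨i, r⟩ | ⟨i, r⟩⟩) (⟨i', r'⟩ | ⟨t', ⟨i', r'⟩ | ⟨i', r'⟩⟩) h <;>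
    obtain ⟨rfl, h2⟩ := key h <;> simp only at h2
  · rw [Fin.ext h2]
  · omega
  · omega
  · omega
  · obtain ⟨h3, h4⟩ := eq_and_eq_of_mul_add_eq r.2 r'.2 h2
    rw [Fin.ext h4, Fin.ext (by omega : (t : ℕ) = t')]
  · obtain ⟨h3, h4⟩ := eq_and_eq_of_mul_add_eq r.2 r'.2 h2
    omega
  · omega
  · obtain ⟨h3, h4⟩ := eq_and_eq_of_mul_add_eq r.2 r'.2 h2
    omega
  · obtain ⟨h3, h4⟩ := eq_and_eq_of_mul_add_eq r.2 r'.2 h2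
    rw [Fin.ext h4, Fin.ext (by omega : (t : ℕ) = t')]

variable (p : Fin n → Measure (EuclideanSpace ℝ (Fin d))) [∀ i, IsProbabilityMeasure (p i)]

/-- For any orders of drawing, the data of the initialization and of the rounds are independent. -/
lemma measurePreserving_data (N l T : ℕ) (hm : N + 2 * T * l ≤ m)
    (π : Fin n → Equiv.Perm (Fin m)) :
    MeasurePreserving (fun X : Inputs n m d =>
        (initData N X π, fun t : Fin T => roundInputs N l X π t))
      (batchLaw m p)
      ((batchLaw N p).prod (Measure.pi fun _ : Fin T => (batchLaw l p).prod (batchLaw l p))) := by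
  have h1 := (measurePreserving_curry fun i (_ : Fin m) => p i).symm
  have h2 := measurePreserving_comp_of_injective (fun q : Fin n × Fin m => p q.1)
    (place_injective N l T hm π)
  have h3 := measurePreserving_sumPiEquivProdPi
    (fun j => p (place N l T hm π j).1)
  have h4 := measurePreserving_curry
    fun (t : Fin T) (q : (Fin n × Fin l) ⊕ (Fin n × Fin l)) => p (Sum.elim Prod.fst Prod.fst q)
  have h5 := measurePreserving_pi _ _ fun _ : Fin T =>
    measurePreserving_prodSumCurry (κ₁ := Fin l) (κ₂ := Fin l) p
  have h6 := (measurePreserving_curry fun i (_ : Fin N) => p i).prod (h5.comp h4)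
  have e1 : (fun j => p (place N l T hm π (.inl j)).1) = fun q : Fin n × Fin N => p q.1 := rfl
  have e2 : (fun j => p (place N l T hm π (.inr j)).1) =
      fun q : Fin T × ((Fin n × Fin l) ⊕ (Fin n × Fin l)) =>
        p (Sum.elim Prod.fst Prod.fst q.2) := by
    funext ⟨t, q⟩
    rcases q with q | q <;> rfl
  rw [e1, e2] at h3
  have h7 := h6.comp (h3.comp (h2.comp h1))
  convert! h7 using 1
  funext X
  refine Prod.ext ?_ ?_
  · funext i r
    change drawn _ _ _ = _
    unfold drawn
    rw [dif_pos (by omega)]; rfl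
  · funext t
    refine Prod.ext ?_ ?_
    · funext i r
      change drawn _ _ _ = _
      unfold drawn
      rw [dif_pos]; rfl
    · funext i r
      change drawn _ _ _ = _
      unfold drawn
      rw [dif_pos]; rfl

end Draw

/-! ### The run in terms of the drawn data -/

section Run

variable {n m d k T₀ L T : ℕ}

/-- The randomness of the initialization: the data it uses in the order in which they are drawn,
the starting matrices and the noise. -/
abbrev InitRandomness (n d k T₀ L N : ℕ) :=
  Inputs n N d × (Fin T₀ → Fin d → Fin k → ℝ) × (Fin T₀ → Fin L → Fin d → Fin k → ℝ)

/-- The law of the randomness of the initialization. -/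
noncomputable def initLaw (k T₀ L N : ℕ) (p : Fin n → Measure (EuclideanSpace ℝ (Fin d))) :
    Measure (InitRandomness n d k T₀ L N) :=
  (batchLaw N p).prod ((Measure.pi fun _ : Fin T₀ => gaussMatrix d k).prod
    (Measure.pi fun _ : Fin T₀ => Measure.pi fun _ : Fin L => gaussMatrix d k))

instance (k T₀ L N : ℕ) (p : Fin n → Measure (EuclideanSpace ℝ (Fin d)))
    [∀ i, IsProbabilityMeasure (p i)] : IsProbabilityMeasure (initLaw k T₀ L N p) := by
  unfold initLaw; infer_instance

/-- The part of the randomness of a run that the initialization uses. -/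
noncomputable def initPart (N : ℕ) (ω : Randomness n m d k T₀ L T) :
    InitRandomness n d k T₀ L N :=
  (initData N ω.1 ω.2.1, ω.2.2.1, ω.2.2.2.1)

/-- The randomness of the rounds of the main loop, `N` data points being used before. -/
noncomputable def roundPart (N l : ℕ) (ω : Randomness n m d k T₀ L T) (t : Fin T) :
    StepData n l d k :=
  ((roundInputs N l ω.1 ω.2.1 t).1, (roundInputs N l ω.1 ω.2.1 t).2, ω.2.2.2.2 t)

lemma measurable_roundInputs_initData (N l : ℕ) :
    Measurable fun z : (Fin n → Equiv.Perm (Fin m)) × Inputs n m d =>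
      (initData N z.2 z.1, fun t : Fin T => roundInputs N l z.2 z.1 t) := by
  have h1 : ∀ i q, Measurable fun z : (Fin n → Equiv.Perm (Fin m)) × Inputs n m d =>
      drawn (z.2 i) (z.1 i) q := fun i q => by
    have h2 : Measurable fun z : (Fin n → Equiv.Perm (Fin m)) × Inputs n m d => (z.1 i, z.2 i) :=
      ((measurable_pi_apply i).comp measurable_fst).prodMk
        ((measurable_pi_apply i).comp measurable_snd)
    exact (measurable_drawn q).comp h2
  refine Measurable.prodMk ?_ (measurable_pi_lambda _ fun t => Measurable.prodMk ?_ ?_) <;>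
  exact measurable_pi_lambda _ fun i => measurable_pi_lambda _ fun r => h1 i _

/-- Drawing without replacement, the initialization and the rounds use independent data, and the
law of the data of a round is that of two fresh mini-batches. -/
lemma measurePreserving_parts (p : Fin n → Measure (EuclideanSpace ℝ (Fin d)))
    [∀ i, IsProbabilityMeasure (p i)] (N l : ℕ) (hm : N + 2 * T * l ≤ m) :
    MeasurePreserving (fun ω : Randomness n m d k T₀ L T => (initPart N ω, roundPart N l ω))
      (runLaw m k T₀ L T p)
      ((initLaw k T₀ L N p).prod (Measure.pi fun _ : Fin T => stepLaw l k p)) := by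
  set ρ := (Measure.pi fun _ : Fin T₀ => gaussMatrix d k).prod
    ((Measure.pi fun _ : Fin T₀ => Measure.pi fun _ : Fin L => gaussMatrix d k).prod
      (Measure.pi fun _ : Fin T => gaussMatrix d k)) with hρ
  set P := Measure.pi fun _ : Fin n =>
    (PMF.uniformOfFintype (Equiv.Perm (Fin m))).toMeasure with hP
  have h1 : MeasurePreserving _ (runLaw m k T₀ L T p) ((P.prod ρ).prod (batchLaw m p)) :=
    Measure.measurePreserving_swap
  have h2 := MeasurePreserving.skew_product (μc := batchLaw m p)
    (measurePreserving_snd (μ := P) (ν := ρ))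
    (g := fun z X => (initData N X z.1, fun t : Fin T => roundInputs N l X z.1 t))
    ((measurable_roundInputs_initData N l).comp
      ((measurable_fst.comp measurable_fst).prodMk measurable_snd))
    (Filter.Eventually.of_forall fun z => (measurePreserving_data p N l T hm z.1).map_eq)
  have h3 := measurePreserving_regroup (Measure.pi fun _ : Fin T₀ => gaussMatrix d k)
    (Measure.pi fun _ : Fin T₀ => Measure.pi fun _ : Fin L => gaussMatrix d k)
    (Measure.pi fun _ : Fin T => gaussMatrix d k) (batchLaw N p)
    (Measure.pi fun _ : Fin T => (batchLaw l p).prod (batchLaw l p))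
  have h4 := (measurePreserving_arrowProdEquivProdArrow _ _ (Fin T)
    (fun _ => (batchLaw l p).prod (batchLaw l p)) (fun _ => gaussMatrix d k)).symm
  have h5 := measurePreserving_pi _ _ fun _ : Fin T =>
    measurePreserving_prodAssoc (batchLaw l p) (batchLaw l p) (gaussMatrix d k)
  have h6 := (MeasurePreserving.id (initLaw k T₀ L N p)).prod (h5.comp h4)
  exact h6.comp (h3.comp (h2.comp h1))

/-- The initialization as a function of the randomness that it uses. -/
noncomputable def initOf [NeZero T₀] (h : Hyper) (Bst : Mat d k)
    (Wst : Matrix (Fin n) (Fin k) ℝ) {N : ℕ} (z : InitRandomness n d k T₀ L N) : Mat d k :=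
  initialization (T := 0) h Bst Wst (z.1, 1, z.2.1, z.2.2, finZeroElim)

lemma measurable_initOf [NeZero T₀] (h : Hyper) (Bst : Mat d k) (Wst : Matrix (Fin n) (Fin k) ℝ)
    (N : ℕ) : Measurable fun z : InitRandomness n d k T₀ L N => initOf h Bst Wst z := by
  have hX : ∀ i j, Measurable fun z : InitRandomness n d k T₀ L N => z.1 i j := fun i j => by
    fun_prop
  have hy : ∀ i j, Measurable fun z : InitRandomness n d k T₀ L N =>
      responses Bst Wst z.1 i j := fun i j => by
    have := fun a => measurable_euclidean_iff.1 (hX i j) a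
    simp only [responses, response, dotProduct, Matrix.mulVec]
    fun_prop
  unfold initOf initialization
  exact measurable_crossValidate _ (f := fun (z : InitRandomness n d k T₀ L N) (c : Fin T₀) =>
      ppm h.σ₀ h.ζ₀ z.1 (responses Bst Wst z.1)
        (fun i l => batch ((1 : Fin n → Equiv.Perm (Fin N)) i) ((c * L + l) * h.m₀) h.m₀)
        (Matrix.of (z.2.1 c)) (fun l => Matrix.of (z.2.2 c l)))
    fun c => measurable_ppm _ _ _ hX hy (measurable_of.comp (by fun_prop))
      fun l => measurable_of.comp (by fun_prop)

lemma ppm_congr {m' : ℕ} (σ₀ ζ₀ : ℝ) (X : Inputs n m d) (X' : Inputs n m' d)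
    (y : Fin n → Fin m → ℝ) (y' : Fin n → Fin m' → ℝ) (S : Fin n → Fin L → Finset (Fin m))
    (S' : Fin n → Fin L → Finset (Fin m')) (X0 : Mat d k) (W : Fin L → Mat d k)
    (hc : ∀ i l, (S i l).card = (S' i l).card)
    (hs : ∀ i l, ∑ j ∈ S i l, (y i j) ^ 2 • Matrix.vecMulVec (X i j).ofLp (X i j).ofLp =
      ∑ j ∈ S' i l, (y' i j) ^ 2 • Matrix.vecMulVec (X' i j).ofLp (X' i j).ofLp) :
    ppm σ₀ ζ₀ X y S X0 W = ppm σ₀ ζ₀ X' y' S' X0 W := by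
  unfold ppm
  simp only [hc, hs]

lemma initialization_eq_initOf [NeZero T₀] (h : Hyper) (Bst : Mat d k)
    (Wst : Matrix (Fin n) (Fin k) ℝ) (ω : Randomness n m d k T₀ L T)
    (hm : T₀ * L * h.m₀ ≤ m) :
    initialization h Bst Wst ω = initOf h Bst Wst (initPart (T₀ * L * h.m₀) ω) := by
  unfold initOf initialization
  congr 1
  funext c
  have hb : ∀ l : Fin L, ((c : ℕ) * L + l) * h.m₀ + h.m₀ ≤ T₀ * L * h.m₀ := by
    intro l
    have h1 : (c : ℕ) * L + l + 1 ≤ T₀ * L := by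
      have := Nat.mul_le_mul_right L (Nat.succ_le_of_lt c.2)
      rw [Nat.succ_mul] at this
      have := l.2
      omega
    calc _ = ((c : ℕ) * L + l + 1) * h.m₀ := by ring
      _ ≤ _ := Nat.mul_le_mul_right _ h1
  refine ppm_congr _ _ _ _ _ _ _ _ _ _ (fun i l => ?_) fun i l => ?_
  · rw [batch_eq_map _ ((hb l).trans hm), batch_eq_map _ (hb l), Finset.card_map,
      Finset.card_map]
  · rw [batch_eq_map _ ((hb l).trans hm), batch_eq_map _ (hb l), Finset.sum_map, Finset.sum_map]
    refine Finset.sum_congr rfl fun r _ => ?_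
    have e : ω.1 i (drawnIdx (ω.2.1 i) ((hb l).trans hm) r) =
        (initPart (T₀ * L * h.m₀) ω).1 i
          (drawnIdx ((1 : Fin n → Equiv.Perm (Fin (T₀ * L * h.m₀))) i) (hb l) r) := by
      rw [← drawn_eq (ω.1 i) (ω.2.1 i) ((hb l).trans hm) r]
      change _ = drawn (ω.1 i) (ω.2.1 i) (drawnIdx 1 (hb l) r : Fin (T₀ * L * h.m₀))
      rw [val_drawnIdx_one]
    simp only [responses, e]

variable {Bst : Mat d k} {Wst : Matrix (Fin n) (Fin k) ℝ} {μ s₁ s_k κ : ℝ} {C : ℝ}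
  {h : Hyper} {NV : Finset (EuclideanSpace ℝ (Fin k))} {NE : Finset (EuclideanSpace ℝ (Fin d))}

lemma iterate_zero [NeZero T₀] (ω : Randomness n m d k T₀ L T) :
    iterate h Bst Wst ω 0 = initialization h Bst Wst ω := Fin.induction_zero _ _

lemma iterate_succ [NeZero T₀] (ω : Randomness n m d k T₀ L T) (t : Fin T) :
    iterate h Bst Wst ω t.succ = qrQ (iterate h Bst Wst ω t.castSucc -
        h.ηg • gaussMech h.ζg h.σg
      (fun i => client (ω.1 i) (responses Bst Wst ω.1 i)
        (batch (ω.2.1 i) (T₀ * L * h.m₀ + 2 * (t : ℕ) * h.mbar) h.mbar)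
        (batch (ω.2.1 i) (T₀ * L * h.m₀ + (2 * (t : ℕ) + 1) * h.mbar) h.mbar)
        (iterate h Bst Wst ω t.castSucc))
      (Matrix.of (ω.2.2.2.2 t))) := by
  unfold iterate
  rw [Fin.induction_succ]

lemma roundPart_fst (N l : ℕ) (ω : Randomness n m d k T₀ L T) (t : Fin T) (i : Fin n)
    (hm : N + 2 * t * l + l ≤ m) :
    (roundPart N l ω t).1 i = fun r => ω.1 i (drawnIdx (ω.2.1 i) hm r) := by
  funext r
  rw [← drawn_eq (ω.1 i) (ω.2.1 i) hm r]
  rfl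

lemma roundPart_snd (N l : ℕ) (ω : Randomness n m d k T₀ L T) (t : Fin T) (i : Fin n)
    (hm : N + (2 * t + 1) * l + l ≤ m) :
    (roundPart N l ω t).2.1 i = fun r => ω.1 i (drawnIdx (ω.2.1 i) hm r) := by
  funext r
  rw [← drawn_eq (ω.1 i) (ω.2.1 i) hm r]
  rfl

/-- As long as no round fails, the iterates follow the explicit trajectory. -/
lemma Regime.iterate_eq_traj [NeZero T₀] (r : Regime Bst Wst μ s₁ s_k κ C h)
    (hNV : IsHalfNet NV) (hNE : IsHalfNet NE) (ω : Randomness n m d k T₀ L T)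
    (hm : T₀ * L * h.m₀ + 2 * T * h.mbar ≤ m)
    (hB : (initialization h Bst Wst ω)ᵀ * initialization h Bst Wst ω = 1)
    (hD : angleDist (initialization h Bst Wst ω) Bst ≤ 0.2)
    (hgood : ∀ t : Fin T, ¬ BadStep h Bst Wst μ s_k κ C NV NE
      (traj (roundStep h Bst Wst) (initialization h Bst Wst ω)
        (roundPart (T₀ * L * h.m₀) h.mbar ω) t.castSucc) (roundPart (T₀ * L * h.m₀) h.mbar ω t))
    (t : Fin (T + 1)) :
    iterate h Bst Wst ω t = traj (roundStep h Bst Wst) (initialization h Bst Wst ω)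
        (roundPart (T₀ * L * h.m₀) h.mbar ω) t := by
  induction t using Fin.induction with
  | zero => rw [iterate_zero, traj_zero]
  | succ t ih =>
    have hiso := (r.traj_bound hNV hNE hB hD hgood t.castSucc).1
    have hg := hgood t
    rw [traj_succ, ← ih]
    rw [← ih] at hiso hg
    rw [iterate_succ]
    set B := iterate h Bst Wst ω t.castSucc
    have hgs : GoodStep Bst Wst μ s_k κ C NV NE B (roundPart (T₀ * L * h.m₀) h.mbar ω t) :=
      not_not.1 fun h' => hg ⟨hiso, h'⟩
    have hm2 : T₀ * L * h.m₀ + (2 * (t : ℕ) + 1) * h.mbar + h.mbar ≤ m := by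
      have : (2 * (t : ℕ) + 1 + 1) * h.mbar ≤ 2 * T * h.mbar :=
        Nat.mul_le_mul_right _ (by omega)
      rw [add_mul _ 1, one_mul] at this; omega
    have hm1 : T₀ * L * h.m₀ + 2 * (t : ℕ) * h.mbar + h.mbar ≤ m := by
      have : (2 * (t : ℕ) + 1) * h.mbar = 2 * t * h.mbar + h.mbar := by ring
      omega
    unfold roundStep rawStep
    congr 4
    funext i
    have hM := isUnit_gramMat r.batch_pos hNV hiso (hgs.1 i)
    rw [batch_eq_map _ hm1, batch_eq_map _ hm2, roundPart_fst _ _ _ _ _ hm1,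
      roundPart_snd _ _ _ _ _ hm2]
    rw [roundPart_fst _ _ _ _ _ hm1] at hM
    exact client_eq_gradOf r.batch_pos (ω.1 i) _ _ (Wst i) hM

end Run

/-! ### Utility of the main loop -/

section Utility

variable {n m d k T₀ L T : ℕ}

/-- A `Q`-factor whose columns span a space close to a `k`-dimensional one has full rank. -/
lemma qrQ_isometry_of_angleDist_lt_one {Bst : Mat d k} (hBst : Bstᵀ * Bst = 1) {A : Mat d k}
    (h : angleDist (qrQ A) Bst < 1) : (qrQ A)ᵀ * qrQ A = 1 := by
  set Q := op (qrQ A) with hQ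
  have h1 : Function.Injective (adjoint Q ∘L op Bst) := by
    rw [injective_iff_map_eq_zero]
    intro u hu
    have h2 := norm_residual_le_angleDist (qrQ A) Bst u
    rw [residual_apply, show adjoint (op (qrQ A)) (op Bst u) = 0 from hu, map_zero, sub_zero,
      norm_isometry (inner_op_of_isometry hBst)] at h2
    by_contra h0
    have := norm_pos_iff.2 h0
    nlinarith
  have h2 : Function.Surjective (adjoint Q ∘L op Bst) :=
    LinearMap.injective_iff_surjective (f := (adjoint Q ∘L op Bst).toLinearMap).1 h1
  have h3 : Function.Injective Q := by
    rw [injective_iff_map_eq_zero]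
    intro u hu
    obtain ⟨v, hv⟩ := h2 u
    have : inner ℝ u u = 0 := by
      nth_rw 2 [← hv]
      rw [ContinuousLinearMap.comp_apply, adjoint_inner_right, hu, inner_zero_left]
    exact inner_self_eq_zero.1 this
  refine qrQ_isometry ?_
  have h4 : LinearMap.range Q.toLinearMap = LinearMap.range (op A).toLinearMap :=
    SetLike.coe_injective (range_op_qrQ A)
  have h5 := LinearMap.finrank_range_add_finrank_ker Q.toLinearMap
  have h6 := LinearMap.finrank_range_add_finrank_ker (op A).toLinearMap
  rw [LinearMap.ker_eq_bot.2 h3, finrank_bot, h4] at h5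
  exact LinearMap.ker_eq_bot.1 (Submodule.finrank_eq_zero.1 (by omega) :
    LinearMap.ker (op A).toLinearMap = ⊥)

lemma exists_ppm_eq_qrQ (σ₀ ζ₀ : ℝ) (X : Inputs n m d) (y : Fin n → Fin m → ℝ)
    (S : Fin n → Fin L → Finset (Fin m)) (X0 : Mat d k) (W : Fin L → Mat d k) :
    ∃ A, ppm σ₀ ζ₀ X y S X0 W = qrQ A := by
  unfold ppm
  induction Fin.last L using Fin.induction with
  | zero => exact ⟨_, rfl⟩
  | succ l ih => exact ⟨_, Fin.induction_succ _ _ l⟩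

variable [NeZero T₀]

lemma exists_initialization_eq_qrQ (h : Hyper) (Bst : Mat d k) (Wst : Matrix (Fin n) (Fin k) ℝ)
    (ω : Randomness n m d k T₀ L T) : ∃ A, initialization h Bst Wst ω = qrQ A :=
  exists_ppm_eq_qrQ _ _ _ _ _ _ _

lemma exists_output_eq_qrQ (h : Hyper) (Bst : Mat d k) (Wst : Matrix (Fin n) (Fin k) ℝ)
    (ω : Randomness n m d k T₀ L T) : ∃ A, output h Bst Wst ω = qrQ A := by
  unfold output
  obtain _ | T := T
  · exact exists_initialization_eq_qrQ h Bst Wst ω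
  · exact ⟨_, iterate_succ ω (Fin.last T)⟩

variable {Bst : Mat d k} {Wst : Matrix (Fin n) (Fin k) ℝ} {μ s₁ s_k κ C : ℝ} {h : Hyper}
  {NV : Finset (EuclideanSpace ℝ (Fin k))} {NE : Finset (EuclideanSpace ℝ (Fin d))}

namespace Regime

variable (r : Regime Bst Wst μ s₁ s_k κ C h)

include r

lemma noiseLevel_pos : 0 < noiseLevel n d h := by
  have := r.n_pos; have := r.d_pos; have := r.k_pos; have := r.log_pos; have := r.μ_pos
  have := r.s_k_pos; have := r.s₁_pos; have := r.σ_pos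
  have : 0 < C := by have := r.one_le_L; linarith
  unfold noiseLevel
  rw [r.ζ_eq, r.η_eq]
  positivity

/-- After the prescribed number of rounds the geometric term is below the noise floor. -/
lemma pow_le (hT : 20 * κ ^ 2 * Real.log (n / (κ ^ 2 * h.ηg * h.σg * h.ζg * √d)) ≤ T) :
    (1 - 0.05 / κ ^ 2) ^ T ≤ κ ^ 2 * noiseLevel n d h := by
  have hκ : 0 < κ := by have := r.one_le_κ; linarith
  have hν : 0 < κ ^ 2 * noiseLevel n d h := mul_pos (by positivity) r.noiseLevel_pos
  have e : (n : ℝ) / (κ ^ 2 * h.ηg * h.σg * h.ζg * √d) = (κ ^ 2 * noiseLevel n d h)⁻¹ := by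
    unfold noiseLevel
    rw [← mul_div_assoc, inv_div]
    congr 1; ring
  rw [e, Real.log_inv] at hT
  have h1 : 1 - 0.05 / κ ^ 2 ≤ Real.exp (-(0.05 / κ ^ 2)) := by
    have := Real.add_one_le_exp (-(0.05 / κ ^ 2)); linarith
  have h0 : 0 ≤ 1 - 0.05 / κ ^ 2 := by
    rw [sub_nonneg, div_le_one (by positivity)]
    have := one_le_pow₀ (n := 2) r.one_le_κ
    linarith
  calc (1 - 0.05 / κ ^ 2) ^ T ≤ Real.exp (-(0.05 / κ ^ 2)) ^ T := pow_le_pow_left₀ h0 h1 T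
    _ = Real.exp (-(T * (0.05 / κ ^ 2))) := by rw [← Real.exp_nat_mul]; congr 1; ring
    _ ≤ Real.exp (Real.log (κ ^ 2 * noiseLevel n d h)) := by
        refine Real.exp_le_exp.2 ?_
        have : 20 * κ ^ 2 * -Real.log (κ ^ 2 * noiseLevel n d h) * (0.05 / κ ^ 2) ≤
            T * (0.05 / κ ^ 2) := mul_le_mul_of_nonneg_right hT (by positivity)
        have h2 : 20 * κ ^ 2 * -Real.log (κ ^ 2 * noiseLevel n d h) * (0.05 / κ ^ 2) =
            -Real.log (κ ^ 2 * noiseLevel n d h) := by field_simp; norm_num; ring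
        linarith
    _ = _ := Real.exp_log hν

/-- If the initialization succeeds and no round fails, the output is at the noise floor. -/
lemma angleDist_output_le (hNV : IsHalfNet NV) (hNE : IsHalfNet NE)
    (ω : Randomness n m d k T₀ L T) (hm : T₀ * L * h.m₀ + 2 * T * h.mbar ≤ m)
    (hT : 20 * κ ^ 2 * Real.log (n / (κ ^ 2 * h.ηg * h.σg * h.ζg * √d)) ≤ T)
    (hD : angleDist (initialization h Bst Wst ω) Bst ≤ 0.2)
    (hgood : ∀ t : Fin T, ¬ BadStep h Bst Wst μ s_k κ C NV NE
      (traj (roundStep h Bst Wst) (initialization h Bst Wst ω)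
        (roundPart (T₀ * L * h.m₀) h.mbar ω) t.castSucc)
      (roundPart (T₀ * L * h.m₀) h.mbar ω t)) :
    angleDist (output h Bst Wst ω) Bst ≤ 3200 * (κ ^ 2 * noiseLevel n d h) := by
  have hB : (initialization h Bst Wst ω)ᵀ * initialization h Bst Wst ω = 1 := by
    obtain ⟨A, hA⟩ := exists_initialization_eq_qrQ h Bst Wst ω
    rw [hA] at hD ⊢
    exact qrQ_isometry_of_angleDist_lt_one r.isometry (hD.trans_lt (by norm_num))
  unfold output
  rw [r.iterate_eq_traj hNV hNE ω hm hB hD hgood]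
  refine (r.traj_bound hNV hNE hB hD hgood (Fin.last T)).2.2.trans ?_
  have h1 := r.pow_le hT
  have h2 : 0 ≤ κ ^ 2 * noiseLevel n d h := mul_nonneg (by positivity) r.noiseLevel_nonneg
  rw [Fin.val_last]
  linarith

/-- Conditioning on the event that the initialization succeeds is harmless: the event depends on data
and noise that the rounds do not use. -/
lemma cond_measure_le {K : ℝ≥0} {p : Fin n → Measure (EuclideanSpace ℝ (Fin d))}
    (hp : ∀ i, IsIsotropicSubgaussian K (p i)) (hC : C = K + 1)
    (hm₁ : 2 ^ 21 * C ^ 4 * (κ ^ 2 * k ^ 2 * Real.log n) ≤ h.mbar)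
    (hm₂ : 2 ^ 21 * C ^ 4 * (μ ^ 4 * k ^ 2 * d / n) ≤ h.mbar)
    (hm : T₀ * L * h.m₀ + 2 * T * h.mbar ≤ m)
    (hT : 20 * κ ^ 2 * Real.log (n / (κ ^ 2 * h.ηg * h.σg * h.ζg * √d)) ≤ T) :
    (ProbabilityTheory.cond (runLaw m k T₀ L T p)
        {ω | angleDist (initialization h Bst Wst ω) Bst ≤ 0.2})
      {ω | 3200 * (κ ^ 2 * noiseLevel n d h) < angleDist (output h Bst Wst ω) Bst} ≤
      ENNReal.ofReal (T * (8 * h.mbar / (n : ℝ) ^ k)) := by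
  have := fun i => (hp i).prob
  obtain ⟨NV, hNV, hNV1, hNV2⟩ := exists_net (EuclideanSpace ℝ (Fin k))
  obtain ⟨NE, hNE, hNE1, hNE2⟩ := exists_net (EuclideanSpace ℝ (Fin d))
  rw [finrank_euclideanSpace, Fintype.card_fin] at hNV hNE
  set N := T₀ * L * h.m₀ with hN
  have mp := measurePreserving_parts (k := k) (T₀ := T₀) (L := L) p N h.mbar hm
  set A' : Set (InitRandomness n d k T₀ L N) := {z | angleDist (initOf h Bst Wst z) Bst ≤ 0.2}
    with hA'
  have hA'm : MeasurableSet A' :=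
    measurableSet_le (measurable_angleDist (measurable_initOf h Bst Wst N) measurable_const)
      measurable_const
  have hinit : ∀ ω : Randomness n m d k T₀ L T,
      initialization h Bst Wst ω = initOf h Bst Wst (initPart N ω) := fun ω =>
    initialization_eq_initOf h Bst Wst ω (by omega)
  have hA : {ω : Randomness n m d k T₀ L T | angleDist (initialization h Bst Wst ω) Bst ≤ 0.2} =
      (fun ω => (initPart N ω, roundPart N h.mbar ω)) ⁻¹' {z | z.1 ∈ A'} := by
    ext ω; simp only [hinit]; rfl
  have hAm : MeasurableSet {z : InitRandomness n d k T₀ L N × (Fin T → StepData n h.mbar d k) |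
      z.1 ∈ A'} := measurable_fst hA'm
  have hμA : runLaw m k T₀ L T p
      {ω | angleDist (initialization h Bst Wst ω) Bst ≤ 0.2} = initLaw k T₀ L N p A' := by
    rw [hA, mp.measure_preimage hAm.nullMeasurableSet, prod_measure_fst fun z => z ∈ A']
    rfl
  have hbad := measure_exists_bad_le (T := T) (P := initLaw k T₀ L N p)
    (measurable_roundStep h Bst Wst) (measurable_badStep (Bst := Bst) (Wst := Wst) (μ := μ)
      (s_k := s_k) (κ := κ) (L := C) (NV := NV) (NE := NE)) (by positivity)
    (r.measure_badStep_le hp hC hm₁ hm₂ hNV hNV1 hNE hNE1) (measurable_initOf h Bst Wst N) hA'm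
  rw [cond_apply (hA ▸ mp.measurable hAm), hμA]
  have hle : runLaw m k T₀ L T p
      ({ω | angleDist (initialization h Bst Wst ω) Bst ≤ 0.2} ∩
        {ω | 3200 * (κ ^ 2 * noiseLevel n d h) < angleDist (output h Bst Wst ω) Bst}) ≤
      ENNReal.ofReal (T * (8 * h.mbar / (n : ℝ) ^ k)) * initLaw k T₀ L N p A' := by
    refine le_trans ?_ hbad
    refine le_trans (measure_mono ?_) (mp.measure_preimage_le _)
    rintro ω ⟨h1, h2⟩
    refine ⟨?_, ?_⟩
    · change angleDist (initOf h Bst Wst (initPart N ω)) Bst ≤ 0.2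
      rw [← hinit]; exact h1
    · by_contra hno
      rw [not_exists] at hno
      simp only [← hinit] at hno
      exact absurd (r.angleDist_output_le hNV2 hNE2 ω hm hT h1 hno) (not_le.2 h2)
  calc (initLaw k T₀ L N p A')⁻¹ * _ ≤ (initLaw k T₀ L N p A')⁻¹ *
        (ENNReal.ofReal (T * (8 * h.mbar / (n : ℝ) ^ k)) * initLaw k T₀ L N p A') := by gcongr
    _ = ENNReal.ofReal (T * (8 * h.mbar / (n : ℝ) ^ k)) *
        ((initLaw k T₀ L N p A')⁻¹ * initLaw k T₀ L N p A') := by ring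
    _ ≤ _ := mul_le_of_le_one_right zero_le (ENNReal.inv_mul_le_one _)

end Regime

end Utility

end Centaur

theorem mainTheorem1 (K : ℝ≥0) :
    ∃ c_m c_ζ c_T c_σ c_p c_d : ℝ,
      0 < c_m ∧ 0 < c_ζ ∧ 0 < c_T ∧ 0 < c_σ ∧ 0 < c_p ∧ 0 < c_d ∧
      ∀ (n m d k : ℕ) (_ : 2 ≤ n) (_ : 1 ≤ k) (_ : k ≤ d)
        -- the laws of the inputs, the ground truth, and the incoherence parameter
        (p : Fin n → Measure (EuclideanSpace ℝ (Fin d)))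
        (_ : ∀ i, Centaur.IsIsotropicSubgaussian K (p i))
        (Bst : Centaur.Mat d k) (_ : Bstᵀ * Bst = 1)
        (Wst : Matrix (Fin n) (Fin k) ℝ) (μ s₁ s_k κ : ℝ)
        (_ : s₁ = Centaur.headSingVal Wst 1) (_ : s_k = Centaur.headSingVal Wst k)
        (_ : 0 < s_k) (_ : κ = s₁ / s_k) (_ : 0 < μ)
        (_ : ∀ i, ‖(WithLp.toLp 2 (Wst i) : EuclideanSpace ℝ (Fin k))‖ ≤ μ * √k * s_k)
        -- the simplifying assumptions on the dimension and on the number of clients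
        (_ : κ ^ 8 * k ^ 3 * Real.log n ≤ d) (_ : m ≤ n)
        -- the numbers of rounds and the hyperparameters
        (T₀ L T_g : ℕ) [NeZero T₀] (h : Centaur.Hyper)
        (_ : T₀ * L * h.m₀ + 2 * T_g * h.mbar ≤ m)
        (_ : c_m * max (κ ^ 2 * k ^ 2 * Real.log n) (μ ^ 4 * k ^ 2 * d / n) ≤ h.mbar)
        (_ : h.ζg = c_ζ * μ ^ 2 * k * s_k ^ 2 * √(d * k * Real.log n))
        (_ : h.ηg = 1 / (4 * s₁ ^ 2))
        (_ : 0 < h.σg)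
        (_ : h.σg ≤ c_σ * n * κ ^ 4 / (μ ^ 2 * d * √(k * Real.log n)))
        (_ : c_T * κ ^ 2 * Real.log (n / (κ ^ 2 * h.ηg * h.σg * h.ζg * √d)) ≤ T_g),
        -- the failure probability, given that the initialization succeeds
        (ProbabilityTheory.cond (Centaur.runLaw m k T₀ L T_g p)
            {ω | Centaur.angleDist (Centaur.initialization h Bst Wst ω) Bst ≤ 0.2})
          {ω | c_d * κ ^ 2 * (h.ηg * h.σg * h.ζg) * √d / n
              < Centaur.angleDist (Centaur.output h Bst Wst ω) Bst}
          ≤ ENNReal.ofReal (c_p * h.mbar * T_g / (n : ℝ) ^ k) ∧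
        -- the explicit form of the bound
        c_d * κ ^ 2 * (h.ηg * h.σg * h.ζg) * √d / n
          = (c_d * c_ζ / 4 * √(Real.log n)) * (h.σg * μ ^ 2 * (k : ℝ) ^ (3 / 2 : ℝ) * d / n) := by
  have hL1 : (1 : ℝ) ≤ K + 1 := le_add_of_nonneg_left K.2
  refine ⟨2 ^ 21 * (K + 1) ^ 4, 4 * (K + 1) ^ 2, 20, 1, 8, 3200, by positivity, by positivity,
    by norm_num, one_pos, by norm_num, by norm_num, ?_⟩
  intro n m d k hn hk hkd p hp Bst hBst Wst μ s₁ s_k κ hs₁ hs_k hs_pos hκ hμ hinc hdim _ T₀ L T _ h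
    hm hmbar hζ hη hσ _ hT
  have hs_le : s_k ≤ s₁ := by rw [hs₁, hs_k]; exact Centaur.headSingVal_antitone hk
  have hs₁_pos : 0 < s₁ := hs_pos.trans_le hs_le
  have hκ1 : 1 ≤ κ := by rw [hκ, one_le_div hs_pos]; exact hs_le
  have hk1 : (1 : ℝ) ≤ k := by exact_mod_cast hk
  have hlog : 0 < Real.log n := Real.log_pos (by exact_mod_cast hn)
  have hbound : 3200 * κ ^ 2 * (h.ηg * h.σg * h.ζg) * √d / n =
      3200 * (κ ^ 2 * Centaur.noiseLevel n d h) := by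
    unfold Centaur.noiseLevel; ring
  refine ⟨?_, ?_⟩
  · rw [hbound]
    by_cases hnoise : 3200 * (κ ^ 2 * Centaur.noiseLevel n d h) ≤ 1
    · have hm₁ : 2 ^ 21 * ((K : ℝ) + 1) ^ 4 * (κ ^ 2 * k ^ 2 * Real.log n) ≤ h.mbar :=
        (mul_le_mul_of_nonneg_left (le_max_left _ _) (by positivity)).trans hmbar
      have hm₂ : 2 ^ 21 * ((K : ℝ) + 1) ^ 4 * (μ ^ 4 * k ^ 2 * d / n) ≤ h.mbar :=
        (mul_le_mul_of_nonneg_left (le_max_right _ _) (by positivity)).trans hmbar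
      have r : Centaur.Regime Bst Wst μ s₁ s_k κ (K + 1) h :=
        { two_le := hn
          one_le := hk
          k_le := hkd
          isometry := hBst
          one_le_L := hL1
          s₁_eq := hs₁
          s_k_eq := hs_k
          s_k_pos := hs_pos
          κ_eq := hκ
          μ_pos := hμ
          incoherent := hinc
          dim := by
            refine le_trans ?_ hdim
            have h1 : (1 : ℝ) ≤ κ ^ 8 := one_le_pow₀ hκ1
            have h2 : (k : ℝ) ≤ (k : ℝ) ^ 3 := le_self_pow₀ hk1 (by norm_num)
            have h3 : 1 * (k : ℝ) ≤ κ ^ 8 * k ^ 3 := by gcongr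
            rw [one_mul] at h3
            exact mul_le_mul_of_nonneg_right h3 hlog.le
          batch_pos := by
            have : (0 : ℝ) < h.mbar := lt_of_lt_of_le (by positivity) hm₁
            exact_mod_cast this
          ζ_eq := hζ
          η_eq := hη
          σ_pos := hσ
          noise := hnoise }
      refine (r.cond_measure_le hp rfl hm₁ hm₂ hm hT).trans (le_of_eq ?_)
      congr 1; ring
    · -- the claimed bound exceeds `1`, which no distance does
      have hempty : {ω : Centaur.Randomness n m d k T₀ L T |
          3200 * (κ ^ 2 * Centaur.noiseLevel n d h) <
            Centaur.angleDist (Centaur.output h Bst Wst ω) Bst} = ∅ := by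
        refine Set.eq_empty_of_forall_notMem fun ω hω => ?_
        obtain ⟨A, hA⟩ := Centaur.exists_output_eq_qrQ h Bst Wst ω
        have h1 := Centaur.angleDist_qrQ_le_one hBst A
        rw [← hA] at h1
        exact absurd (lt_of_lt_of_le hω h1) (not_lt.2 (not_le.1 hnoise).le)
      rw [hempty, measure_empty]
      exact zero_le
  · have hsqrt : √(d * k * Real.log n) * √d = d * √k * √(Real.log n) := by
      rw [Real.sqrt_mul (by positivity), Real.sqrt_mul (by positivity)]
      calc _ = √d * √d * √k * √(Real.log n) := by ring
        _ = _ := by rw [Real.mul_self_sqrt (by positivity)]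
    have hpow : (k : ℝ) ^ (3 / 2 : ℝ) = k * √k := by
      rw [show (3 / 2 : ℝ) = 1 + 1 / 2 by norm_num, Real.rpow_add (by linarith), Real.rpow_one,
        Real.sqrt_eq_rpow]
    have hκη : κ ^ 2 * h.ηg * s_k ^ 2 = 1 / 4 := by
      rw [hκ, hη]; field_simp
    rw [hpow, hζ]
    calc _ = 3200 * (4 * ((K : ℝ) + 1) ^ 2) * (κ ^ 2 * h.ηg * s_k ^ 2) *
          (h.σg * μ ^ 2 * k) * (√(d * k * Real.log n) * √d) / n := by ring
      _ = _ := by rw [hsqrt, hκη]; ring
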